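/- **Setting.** Let $H$ be a Hermitian matrix on $\mathbb C^N$, $0\le\beta<\infty$, and $\sigma_\beta=e^{-\beta H}/\mathrm{Tr}\,e^{-\beta H}$. Let $\mathcal A$ be a finite nonempty set of $N\times N$ matrices, closed under $A\mapsto -A$ and $A\mapsto A^\dagger$, with operator norms $\|A\|\le 1$, and let $g$ be a probability density on $\mathbb R$. For $\sigma>1$ let $$f(t)=\frac{1}{(2\pi)^{1/4}\sigma^{1/2}}e^{-t^2/(4\sigma^2)} .$$ Couple the system to one bath qubit with Hamiltonian $H_E=-\omega Z/2$ and coupling operator $B_E=|1\rangle\langle 0|$, through $$H_\alpha(t)=H+H_E+\alpha f(t)\bigl(A\otimes B_E+A^\dagger\otimes B_E^\dagger\bigr),\qquad U=\mathcal T\exp\Bigl(-i\int_{-T}^{T}H_\alpha(s)\,ds\Bigr),$$ and define the channel $$\Phi_\alpha(\rho)=\mathbb E_{A,\omega}\,\mathrm{Tr}_E\bigl(U(\rho\otimes\rho_E)U^\dagger\bigr),\qquad \rho_E=e^{-\beta H_E}/\mathrm{Tr}\,e^{-\beta H_E},$$ where $A$ is uniform in $\mathcal A$ and $\omega$ is independent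 of $A$ with density $g$. Put $$\gamma(\omega)=\frac{g(\omega)+g(-\omega)}{1+e^{\beta\omega}},\qquad \widetilde\gamma(\omega)=\gamma(\omega)e^{\beta\omega}.$$ The mixing time $\tau_{\rm mix}$ of $\Phi_\alpha$ is the least $t\in\mathbb N$ such that $\|\Phi_\alpha^t(\rho_1)-\Phi_\alpha^t(\rho_2)\|_1\le\frac12\|\rho_1-\rho_2\|_1$ for all density matrices $\rho_1\ne\rho_2$. **Theorem.** For all constants $c_\alpha,c_\beta,c_T,c_\alpha',\kappa>0$ and $\sigma_0>1$ there are $C,m>0$, depending only on these constants, such that the following holds for all $N,H,\mathcal A,g,\alpha,\beta,\sigma,T$ as above. Assume that * $\gamma(\omega)\to0$ as $|\omega|\to\infty$; * $\gamma$ and $\widetilde\gamma$ are locally absolutely continuous with $\gamma',\widetilde\gamma'\in L^1(\mathbb R)$, and $\|\gamma'\|_{L^1}+\|\widetilde\gamma'\|_{L^1}\ge\kappa$; * $\sigma\ge\sigma_0$, $|\alpha|\le c_\alpha\sigma^{-1/2}$, $\sigma\ge c_\beta\beta$ and $T\ge c_T\sigma$. Let $$\mathcal E=\frac{\beta\alpha^2}{\sigma}\bigl(\|\gamma'\|_{L^1}+\|\widetilde\gamma'\|_{L^1}\bigr)\log\sigma+\frac{\alpha^2\sigma^2}{T}e^{-T^2/(4\sigma^2)}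 .$$ Then 1. $\|\Phi_\alpha(\sigma_\beta)-\sigma_\beta\|_1\le C\,\mathcal E$; 2. if $\Phi_\alpha$ has mixing time $\tau_{\rm mix}$, then every density matrix $\rho_{\rm fix}$ with $\Phi_\alpha(\rho_{\rm fix})=\rho_{\rm fix}$ satisfies $\|\rho_{\rm fix}-\sigma_\beta\|_1\le C\,\tau_{\rm mix}\,\mathcal E$; 3. the cumulative coupling satisfies $|\alpha|\int_{-T}^Tf(t)\,dt\le C$, and if moreover $|\alpha|\ge c_\alpha'\sigma^{-1/2}$, then $|\alpha|\int_{-T}^Tf(t)\,dt\ge m$. So it is $\Theta(1)$ when $|\alpha|=\Theta(\sigma^{-1/2})$. -/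

import Mathlib

open scoped Kronecker Matrix ComplexOrder

noncomputable section

/-- The Schatten 1-norm `Tr √(AᴴA)`, i.e. the sum of the square roots of the eigenvalues of
`AᴴA` (counted with multiplicity). -/
def traceNorm {d : Type*} [Fintype d] [DecidableEq d] (A : Matrix d d ℂ) : ℝ :=
  ∑ i, Real.sqrt ((Matrix.isHermitian_conjTranspose_mul_self A).eigenvalues i)

/-- The operator norm of a matrix acting on the Euclidean space. -/
def opNorm {d : Type*} [Fintype d] [DecidableEq d] (A : Matrix d d ℂ) : ℝ :=
  ‖Matrix.toEuclideanCLM (𝕜 := ℂ) A‖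

/-- Density matrices: positive semidefinite with unit trace. -/
def IsDensityMatrix {d : Type*} [Fintype d] (ρ : Matrix d d ℂ) : Prop :=
  ρ.PosSemidef ∧ ρ.trace = 1

/-- The thermal (Gibbs) state `e^{-βH} / Tr e^{-βH}`. -/
def gibbsState {d : Type*} [Fintype d] [DecidableEq d] (β : ℝ) (H : Matrix d d ℂ) :
    Matrix d d ℂ :=
  (NormedSpace.exp ((-β : ℂ) • H)).trace⁻¹ • NormedSpace.exp ((-β : ℂ) • H)

/-- The terms of the Dyson series of `∂ₜ U = -i K(t) U`, `U(t₀) = 1`: the `n`-th term at time `t`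
is `(-i)ⁿ ∫_{t₀ ≤ sₙ ≤ ⋯ ≤ s₁ ≤ t} K(s₁) ⋯ K(sₙ)` (the integral is taken entrywise). -/
def dysonTerm {d : Type*} [Fintype d] [DecidableEq d] (K : ℝ → Matrix d d ℂ) (t₀ : ℝ) :
    ℕ → ℝ → Matrix d d ℂ
  | 0, _ => 1
  | n + 1, t => Matrix.of fun i j =>
      -Complex.I * ∫ s in t₀..t, (K s * dysonTerm K t₀ n s) i j

/-- The time-ordered exponential `𝒯 exp(-i ∫_{t₀}^t K(s) ds)`, as the sum of its Dyson series. -/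
def timeOrderedExp {d : Type*} [Fintype d] [DecidableEq d] (K : ℝ → Matrix d d ℂ) (t₀ t : ℝ) :
    Matrix d d ℂ :=
  ∑' n, dysonTerm K t₀ n t

/-- The Gaussian filter `f(t) = (2π)^{-1/4} σ^{-1/2} exp(-t²/(4σ²))`. -/
def gaussianFilter (σ t : ℝ) : ℝ :=
  1 / ((2 * Real.pi) ^ (1 / 4 : ℝ) * σ ^ (1 / 2 : ℝ)) * Real.exp (-t ^ 2 / (4 * σ ^ 2))

/-- The bath Hamiltonian `H_E = -ω Z / 2` on one qubit. -/
def bathHamiltonian (ω : ℝ) : Matrix (Fin 2) (Fin 2) ℂ :=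
  (-(ω : ℂ) / 2) • !![1, 0; 0, -1]

/-- The bath coupling operator `B_E = (X - iY)/2 = |1⟩⟨0|`. -/
def bathCoupling : Matrix (Fin 2) (Fin 2) ℂ :=
  !![0, 0; 1, 0]

/-- The total Hamiltonian
`H_α(t) = H ⊗ 1 + 1 ⊗ H_E + α f(t) (A ⊗ B_E + A† ⊗ B_E†)` on system ⊗ bath. -/
def totalHamiltonian {d : Type*} [Fintype d] [DecidableEq d] (H A : Matrix d d ℂ)
    (α σ ω t : ℝ) : Matrix (d × Fin 2) (d × Fin 2) ℂ :=
  H ⊗ₖ (1 : Matrix (Fin 2) (Fin 2) ℂ) + (1 : Matrix d d ℂ) ⊗ₖ bathHamiltonian ω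
    + ((α * gaussianFilter σ t : ℝ) : ℂ) • (A ⊗ₖ bathCoupling + Aᴴ ⊗ₖ bathCouplingᴴ)

/-- The partial trace over the bath. -/
def traceBath {d : Type*} (M : Matrix (d × Fin 2) (d × Fin 2) ℂ) : Matrix d d ℂ :=
  Matrix.of fun i j => ∑ k : Fin 2, M (i, k) (j, k)

/-- One system–bath interaction from time `-T` to `T`, for given `A` and `ω`:
`Tr_E (U (ρ ⊗ ρ_E) U†)`, with the bath prepared in its thermal state. -/
def interactionStep {d : Type*} [Fintype d] [DecidableEq d] (H A : Matrix d d ℂ)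
    (α β σ T ω : ℝ) (ρ : Matrix d d ℂ) : Matrix d d ℂ :=
  traceBath
    (timeOrderedExp (totalHamiltonian H A α σ ω) (-T) T
      * (ρ ⊗ₖ gibbsState β (bathHamiltonian ω))
      * (timeOrderedExp (totalHamiltonian H A α σ ω) (-T) T)ᴴ)

/-- The channel `Φ_α`: the expectation of `interactionStep` over `A` uniform in `𝒜` and an
independent bath frequency `ω` with density `g` (entrywise integral). -/
def systemBathChannel {d : Type*} [Fintype d] [DecidableEq d] (H : Matrix d d ℂ)
    (𝒜 : Finset (Matrix d d ℂ)) (g : ℝ → ℝ) (α β σ T : ℝ) (ρ : Matrix d d ℂ) : Matrix d d ℂ :=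
  (𝒜.card : ℂ)⁻¹ • ∑ A ∈ 𝒜,
    Matrix.of fun i j => ∫ ω, (g ω : ℂ) * interactionStep H A α β σ T ω ρ i j

/-- `γ(ω) = (g(ω) + g(-ω)) / (1 + e^{βω})`. -/
def gammaFilter (g : ℝ → ℝ) (β ω : ℝ) : ℝ :=
  (g ω + g (-ω)) / (1 + Real.exp (β * ω))

/-- `γ̃(ω) = γ(ω) e^{βω}`. -/
def gammaTilde (g : ℝ → ℝ) (β ω : ℝ) : ℝ :=
  gammaFilter g β ω * Real.exp (β * ω)

/-- `h` is locally absolutely continuous and its derivative lies in `L¹(ℝ)`. -/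
def HasL1Deriv (h : ℝ → ℝ) : Prop :=
  (∀ a b : ℝ, AbsolutelyContinuousOnInterval h a b) ∧ MeasureTheory.Integrable (deriv h)

/-- `‖h'‖_{L¹}`. -/
def l1NormDeriv (h : ℝ → ℝ) : ℝ :=
  ∫ ω, |deriv h ω|

/-- `τ` is the (integer) mixing time of `Φ`: the least `t` with
`sup_{ρ₁ ≠ ρ₂} ‖Φᵗ ρ₁ - Φᵗ ρ₂‖₁ / ‖ρ₁ - ρ₂‖₁ ≤ 1/2`, over density matrices `ρ₁`, `ρ₂`. -/
def IsMixingTime {d : Type*} [Fintype d] [DecidableEq d] (Φ : Matrix d d ℂ → Matrix d d ℂ)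
    (τ : ℕ) : Prop :=
  IsLeast {t : ℕ | ∀ ρ₁ ρ₂ : Matrix d d ℂ, IsDensityMatrix ρ₁ → IsDensityMatrix ρ₂ → ρ₁ ≠ ρ₂ →
    traceNorm (Φ^[t] ρ₁ - Φ^[t] ρ₂) / traceNorm (ρ₁ - ρ₂) ≤ 1 / 2} τ

/-- The quantity
`(βα²/σ) (‖γ'‖_{L¹} + ‖γ̃'‖_{L¹}) log σ + (α²σ²/T) e^{-T²/(4σ²)}`. -/
def thermalErrorBound (g : ℝ → ℝ) (α β σ T : ℝ) : ℝ :=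
  β * α ^ 2 / σ * ((l1NormDeriv (gammaFilter g β) + l1NormDeriv (gammaTilde g β)) * Real.log σ)
    + α ^ 2 * σ ^ 2 / T * Real.exp (-T ^ 2 / (4 * σ ^ 2))

end

/-!
The thermal state is almost a fixed point of `Φ_α` because, up to the variation of the envelope
`u = α f`, the joint evolution conserves the uncoupled energy `H₀ = H ⊗ 1 + 1 ⊗ H_E`, and the
frequency average suppresses whatever is left at first order in the coupling.

*Energy balance.* Let `S` be the evolution operator in the interaction picture, generated by
`u(t) W(t)` with `W(t) = e^{iωt} W₊(t) + e^{-iωt} W₋(t)`. Duhamel's formula in the inverse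
temperature writes `Tr (O Φ(σ_β)) - Tr (O σ_β)` as an integral over `s ∈ [0, β]` of
`Tr (O e^{-sH₀} [H₀, S] e^{-(β-s)H₀} S†) / Tr e^{-βH₀}`
(`integral_cutExpectation_commutator`). The energy balance turns the commutator `[H₀, S]` into
insertions of `W` along the evolution, with amplitudes `u(±T)` at the ends and `u'` in between
(`freeHamiltonian_commutator_eq`), whose total size is `O(|α| σ^{-1/2})`.

*Averaging.* Resolving the bath into its two basis states separates the dependence on `ω` of the
Gibbs weights into scalar thermal weights `w(ω) = (g(ω) + g(-ω)) e^{pω} / (e^{βω/2} + e^{-βω/2})`,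
`|p| ≤ β / 2` (`cutExpectation_eq_sum`). Here `g` may be symmetrised because exchanging the bath
levels maps `(A, ω)` to `(A†, -ω)` (`interactionStep_conjTranspose_neg`). A single insertion has
zero expectation, because the coupling is off-diagonal in the bath. Each further coupling carries a
phase `e^{±iωt}`, so that the average over `ω` produces the Fourier transform of `w`, which decays
as `(‖γ'‖₁ + ‖γ̃'‖₁) / |t|`; integrating it against `|u| ≤ |α| σ^{-1/2}` over times up to `σ` gives
a second factor `|α| σ^{-1/2} (‖γ'‖₁ + ‖γ̃'‖₁) log σ`
(`integral_coupling_mul_weightFourier_le`). All orders of the coupling are summed by a Grönwall-type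
induction for arbitrary bounded bilinear forms (`norm_average_insertedCommutator_le`), which costs a
factor depending only on `∫ |u| ≤ 4 c_α`. Altogether the first term of the error bound alone
controls `‖Φ_α(σ_β) - σ_β‖₁`.

*Fixed points.* The channel is linear and contracts the trace norm
(`traceNorm_systemBathChannel_le`), so that after `τ_mix` steps the drift of `σ_β` has grown at most
linearly while its distance to a fixed point has been halved (`traceNorm_sub_le_of_halving`).
-/

/-! ### Averaging over the frequency along a pair of propagators -/

noncomputable section Averaging

open MeasureTheory intervalIntegral Filter Topology

/-- The unimodular phase `e^{ix}`. -/
def phase (x : ℝ) : ℂ := Complex.exp (x * Complex.I)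

lemma norm_phase (x : ℝ) : ‖phase x‖ = 1 := Complex.norm_exp_ofReal_mul_I x

lemma phase_add (x y : ℝ) : phase (x + y) = phase x * phase y := by
  simp [phase, add_mul, Complex.exp_add]

@[fun_prop]
lemma continuous_phase : Continuous phase := by unfold phase; fun_prop

/-- The (unnormalised) Fourier transform `ŵ(c) = ∫ w(ω) e^{icω} dω` of a frequency weight. -/
def weightFourier (w : ℝ → ℂ) (c : ℝ) : ℂ := ∫ ω, w ω * phase (c * ω)

lemma integrable_weight_mul {w : ℝ → ℂ} (hw : Integrable w) {F : ℝ → ℂ} (hF : Continuous F)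
    {B : ℝ} (hB : ∀ ω, ‖F ω‖ ≤ B) : Integrable fun ω => w ω * F ω :=
  hw.mul_bdd hF.aestronglyMeasurable (.of_forall hB)

lemma continuous_integral_weight {w : ℝ → ℂ} (hw : Integrable w) {F : ℝ → ℝ → ℂ}
    (hF : Continuous (Function.uncurry F)) {B : ℝ} (hB : ∀ s ω, ‖F s ω‖ ≤ B) :
    Continuous fun s => ∫ ω, w ω * F s ω := by
  refine continuous_of_dominated (bound := fun ω => ‖w ω‖ * B) (fun s => ?_) (fun s => ?_)
    (hw.norm.mul_const B) (.of_forall fun ω => ?_)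
  · exact (integrable_weight_mul hw (F := F s) (by fun_prop) (hB s)).aestronglyMeasurable
  · refine .of_forall fun ω => ?_
    rw [norm_mul]
    exact mul_le_mul_of_nonneg_left (hB s ω) (norm_nonneg _)
  · have : Continuous fun s => F s ω := by fun_prop
    fun_prop

lemma continuous_weightFourier {w : ℝ → ℂ} (hw : Integrable w) : Continuous (weightFourier w) :=
  continuous_integral_weight hw (F := fun c ω => phase (c * ω)) (by fun_prop)
    (fun _ _ => (norm_phase _).le)

lemma integral_add_sub_sub {f₁ f₂ f₃ f₄ : ℝ → ℂ} (h₁ : Integrable f₁) (h₂ : Integrable f₂)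
    (h₃ : Integrable f₃) (h₄ : Integrable f₄) :
    ∫ x, (f₁ x + f₂ x - f₃ x - f₄ x) =
      (∫ x, f₁ x) + (∫ x, f₂ x) - (∫ x, f₃ x) - ∫ x, f₄ x := by
  have h := MeasureTheory.integral_sub ((h₁.add h₂).sub h₃) h₄
  rw [MeasureTheory.integral_sub' (h₁.add h₂) h₃, MeasureTheory.integral_add' h₁ h₂] at h
  exact h

lemma integral_sub_add {f₁ f₂ f₃ : ℝ → ℂ} (h₁ : Integrable f₁) (h₂ : Integrable f₂)
    (h₃ : Integrable f₃) :
    ∫ x, (f₁ x - f₂ x + f₃ x) = (∫ x, f₁ x) - (∫ x, f₂ x) + ∫ x, f₃ x := by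
  have h := MeasureTheory.integral_add (h₁.sub h₂) h₃
  rw [MeasureTheory.integral_sub' h₁ h₂] at h
  exact h

lemma integral_weight_intervalIntegral_swap {w : ℝ → ℂ} (hw : Integrable w) {F : ℝ → ℝ → ℂ}
    (hF : Continuous (Function.uncurry F)) {B a b : ℝ} (hab : a ≤ b)
    (hB : ∀ s ∈ Set.Icc a b, ∀ ω, ‖F s ω‖ ≤ B) :
    ∫ ω, w ω * ∫ s in a..b, F s ω = ∫ s in a..b, ∫ ω, w ω * F s ω := by
  simp only [integral_of_le hab, ← MeasureTheory.integral_const_mul]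
  refine integral_integral_swap ?_
  have h1 : Integrable (fun p : ℝ × ℝ => w p.1 * (1 : ℂ))
      (volume.prod (volume.restrict (Set.Ioc a b))) := hw.mul_prod (integrable_const 1)
  have hc : Continuous fun p : ℝ × ℝ => F p.2 p.1 := by fun_prop
  have h2 := h1.mul_bdd (c := B) (g := fun p : ℝ × ℝ => F p.2 p.1) hc.aestronglyMeasurable ?_
  · simpa [Function.uncurry_def] using h2
  · rw [Measure.ae_prod_iff_ae_ae]
    · refine .of_forall fun ω => ?_
      filter_upwards [ae_restrict_mem measurableSet_Ioc] with s hs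
      exact hB s ⟨hs.1.le, hs.2⟩ ω
    · exact measurableSet_le (by fun_prop) measurable_const

variable {𝔐 : Type*} [NormedRing 𝔐] [NormedAlgebra ℂ 𝔐]

/-- The bilinear form `(x, y) ↦ b (a * x) y`. -/
def formMulLeft (b : 𝔐 →L[ℂ] 𝔐 →L[ℂ] ℂ) (a : 𝔐) : 𝔐 →L[ℂ] 𝔐 →L[ℂ] ℂ :=
  b.comp (ContinuousLinearMap.mul ℂ 𝔐 a)

/-- The bilinear form `(x, y) ↦ b x (y * a)`. -/
def formMulRight (b : 𝔐 →L[ℂ] 𝔐 →L[ℂ] ℂ) (a : 𝔐) : 𝔐 →L[ℂ] 𝔐 →L[ℂ] ℂ :=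
  (b.flip.comp ((ContinuousLinearMap.mul ℂ 𝔐).flip a)).flip

@[simp] lemma formMulLeft_apply (b : 𝔐 →L[ℂ] 𝔐 →L[ℂ] ℂ) (a x y : 𝔐) :
    formMulLeft b a x y = b (a * x) y := rfl

@[simp] lemma formMulRight_apply (b : 𝔐 →L[ℂ] 𝔐 →L[ℂ] ℂ) (a x y : 𝔐) :
    formMulRight b a x y = b x (y * a) := rfl

lemma norm_form_apply_le {b : 𝔐 →L[ℂ] 𝔐 →L[ℂ] ℂ} (hb : ‖b‖ ≤ 1) (x y : 𝔐) :
    ‖b x y‖ ≤ ‖x‖ * ‖y‖ := by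
  refine (b.le_opNorm₂ x y).trans ?_
  have := mul_le_mul_of_nonneg_right hb (mul_nonneg (norm_nonneg x) (norm_nonneg y))
  linarith [mul_assoc ‖b‖ ‖x‖ ‖y‖]

lemma norm_formMulLeft_le {b : 𝔐 →L[ℂ] 𝔐 →L[ℂ] ℂ} (hb : ‖b‖ ≤ 1) {a : 𝔐} (ha : ‖a‖ ≤ 1) :
    ‖formMulLeft b a‖ ≤ 1 := by
  refine ContinuousLinearMap.opNorm_le_bound₂ _ zero_le_one fun x y => ?_
  rw [formMulLeft_apply, one_mul]
  refine (norm_form_apply_le hb _ _).trans ?_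
  refine mul_le_mul_of_nonneg_right ((norm_mul_le _ _).trans ?_) (norm_nonneg _)
  exact mul_le_of_le_one_left (norm_nonneg _) ha

lemma norm_formMulRight_le {b : 𝔐 →L[ℂ] 𝔐 →L[ℂ] ℂ} (hb : ‖b‖ ≤ 1) {a : 𝔐} (ha : ‖a‖ ≤ 1) :
    ‖formMulRight b a‖ ≤ 1 := by
  refine ContinuousLinearMap.opNorm_le_bound₂ _ zero_le_one fun x y => ?_
  rw [formMulRight_apply, one_mul]
  refine (norm_form_apply_le hb _ _).trans ?_
  refine mul_le_mul_of_nonneg_left ((norm_mul_le _ _).trans ?_) (norm_nonneg _)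
  exact mul_le_of_le_one_right (norm_nonneg _) ha

/-- The weighted average `∫ w(ω) e^{icω} b(P(t,ω), R(t,ω)) dω`. -/
def formAverage (w : ℝ → ℂ) (P R : ℝ → ℝ → 𝔐) (b : 𝔐 →L[ℂ] 𝔐 →L[ℂ] ℂ) (c t : ℝ) : ℂ :=
  ∫ ω, w ω * (phase (c * ω) * b (P t ω) (R t ω))

/-- The interaction `e^{iωt} W₊(t) + e^{-iωt} W₋(t)`. -/
def rotatingCoupling (Wp Wm : ℝ → 𝔐) (t ω : ℝ) : 𝔐 :=
  phase (t * ω) • Wp t + phase (-t * ω) • Wm t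

/-- `P' = -i u W P` and `R' = i u R W`, jointly continuous and bounded by one, for the coupling
`W = e^{iωt} W₊ + e^{-iωt} W₋` and the envelope `u`. -/
structure IsPropagatorPair (u : ℝ → ℝ) (Wp Wm : ℝ → 𝔐) (P R : ℝ → ℝ → 𝔐) : Prop where
  continuous_left : Continuous (Function.uncurry P)
  continuous_right : Continuous (Function.uncurry R)
  norm_left_le : ∀ t ω, ‖P t ω‖ ≤ 1
  norm_right_le : ∀ t ω, ‖R t ω‖ ≤ 1
  hasDerivAt_left : ∀ t ω, HasDerivAt (fun t => P t ω)
    ((-(Complex.I * u t)) • (rotatingCoupling Wp Wm t ω * P t ω)) t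
  hasDerivAt_right : ∀ t ω, HasDerivAt (fun t => R t ω)
    ((Complex.I * u t) • (R t ω * rotatingCoupling Wp Wm t ω)) t

/-- A coupling with continuous components of norm at most one. -/
structure IsUnitCoupling (Wp Wm : ℝ → 𝔐) : Prop where
  continuous_plus : Continuous Wp
  continuous_minus : Continuous Wm
  norm_plus_le : ∀ t, ‖Wp t‖ ≤ 1
  norm_minus_le : ∀ t, ‖Wm t‖ ≤ 1

variable {u : ℝ → ℝ} {Wp Wm : ℝ → 𝔐} {P R : ℝ → ℝ → 𝔐}

lemma norm_phase_mul_form_le (h : IsPropagatorPair u Wp Wm P R) {b : 𝔐 →L[ℂ] 𝔐 →L[ℂ] ℂ}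
    (hb : ‖b‖ ≤ 1) (c t ω : ℝ) : ‖phase (c * ω) * b (P t ω) (R t ω)‖ ≤ 1 := by
  rw [norm_mul, norm_phase, one_mul]
  refine (norm_form_apply_le hb _ _).trans ?_
  exact mul_le_one₀ (h.norm_left_le t ω) (norm_nonneg _) (h.norm_right_le t ω)

lemma continuous_form (h : IsPropagatorPair u Wp Wm P R) (b : 𝔐 →L[ℂ] 𝔐 →L[ℂ] ℂ) :
    Continuous fun p : ℝ × ℝ => b (P p.1 p.2) (R p.1 p.2) := by
  have h1 := h.continuous_left
  have h2 := h.continuous_right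
  have h3 : Continuous fun p : ℝ × ℝ => P p.1 p.2 := h1
  have h4 : Continuous fun p : ℝ × ℝ => R p.1 p.2 := h2
  fun_prop

lemma integrable_formAverage {w : ℝ → ℂ} (hw : Integrable w) (h : IsPropagatorPair u Wp Wm P R)
    {b : 𝔐 →L[ℂ] 𝔐 →L[ℂ] ℂ} (hb : ‖b‖ ≤ 1) (c t : ℝ) :
    Integrable fun ω => w ω * (phase (c * ω) * b (P t ω) (R t ω)) := by
  refine integrable_weight_mul hw ?_ (norm_phase_mul_form_le h hb c t)
  have := continuous_form h b
  have h3 : Continuous fun ω : ℝ => b (P t ω) (R t ω) :=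
    this.comp (by fun_prop : Continuous fun ω : ℝ => (t, ω))
  exact (by fun_prop : Continuous fun ω => phase (c * ω)).mul h3

lemma norm_formAverage_le {w : ℝ → ℂ} (hw : Integrable w) (h : IsPropagatorPair u Wp Wm P R)
    {b : 𝔐 →L[ℂ] 𝔐 →L[ℂ] ℂ} (hb : ‖b‖ ≤ 1) (c t : ℝ) :
    ‖formAverage w P R b c t‖ ≤ ∫ ω, ‖w ω‖ := by
  refine norm_integral_le_of_norm_le hw.norm (.of_forall fun ω => ?_)
  rw [norm_mul]
  exact mul_le_of_le_one_right (norm_nonneg _) (norm_phase_mul_form_le h hb c t ω)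

lemma hasDerivAt_form (h : IsPropagatorPair u Wp Wm P R) (b : 𝔐 →L[ℂ] 𝔐 →L[ℂ] ℂ) (c t ω : ℝ) :
    HasDerivAt (fun t => phase (c * ω) * b (P t ω) (R t ω))
      (-(Complex.I * u t) *
        (phase ((c + t) * ω) * formMulLeft b (Wp t) (P t ω) (R t ω)
          + phase ((c - t) * ω) * formMulLeft b (Wm t) (P t ω) (R t ω)
          - phase ((c + t) * ω) * formMulRight b (Wp t) (P t ω) (R t ω)
          - phase ((c - t) * ω) * formMulRight b (Wm t) (P t ω) (R t ω))) t := by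
  have hb := (b.bilinearRestrictScalars ℝ).hasFDerivAt_of_bilinear
    (h.hasDerivAt_left t ω).hasFDerivAt (h.hasDerivAt_right t ω).hasFDerivAt
  have h2 : HasDerivAt (fun t => phase (c * ω) * b (P t ω) (R t ω)) _ t :=
    (hb.hasDerivAt).const_mul (phase (c * ω))
  refine h2.congr_deriv ?_
  have e1 : phase ((c + t) * ω) = phase (c * ω) * phase (t * ω) := by
    rw [← phase_add]; ring_nf
  have e2 : phase ((c - t) * ω) = phase (c * ω) * phase (-t * ω) := by
    rw [← phase_add]; ring_nf
  rw [e1, e2]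
  simp [rotatingCoupling, add_mul, mul_add]
  ring

/-- The Duhamel formula for averages: differentiating a propagator inserts a coupling operator
into the form and shifts the frequency by the time of the insertion. -/
lemma formAverage_sub_eq {w : ℝ → ℂ} (hw : Integrable w) (hu : Continuous u)
    (hW : IsUnitCoupling Wp Wm) (h : IsPropagatorPair u Wp Wm P R) {b : 𝔐 →L[ℂ] 𝔐 →L[ℂ] ℂ}
    (hb : ‖b‖ ≤ 1) (c : ℝ) {r t : ℝ} (hrt : r ≤ t) :
    formAverage w P R b c t - formAverage w P R b c r =
      ∫ s in r..t, -(Complex.I * u s) *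
        (formAverage w P R (formMulLeft b (Wp s)) (c + s) s
          + formAverage w P R (formMulLeft b (Wm s)) (c - s) s
          - formAverage w P R (formMulRight b (Wp s)) (c + s) s
          - formAverage w P R (formMulRight b (Wm s)) (c - s) s) := by
  set F : ℝ → ℝ → ℂ := fun s ω => -(Complex.I * u s) *
        (phase ((c + s) * ω) * formMulLeft b (Wp s) (P s ω) (R s ω)
          + phase ((c - s) * ω) * formMulLeft b (Wm s) (P s ω) (R s ω)
          - phase ((c + s) * ω) * formMulRight b (Wp s) (P s ω) (R s ω)
          - phase ((c - s) * ω) * formMulRight b (Wm s) (P s ω) (R s ω)) with hF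
  have hP : Continuous fun p : ℝ × ℝ => P p.1 p.2 := h.continuous_left
  have hR : Continuous fun p : ℝ × ℝ => R p.1 p.2 := h.continuous_right
  have hWp := hW.continuous_plus
  have hWm := hW.continuous_minus
  have hFc : Continuous (Function.uncurry F) := by
    simp only [Function.uncurry_def, hF, formMulLeft_apply, formMulRight_apply]
    fun_prop
  have hpl : ∀ s ω, ‖phase ((c + s) * ω) * formMulLeft b (Wp s) (P s ω) (R s ω)‖ ≤ 1 :=
    fun s ω => norm_phase_mul_form_le h (norm_formMulLeft_le hb (hW.norm_plus_le s)) _ _ _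
  have hml : ∀ s ω, ‖phase ((c - s) * ω) * formMulLeft b (Wm s) (P s ω) (R s ω)‖ ≤ 1 :=
    fun s ω => norm_phase_mul_form_le h (norm_formMulLeft_le hb (hW.norm_minus_le s)) _ _ _
  have hpr : ∀ s ω, ‖phase ((c + s) * ω) * formMulRight b (Wp s) (P s ω) (R s ω)‖ ≤ 1 :=
    fun s ω => norm_phase_mul_form_le h (norm_formMulRight_le hb (hW.norm_plus_le s)) _ _ _
  have hmr : ∀ s ω, ‖phase ((c - s) * ω) * formMulRight b (Wm s) (P s ω) (R s ω)‖ ≤ 1 :=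
    fun s ω => norm_phase_mul_form_le h (norm_formMulRight_le hb (hW.norm_minus_le s)) _ _ _
  obtain ⟨B, hB⟩ := isCompact_Icc.exists_bound_of_continuousOn (s := Set.Icc r t) hu.continuousOn
  have hFB : ∀ s ∈ Set.Icc r t, ∀ ω, ‖F s ω‖ ≤ B * 4 := fun s hs ω => by
    have h1 : ‖-(Complex.I * (u s : ℂ))‖ ≤ B := by
      rw [norm_neg, norm_mul, Complex.norm_I, one_mul, Complex.norm_real]; exact hB s hs
    rw [hF]
    simp only [norm_mul _ (_ - _)]
    refine mul_le_mul h1 ?_ (norm_nonneg _) ((norm_nonneg _).trans h1)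
    refine (norm_sub_le _ _).trans ?_
    have := (norm_sub_le _ _).trans (add_le_add (norm_add_le
      (phase ((c + s) * ω) * formMulLeft b (Wp s) (P s ω) (R s ω))
      (phase ((c - s) * ω) * formMulLeft b (Wm s) (P s ω) (R s ω))) (hpr s ω))
    linarith [hpl s ω, hml s ω, hmr s ω]
  have hftc : ∀ ω, phase (c * ω) * b (P t ω) (R t ω) - phase (c * ω) * b (P r ω) (R r ω)
      = ∫ s in r..t, F s ω := fun ω => by
    refine (integral_eq_sub_of_hasDerivAt (fun s _ => hasDerivAt_form h b c s ω) ?_).symm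
    have : Continuous fun s => F s ω := by fun_prop
    exact this.intervalIntegrable _ _
  rw [formAverage, formAverage, ← MeasureTheory.integral_sub (integrable_formAverage hw h hb c t)
    (integrable_formAverage hw h hb c r)]
  simp only [← mul_sub, hftc]
  rw [integral_weight_intervalIntegral_swap hw hFc hrt hFB]
  refine integral_congr fun s _ => ?_
  have i1 := integrable_formAverage hw h (norm_formMulLeft_le hb (hW.norm_plus_le s)) (c + s) s
  have i2 := integrable_formAverage hw h (norm_formMulLeft_le hb (hW.norm_minus_le s)) (c - s) s
  have i3 := integrable_formAverage hw h (norm_formMulRight_le hb (hW.norm_plus_le s)) (c + s) s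
  have i4 := integrable_formAverage hw h (norm_formMulRight_le hb (hW.norm_minus_le s)) (c - s) s
  simp only [formAverage]
  rw [← integral_add_sub_sub i1 i2 i3 i4, ← MeasureTheory.integral_const_mul]
  refine integral_congr_ae (.of_forall fun ω => ?_)
  simp only [hF]
  ring

/-- Averages are stable along a propagator pair. If at time `r` every average is bounded by the
Fourier transform of the weight up to `δ`, then up to time `T` every average moves by at most
`(2J + Lδ) e^L`, where `L` measures the total coupling and `J` the coupling averaged against the
Fourier transform. The Duhamel formula is iterated; the remainder after `n` steps is `φⁿ/n!`. -/
theorem norm_formAverage_sub_le {w : ℝ → ℂ} (hw : Integrable w) (hu : Continuous u)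
    (hW : IsUnitCoupling Wp Wm) (h : IsPropagatorPair u Wp Wm P R) {r T J δ L : ℝ} (hrT : r ≤ T)
    (hJ0 : 0 ≤ J) (hδ : 0 ≤ δ)
    (hJ : ∀ c, ∫ s in r..T, |u s| * (‖weightFourier w (c + s)‖ + ‖weightFourier w (c - s)‖) ≤ J)
    (hL : 4 * ∫ s in r..T, |u s| ≤ L)
    (hinit : ∀ b : 𝔐 →L[ℂ] 𝔐 →L[ℂ] ℂ, ‖b‖ ≤ 1 → ∀ c,
      ‖formAverage w P R b c r‖ ≤ ‖weightFourier w c‖ + δ)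
    {b : 𝔐 →L[ℂ] 𝔐 →L[ℂ] ℂ} (hb : ‖b‖ ≤ 1) (c : ℝ) :
    ‖formAverage w P R b c T - formAverage w P R b c r‖ ≤ (2 * J + L * δ) * Real.exp L := by
  have hŵ := continuous_weightFourier hw
  set φ : ℝ → ℝ := fun t => 4 * ∫ s in r..t, |u s| with hφ
  have hφd : ∀ t, HasDerivAt φ (4 * |u t|) t := fun t =>
    ((hu.abs.integral_hasStrictDerivAt r t).hasDerivAt).const_mul 4
  have hφc : Continuous φ := continuous_iff_continuousAt.2 fun t => (hφd t).continuousAt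
  have hφ0 : φ r = 0 := by simp [hφ]
  have hφnn : ∀ t ∈ Set.Icc r T, 0 ≤ φ t := fun t ht =>
    mul_nonneg (by norm_num) (integral_nonneg ht.1 fun s _ => abs_nonneg _)
  have hmono : ∀ t ∈ Set.Icc r T, ∀ F : ℝ → ℝ, Continuous F → (∀ s, 0 ≤ F s) →
      ∫ s in r..t, F s ≤ ∫ s in r..T, F s := fun t ht F hF hF0 =>
    integral_mono_interval le_rfl ht.1 ht.2 (.of_forall hF0) (hF.intervalIntegrable _ _)
  have hφL : ∀ t ∈ Set.Icc r T, φ t ≤ L := fun t ht =>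
    (mul_le_mul_of_nonneg_left (hmono t ht _ hu.abs fun s => abs_nonneg _) (by norm_num)).trans hL
  have hL0 : 0 ≤ L := (hφnn r ⟨le_rfl, hrT⟩).trans (hφL r ⟨le_rfl, hrT⟩)
  set K := 2 * J + L * δ with hK
  have hK0 : 0 ≤ K := by positivity
  set B := 2 * ∫ ω, ‖w ω‖ with hB
  have hB0 : 0 ≤ B := mul_nonneg (by norm_num) (integral_nonneg fun _ => norm_nonneg _)
  have key : ∀ n : ℕ, ∀ t ∈ Set.Icc r T, ∀ b : 𝔐 →L[ℂ] 𝔐 →L[ℂ] ℂ, ‖b‖ ≤ 1 → ∀ c,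
      ‖formAverage w P R b c t - formAverage w P R b c r‖
        ≤ K * Real.exp (φ t) + B * (φ t ^ n / n.factorial) := by
    intro n
    induction n with
    | zero =>
      intro t ht b hb c
      have h1 := norm_formAverage_le hw h hb c t
      have h2 := norm_formAverage_le hw h hb c r
      have h3 := norm_sub_le (formAverage w P R b c t) (formAverage w P R b c r)
      have h4 : 0 ≤ K * Real.exp (φ t) := by positivity
      simp only [pow_zero, Nat.factorial_zero, Nat.cast_one, div_one, mul_one]
      linarith
    | succ n ih =>
      intro t ht b hb c
      rw [formAverage_sub_eq hw hu hW h hb c ht.1]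
      set E : ℝ → ℝ := fun s => K * Real.exp (φ s) + B * (φ s ^ n / n.factorial) with hE
      have hstep : ∀ s ∈ Set.Icc r t, ∀ b : 𝔐 →L[ℂ] 𝔐 →L[ℂ] ℂ, ‖b‖ ≤ 1 → ∀ c,
          ‖formAverage w P R b c s‖ ≤ ‖weightFourier w c‖ + δ + E s := fun s hs b hb c => by
        have h1 := ih s ⟨hs.1, hs.2.trans ht.2⟩ b hb c
        have h2 := hinit b hb c
        have h3 := norm_add_le (formAverage w P R b c s - formAverage w P R b c r)
          (formAverage w P R b c r)
        rw [sub_add_cancel] at h3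
        simp only [hE]
        linarith
      have hEc : Continuous E := by fun_prop
      have hbound : ∀ s ∈ Set.Icc r t, ‖-(Complex.I * u s) *
        (formAverage w P R (formMulLeft b (Wp s)) (c + s) s
          + formAverage w P R (formMulLeft b (Wm s)) (c - s) s
          - formAverage w P R (formMulRight b (Wp s)) (c + s) s
          - formAverage w P R (formMulRight b (Wm s)) (c - s) s)‖ ≤
          2 * (|u s| * (‖weightFourier w (c + s)‖ + ‖weightFourier w (c - s)‖))
            + δ * (4 * |u s|) + 4 * |u s| * E s := fun s hs => by
        rw [norm_mul, norm_neg, norm_mul, Complex.norm_I, one_mul, Complex.norm_real,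
          Real.norm_eq_abs]
        have h1 := hstep s hs _ (norm_formMulLeft_le hb (hW.norm_plus_le s)) (c + s)
        have h2 := hstep s hs _ (norm_formMulLeft_le hb (hW.norm_minus_le s)) (c - s)
        have h3 := hstep s hs _ (norm_formMulRight_le hb (hW.norm_plus_le s)) (c + s)
        have h4 := hstep s hs _ (norm_formMulRight_le hb (hW.norm_minus_le s)) (c - s)
        refine (mul_le_mul_of_nonneg_left ((norm_sub_le _ _).trans (add_le_add
          ((norm_sub_le _ _).trans (add_le_add (norm_add_le _ _) h3)) h4)) (abs_nonneg _)).trans ?_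
        refine (mul_le_mul_of_nonneg_left (add_le_add (add_le_add (add_le_add h1 h2) le_rfl) le_rfl)
          (abs_nonneg _)).trans (le_of_eq ?_)
        ring
      have hc1 : Continuous fun s =>
          |u s| * (‖weightFourier w (c + s)‖ + ‖weightFourier w (c - s)‖) := by fun_prop
      refine (norm_integral_le_of_norm_le ht.1 (g := fun s =>
          2 * (|u s| * (‖weightFourier w (c + s)‖ + ‖weightFourier w (c - s)‖))
            + δ * (4 * |u s|) + 4 * |u s| * E s)
          (.of_forall fun s hs => hbound s ⟨hs.1.le, hs.2⟩)
          (Continuous.intervalIntegrable (by fun_prop) _ _)).trans ?_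
      have hint : ∫ s in r..t, 4 * |u s| * E s =
          K * (Real.exp (φ t) - 1) + B * (φ t ^ (n + 1) / (n + 1).factorial) := by
        have hd : ∀ s ∈ Set.uIcc r t, HasDerivAt
            (fun s => K * Real.exp (φ s) + B * (φ s ^ (n + 1) / (n + 1).factorial))
            (4 * |u s| * E s) s := fun s _ => by
          have h1 := ((hφd s).exp.const_mul K).add
            ((((hφd s).pow (n + 1)).div_const ((n + 1).factorial : ℝ)).const_mul B)
          refine h1.congr_deriv ?_
          simp only [hE, Nat.factorial_succ]
          push_cast
          have : (n.factorial : ℝ) ≠ 0 := by positivity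
          field_simp
        rw [integral_eq_sub_of_hasDerivAt hd (Continuous.intervalIntegrable (by fun_prop) _ _)]
        simp [hφ0]
        ring
      rw [integral_add (Continuous.intervalIntegrable (by fun_prop) _ _)
        (Continuous.intervalIntegrable (by fun_prop) _ _),
        integral_add (Continuous.intervalIntegrable (by fun_prop) _ _)
        (Continuous.intervalIntegrable (by fun_prop) _ _), hint]
      simp only [intervalIntegral.integral_const_mul]
      have h1 := (hmono t ht _ hc1 fun s => by positivity).trans (hJ c)
      have h2 : δ * φ t ≤ δ * L := mul_le_mul_of_nonneg_left (hφL t ht) hδ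
      simp only [hφ] at h2
      simp only [hK]
      linarith
  have hlim : Tendsto (fun n : ℕ => K * Real.exp (φ T) + B * (φ T ^ n / n.factorial)) atTop
      (𝓝 (K * Real.exp (φ T) + B * 0)) :=
    ((FloorSemiring.tendsto_pow_div_factorial_atTop (φ T)).const_mul B).const_add _
  have hTT : T ∈ Set.Icc r T := ⟨hrT, le_rfl⟩
  refine (ge_of_tendsto' hlim fun n => key n T hTT b hb c).trans ?_
  rw [mul_zero, add_zero]
  exact mul_le_mul_of_nonneg_left (Real.exp_le_exp.2 (hφL T hTT)) hK0

/-- The constant by which averages with one inserted operator are controlled. -/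
def insertionConst (J L : ℝ) : ℝ :=
  (2 * J + L * (2 * J * Real.exp L)) * Real.exp L + 2 * J * Real.exp L

/-- An average with one operator `M` inserted at time `r` is small as soon as the form vanishes on
`(M, 1)`: without any further coupling the average vanishes, and each further coupling integrates
the Fourier transform of the weight. -/
theorem norm_insertion_average_le {w : ℝ → ℂ} (hw : Integrable w) (hu : Continuous u)
    (hW : IsUnitCoupling Wp Wm) (h : IsPropagatorPair u Wp Wm P R) {a r T J L : ℝ} (har : a ≤ r)
    (hrT : r ≤ T) (hPa : ∀ ω, P a ω = 1) (hRa : ∀ ω, R a ω = 1) (hPR : ∀ t ω, P t ω * R t ω = 1)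
    (hJ0 : 0 ≤ J)
    (hJ : ∀ c, ∫ s in a..T, |u s| * (‖weightFourier w (c + s)‖ + ‖weightFourier w (c - s)‖) ≤ J)
    (hL : 4 * ∫ s in a..T, |u s| ≤ L) {M : 𝔐} (hM : ‖M‖ ≤ 1)
    {b : 𝔐 →L[ℂ] 𝔐 →L[ℂ] ℂ} (hb : ‖b‖ ≤ 1) (hbM : b M 1 = 0) (c : ℝ) :
    ‖∫ ω, w ω * (phase (c * ω) * b (P T ω * R r ω * M * P r ω) (R T ω))‖
      ≤ insertionConst J L := by
  have hŵ := continuous_weightFourier hw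
  have hone : ‖(1 : 𝔐)‖ ≤ 1 := by rw [← hPa 0]; exact h.norm_left_le a 0
  have hsub : ∀ F : ℝ → ℝ, Continuous F → (∀ s, 0 ≤ F s) → ∀ x y, a ≤ x → x ≤ y → y ≤ T →
      ∫ s in x..y, F s ≤ ∫ s in a..T, F s := fun F hF hF0 x y h1 h2 h3 =>
    integral_mono_interval h1 h2 h3 (.of_forall hF0) (hF.intervalIntegrable _ _)
  have hJ' : ∀ x y, a ≤ x → x ≤ y → y ≤ T → ∀ c,
      ∫ s in x..y, |u s| * (‖weightFourier w (c + s)‖ + ‖weightFourier w (c - s)‖) ≤ J :=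
    fun x y h1 h2 h3 c => (hsub _ (by fun_prop) (fun s => by positivity) x y h1 h2 h3).trans (hJ c)
  have hL' : ∀ x y, a ≤ x → x ≤ y → y ≤ T → 4 * ∫ s in x..y, |u s| ≤ L :=
    fun x y h1 h2 h3 => (mul_le_mul_of_nonneg_left (hsub _ hu.abs (fun s => abs_nonneg _) x y
      h1 h2 h3) (by norm_num)).trans hL
  have hstart : ∀ (b : 𝔐 →L[ℂ] 𝔐 →L[ℂ] ℂ) (c : ℝ),
      formAverage w P R b c a = weightFourier w c * b 1 1 := fun b c => by
    simp only [formAverage, weightFourier, hPa, hRa, ← MeasureTheory.integral_mul_const, mul_assoc]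
  have hb11 : ∀ b : 𝔐 →L[ℂ] 𝔐 →L[ℂ] ℂ, ‖b‖ ≤ 1 → ‖b 1 1‖ ≤ 1 := fun b hb =>
    (norm_form_apply_le hb 1 1).trans (mul_le_one₀ hone (norm_nonneg _) hone)
  set δ := 2 * J * Real.exp L with hδ
  have hδ0 : 0 ≤ δ := by positivity
  -- From the initial time to `r`, where the propagators start from the identity.
  have hfirst : ∀ b : 𝔐 →L[ℂ] 𝔐 →L[ℂ] ℂ, ‖b‖ ≤ 1 → ∀ c,
      ‖formAverage w P R b c r - weightFourier w c * b 1 1‖ ≤ δ := fun b hb c => by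
    have h1 := norm_formAverage_sub_le hw hu hW h har hJ0 le_rfl
      (hJ' a r le_rfl har hrT) (hL' a r le_rfl har hrT) (fun b hb c => by
        rw [hstart, norm_mul, add_zero]
        exact mul_le_of_le_one_right (norm_nonneg _) (hb11 b hb)) hb c
    rwa [hstart, mul_zero, add_zero] at h1
  have hPc : Continuous fun p : ℝ × ℝ => P p.1 p.2 := h.continuous_left
  have hRc : Continuous fun p : ℝ × ℝ => R p.1 p.2 := h.continuous_right
  have hPr : Continuous fun p : ℝ × ℝ => P r p.2 :=
    hPc.comp (by fun_prop : Continuous fun p : ℝ × ℝ => (r, p.2))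
  have hRr : Continuous fun p : ℝ × ℝ => R r p.2 :=
    hRc.comp (by fun_prop : Continuous fun p : ℝ × ℝ => (r, p.2))
  -- The propagator with the insertion solves the same equation from time `r` on.
  have hQ : IsPropagatorPair u Wp Wm (fun t ω => P t ω * R r ω * M * P r ω) R :=
    { continuous_left := ((hPc.mul hRr).mul continuous_const).mul hPr
      continuous_right := h.continuous_right
      norm_left_le := fun t ω => by
        refine (norm_mul_le _ _).trans (mul_le_one₀ ?_ (norm_nonneg _) (h.norm_left_le _ _))
        refine (norm_mul_le _ _).trans (mul_le_one₀ ?_ (norm_nonneg _) hM)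
        exact (norm_mul_le _ _).trans
          (mul_le_one₀ (h.norm_left_le _ _) (norm_nonneg _) (h.norm_right_le _ _))
      norm_right_le := h.norm_right_le
      hasDerivAt_left := fun t ω => by
        refine ((((h.hasDerivAt_left t ω).mul_const (R r ω)).mul_const M).mul_const
          (P r ω)).congr_deriv ?_
        simp only [smul_mul_assoc, mul_assoc]
      hasDerivAt_right := h.hasDerivAt_right }
  have hQr : ∀ b : 𝔐 →L[ℂ] 𝔐 →L[ℂ] ℂ, ∀ c,
      formAverage w (fun t ω => P t ω * R r ω * M * P r ω) R b c r =
        formAverage w P R (formMulLeft b M) c r := fun b c => by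
    simp only [formAverage, formMulLeft_apply, hPR, one_mul]
  have hsecond := norm_formAverage_sub_le hw hu hW hQ hrT hJ0 hδ0
      (hJ' r T har hrT le_rfl) (hL' r T har hrT le_rfl) (fun b hb c => by
        rw [hQr]
        have hb' := norm_formMulLeft_le hb hM
        have h1 := hfirst _ hb' c
        have h2 : ‖weightFourier w c * formMulLeft b M 1 1‖ ≤ ‖weightFourier w c‖ := by
          rw [norm_mul]
          exact mul_le_of_le_one_right (norm_nonneg _) (hb11 _ hb')
        have h3 := norm_add_le (formAverage w P R (formMulLeft b M) c r
          - weightFourier w c * formMulLeft b M 1 1) (weightFourier w c * formMulLeft b M 1 1)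
        rw [sub_add_cancel] at h3
        linarith) hb c
  have hthird := hfirst _ (norm_formMulLeft_le hb hM) c
  rw [formMulLeft_apply, mul_one, hbM, mul_zero, sub_zero, ← hQr] at hthird
  have h4 := norm_add_le (formAverage w (fun t ω => P t ω * R r ω * M * P r ω) R b c T
    - formAverage w (fun t ω => P t ω * R r ω * M * P r ω) R b c r)
    (formAverage w (fun t ω => P t ω * R r ω * M * P r ω) R b c r)
  rw [sub_add_cancel] at h4
  exact h4.trans (add_le_add hsecond hthird)

lemma continuous_insertion (hW : IsUnitCoupling Wp Wm) (h : IsPropagatorPair u Wp Wm P R) (T : ℝ) :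
    Continuous fun p : ℝ × ℝ =>
      P T p.2 * R p.1 p.2 * rotatingCoupling Wp Wm p.1 p.2 * P p.1 p.2 := by
  have hP : Continuous fun p : ℝ × ℝ => P p.1 p.2 := h.continuous_left
  have hR : Continuous fun p : ℝ × ℝ => R p.1 p.2 := h.continuous_right
  have hPT : Continuous fun p : ℝ × ℝ => P T p.2 :=
    hP.comp (by fun_prop : Continuous fun p : ℝ × ℝ => (T, p.2))
  have hWp := hW.continuous_plus
  have hWm := hW.continuous_minus
  unfold rotatingCoupling
  fun_prop

lemma norm_rotatingCoupling_le (hW : IsUnitCoupling Wp Wm) (t ω : ℝ) :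
    ‖rotatingCoupling Wp Wm t ω‖ ≤ 2 := by
  refine (norm_add_le _ _).trans ?_
  rw [norm_smul, norm_smul, norm_phase, norm_phase, one_mul, one_mul]
  linarith [hW.norm_plus_le t, hW.norm_minus_le t]

lemma norm_insertion_le (hW : IsUnitCoupling Wp Wm) (h : IsPropagatorPair u Wp Wm P R)
    (T r ω : ℝ) : ‖P T ω * R r ω * rotatingCoupling Wp Wm r ω * P r ω‖ ≤ 2 := by
  refine (norm_mul_le _ _).trans ((mul_le_of_le_one_right (norm_nonneg _)
    (h.norm_left_le r ω)).trans ?_)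
  refine (norm_mul_le _ _).trans ((mul_le_of_le_one_left (norm_nonneg _) ?_).trans
    (norm_rotatingCoupling_le hW r ω))
  exact (norm_mul_le _ _).trans
    (mul_le_one₀ (h.norm_left_le _ _) (norm_nonneg _) (h.norm_right_le _ _))

/-- The average of a form with the coupling inserted at time `r`. -/
lemma norm_coupling_insertion_average_le {w : ℝ → ℂ} (hw : Integrable w) (hu : Continuous u)
    (hW : IsUnitCoupling Wp Wm) (h : IsPropagatorPair u Wp Wm P R) {a r T J L : ℝ} (har : a ≤ r)
    (hrT : r ≤ T) (hPa : ∀ ω, P a ω = 1) (hRa : ∀ ω, R a ω = 1) (hPR : ∀ t ω, P t ω * R t ω = 1)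
    (hJ0 : 0 ≤ J)
    (hJ : ∀ c, ∫ s in a..T, |u s| * (‖weightFourier w (c + s)‖ + ‖weightFourier w (c - s)‖) ≤ J)
    (hL : 4 * ∫ s in a..T, |u s| ≤ L) {b : 𝔐 →L[ℂ] 𝔐 →L[ℂ] ℂ} (hb : ‖b‖ ≤ 1)
    (hbp : ∀ t, b (Wp t) 1 = 0) (hbm : ∀ t, b (Wm t) 1 = 0) :
    ‖∫ ω, w ω * b (P T ω * R r ω * rotatingCoupling Wp Wm r ω * P r ω) (R T ω)‖
      ≤ 2 * insertionConst J L := by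
  have hP : Continuous fun p : ℝ × ℝ => P p.1 p.2 := h.continuous_left
  have hR : Continuous fun p : ℝ × ℝ => R p.1 p.2 := h.continuous_right
  have hsec : ∀ t : ℝ, Continuous fun ω : ℝ => (t, ω) := fun t => by fun_prop
  have hPT : Continuous fun ω => P T ω := hP.comp (hsec T)
  have hRT : Continuous fun ω => R T ω := hR.comp (hsec T)
  have hPr : Continuous fun ω => P r ω := hP.comp (hsec r)
  have hRr : Continuous fun ω => R r ω := hR.comp (hsec r)
  have hint : ∀ (M : 𝔐), ‖M‖ ≤ 1 → ∀ c : ℝ, Integrable fun ω =>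
      w ω * (phase (c * ω) * b (P T ω * R r ω * M * P r ω) (R T ω)) := fun M hM c => by
    refine integrable_weight_mul hw (B := 1) (by fun_prop) fun ω => ?_
    rw [norm_mul, norm_phase, one_mul]
    refine (norm_form_apply_le hb _ _).trans (mul_le_one₀ ?_ (norm_nonneg _) (h.norm_right_le _ _))
    refine (norm_mul_le _ _).trans (mul_le_one₀ ?_ (norm_nonneg _) (h.norm_left_le _ _))
    refine (norm_mul_le _ _).trans (mul_le_one₀ ?_ (norm_nonneg _) hM)
    exact (norm_mul_le _ _).trans
      (mul_le_one₀ (h.norm_left_le _ _) (norm_nonneg _) (h.norm_right_le _ _))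
  have hsplit : ∀ ω, w ω * b (P T ω * R r ω * rotatingCoupling Wp Wm r ω * P r ω) (R T ω) =
      w ω * (phase (r * ω) * b (P T ω * R r ω * Wp r * P r ω) (R T ω)) +
      w ω * (phase (-r * ω) * b (P T ω * R r ω * Wm r * P r ω) (R T ω)) := fun ω => by
    simp only [rotatingCoupling, mul_add, add_mul, mul_smul_comm, smul_mul_assoc, map_add,
      map_smul, add_apply, smul_apply, smul_eq_mul]
  simp only [hsplit]
  rw [MeasureTheory.integral_add (hint _ (hW.norm_plus_le r) r) (hint _ (hW.norm_minus_le r) (-r)),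
    two_mul]
  exact (norm_add_le _ _).trans (add_le_add
    (norm_insertion_average_le hw hu hW h har hrT hPa hRa hPR hJ0 hJ hL (hW.norm_plus_le r) hb
      (hbp r) r)
    (norm_insertion_average_le hw hu hW h har hrT hPa hRa hPR hJ0 hJ hL (hW.norm_minus_le r) hb
      (hbm r) (-r)))

/-- The operator obtained by inserting the coupling with envelope `v` along the evolution, and with
amplitude `y` at the start and `-z` at the end. -/
def insertedCommutator (v : ℝ → ℝ) (y z : ℝ) (Wp Wm : ℝ → 𝔐) (P R : ℝ → ℝ → 𝔐) (a T ω : ℝ) : 𝔐 :=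
  (y : ℂ) • (P T ω * rotatingCoupling Wp Wm a ω) - (z : ℂ) • (rotatingCoupling Wp Wm T ω * P T ω)
    + ∫ r in a..T, (v r : ℂ) • (P T ω * R r ω * rotatingCoupling Wp Wm r ω * P r ω)

lemma norm_insertedCommutator_le (hW : IsUnitCoupling Wp Wm) (h : IsPropagatorPair u Wp Wm P R)
    {v : ℝ → ℝ} (hv : Continuous v) {a T : ℝ} (haT : a ≤ T) (y z ω : ℝ) :
    ‖insertedCommutator v y z Wp Wm P R a T ω‖ ≤ (|y| + |z| + ∫ r in a..T, |v r|) * 2 := by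
  have h1 : ‖(y : ℂ) • (P T ω * rotatingCoupling Wp Wm a ω)‖ ≤ |y| * 2 := by
    rw [norm_smul, Complex.norm_real, Real.norm_eq_abs]
    refine mul_le_mul_of_nonneg_left ?_ (abs_nonneg y)
    exact (norm_mul_le _ _).trans ((mul_le_of_le_one_left (norm_nonneg _)
      (h.norm_left_le _ _)).trans (norm_rotatingCoupling_le hW _ _))
  have h2 : ‖(z : ℂ) • (rotatingCoupling Wp Wm T ω * P T ω)‖ ≤ |z| * 2 := by
    rw [norm_smul, Complex.norm_real, Real.norm_eq_abs]
    refine mul_le_mul_of_nonneg_left ?_ (abs_nonneg z)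
    exact (norm_mul_le _ _).trans ((mul_le_of_le_one_right (norm_nonneg _)
      (h.norm_left_le _ _)).trans (norm_rotatingCoupling_le hW _ _))
  have h3 : ‖∫ r in a..T, (v r : ℂ) • (P T ω * R r ω * rotatingCoupling Wp Wm r ω * P r ω)‖ ≤
      ∫ r in a..T, |v r| * 2 :=
    norm_integral_le_of_norm_le haT (.of_forall fun r _ => by
      rw [norm_smul, Complex.norm_real, Real.norm_eq_abs]
      exact mul_le_mul_of_nonneg_left (norm_insertion_le hW h T r ω) (abs_nonneg _))
      (Continuous.intervalIntegrable (by fun_prop) _ _)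
  rw [intervalIntegral.integral_mul_const] at h3
  refine (norm_add_le _ _).trans ((add_le_add ((norm_sub_le _ _).trans (add_le_add h1 h2)) h3).trans
    (le_of_eq (by ring)))

lemma continuous_insertedCommutator (hW : IsUnitCoupling Wp Wm) (h : IsPropagatorPair u Wp Wm P R)
    {v : ℝ → ℝ} (hv : Continuous v) (a T y z : ℝ) :
    Continuous fun ω => insertedCommutator v y z Wp Wm P R a T ω := by
  have hP : Continuous fun p : ℝ × ℝ => P p.1 p.2 := h.continuous_left
  have hPT : Continuous fun ω : ℝ => P T ω := hP.comp (by fun_prop : Continuous fun ω : ℝ => (T, ω))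
  have hr : ∀ t, Continuous fun ω : ℝ => rotatingCoupling Wp Wm t ω := fun t => by
    unfold rotatingCoupling; fun_prop
  have hra := hr a
  have hrT := hr T
  have hi : Continuous fun ω => ∫ r in a..T,
      (v r : ℂ) • (P T ω * R r ω * rotatingCoupling Wp Wm r ω * P r ω) := by
    refine intervalIntegral.continuous_parametric_intervalIntegral_of_continuous'
      (f := fun ω r => (v r : ℂ) • (P T ω * R r ω * rotatingCoupling Wp Wm r ω * P r ω)) ?_ a T
    have h2 := (continuous_insertion hW h T).comp
      (by fun_prop : Continuous fun p : ℝ × ℝ => (p.2, p.1))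
    have h3 : Continuous fun p : ℝ × ℝ => (v p.2 : ℂ) := by fun_prop
    exact h3.smul h2
  unfold insertedCommutator
  fun_prop

/-- Averages of forms in an inserted commutator: every insertion contributes at most the insertion
constant, times its amplitude. -/
theorem norm_average_insertedCommutator_le [CompleteSpace 𝔐] {w : ℝ → ℂ} (hw : Integrable w)
    (hu : Continuous u)
    (hW : IsUnitCoupling Wp Wm) (h : IsPropagatorPair u Wp Wm P R) {a T J L : ℝ} (haT : a ≤ T)
    (hPa : ∀ ω, P a ω = 1) (hRa : ∀ ω, R a ω = 1) (hPR : ∀ t ω, P t ω * R t ω = 1)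
    (hJ0 : 0 ≤ J)
    (hJ : ∀ c, ∫ s in a..T, |u s| * (‖weightFourier w (c + s)‖ + ‖weightFourier w (c - s)‖) ≤ J)
    (hL : 4 * ∫ s in a..T, |u s| ≤ L) {b : 𝔐 →L[ℂ] 𝔐 →L[ℂ] ℂ} (hb : ‖b‖ ≤ 1)
    (hbp : ∀ t, b (Wp t) 1 = 0) (hbm : ∀ t, b (Wm t) 1 = 0)
    {v : ℝ → ℝ} (hv : Continuous v) (y z : ℝ) :
    ‖∫ ω, w ω * b (insertedCommutator v y z Wp Wm P R a T ω) (R T ω)‖ ≤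
      (|y| + |z| + ∫ r in a..T, |v r|) * (2 * insertionConst J L) := by
  set Q : ℝ → ℝ → ℂ := fun r ω =>
    b (P T ω * R r ω * rotatingCoupling Wp Wm r ω * P r ω) (R T ω) with hQ
  have hR : Continuous fun p : ℝ × ℝ => R p.1 p.2 := h.continuous_right
  have hRT : Continuous fun p : ℝ × ℝ => R T p.2 :=
    hR.comp (by fun_prop : Continuous fun p : ℝ × ℝ => (T, p.2))
  have hins := continuous_insertion hW h T
  have hQc : Continuous (Function.uncurry Q) := by
    have : Continuous fun p : ℝ × ℝ => Q p.1 p.2 := by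
      simp only [hQ]
      fun_prop
    exact this
  have hQb : ∀ r ω, ‖Q r ω‖ ≤ 2 := fun r ω =>
    (norm_form_apply_le hb _ _).trans ((mul_le_of_le_one_right (norm_nonneg _)
      (h.norm_right_le _ _)).trans (norm_insertion_le hW h T r ω))
  have hQi : ∀ r, Integrable fun ω => w ω * Q r ω := fun r =>
    integrable_weight_mul hw (by fun_prop) (hQb r)
  have hQav : ∀ r ∈ Set.Icc a T, ‖∫ ω, w ω * Q r ω‖ ≤ 2 * insertionConst J L := fun r hr =>
    norm_coupling_insertion_average_le hw hu hW h hr.1 hr.2 hPa hRa hPR hJ0 hJ hL hb hbp hbm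
  have hvQb : ∃ B, ∀ r ∈ Set.Icc a T, ∀ ω, ‖(v r : ℂ) * Q r ω‖ ≤ B := by
    obtain ⟨B, hB⟩ := isCompact_Icc.exists_bound_of_continuousOn (s := Set.Icc a T) hv.continuousOn
    refine ⟨B * 2, fun r hr ω => ?_⟩
    rw [norm_mul, Complex.norm_real]
    exact mul_le_mul (hB r hr) (hQb r ω) (norm_nonneg _) ((norm_nonneg _).trans (hB r hr))
  obtain ⟨B, hB⟩ := hvQb
  have hvQc : Continuous (Function.uncurry fun r ω => (v r : ℂ) * Q r ω) := by
    have h1 : Continuous fun p : ℝ × ℝ => (v p.1 : ℂ) := by fun_prop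
    exact h1.mul hQc
  have hform : ∀ ω, b (insertedCommutator v y z Wp Wm P R a T ω) (R T ω) =
      (y : ℂ) * Q a ω - (z : ℂ) * Q T ω + ∫ r in a..T, (v r : ℂ) * Q r ω := fun ω => by
    have hc : Continuous fun r =>
        (v r : ℂ) • (P T ω * R r ω * rotatingCoupling Wp Wm r ω * P r ω) := by
      have h1 : Continuous fun r => P T ω * R r ω * rotatingCoupling Wp Wm r ω * P r ω :=
        hins.comp (by fun_prop : Continuous fun r : ℝ => (r, ω))
      fun_prop
    have h1 := (b.flip (R T ω)).intervalIntegral_comp_comm (hc.intervalIntegrable (μ := volume) a T)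
    simp only [ContinuousLinearMap.flip_apply] at h1
    rw [insertedCommutator, map_add, map_sub, map_smul, map_smul, add_apply,
      sub_apply, smul_apply, smul_apply,
      ← h1]
    simp only [hQ, hRa, hPa, hPR, mul_one, one_mul, map_smul, smul_apply,
      smul_eq_mul]
  have hsplit : ∀ ω, w ω * b (insertedCommutator v y z Wp Wm P R a T ω) (R T ω) =
      (y : ℂ) * (w ω * Q a ω) - (z : ℂ) * (w ω * Q T ω)
        + w ω * ∫ r in a..T, (v r : ℂ) * Q r ω := fun ω => by
    rw [hform]; ring
  have hi3 : Integrable fun ω => w ω * ∫ r in a..T, (v r : ℂ) * Q r ω := by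
    refine integrable_weight_mul hw (B := B * |T - a|)
      (intervalIntegral.continuous_parametric_intervalIntegral_of_continuous'
        (f := fun ω r => (v r : ℂ) * Q r ω)
        (hvQc.comp (by fun_prop : Continuous fun p : ℝ × ℝ => (p.2, p.1))) a T) fun ω => ?_
    refine intervalIntegral.norm_integral_le_of_norm_le_const fun r hr => hB r ?_ ω
    rw [Set.uIoc_of_le haT] at hr
    exact ⟨hr.1.le, hr.2⟩
  simp only [hsplit]
  rw [integral_sub_add ((hQi a).const_mul (y : ℂ)) ((hQi T).const_mul (z : ℂ)) hi3,
    MeasureTheory.integral_const_mul, MeasureTheory.integral_const_mul,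
    integral_weight_intervalIntegral_swap hw hvQc haT hB]
  have haa : a ∈ Set.Icc a T := ⟨le_rfl, haT⟩
  have hTT : T ∈ Set.Icc a T := ⟨haT, le_rfl⟩
  have h1 : ‖(y : ℂ) * ∫ ω, w ω * Q a ω‖ ≤ |y| * (2 * insertionConst J L) := by
    rw [norm_mul, Complex.norm_real]
    exact mul_le_mul_of_nonneg_left (hQav a haa) (abs_nonneg y)
  have h2 : ‖(z : ℂ) * ∫ ω, w ω * Q T ω‖ ≤ |z| * (2 * insertionConst J L) := by
    rw [norm_mul, Complex.norm_real]
    exact mul_le_mul_of_nonneg_left (hQav T hTT) (abs_nonneg z)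
  have h3 : ‖∫ r in a..T, ∫ ω, w ω * ((v r : ℂ) * Q r ω)‖ ≤
      ∫ r in a..T, |v r| * (2 * insertionConst J L) :=
    norm_integral_le_of_norm_le haT (.of_forall fun r hr => by
      simp only [mul_left_comm (w _)]
      rw [MeasureTheory.integral_const_mul, norm_mul, Complex.norm_real, Real.norm_eq_abs]
      exact mul_le_mul_of_nonneg_left (hQav r ⟨hr.1.le, hr.2⟩) (abs_nonneg _))
      (Continuous.intervalIntegrable (by fun_prop) _ _)
  rw [intervalIntegral.integral_mul_const] at h3
  refine (norm_add_le _ _).trans ((add_le_add ((norm_sub_le _ _).trans (add_le_add h1 h2)) h3).trans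
    (le_of_eq (by ring)))

end Averaging

/-! ### Trace norm and operator norm -/

noncomputable section TraceNorm

open scoped Matrix.Norms.L2Operator
open Matrix

variable {d : Type*} [Fintype d] [DecidableEq d]

lemma norm_one_matrix_le : ‖(1 : Matrix d d ℂ)‖ ≤ 1 := by
  rw [← Matrix.diagonal_one, Matrix.l2_opNorm_diagonal]
  exact (pi_norm_le_iff_of_nonneg zero_le_one).2 fun i => by simp

lemma norm_le_one_of_conjTranspose_mul_self {U : Matrix d d ℂ} (h : Uᴴ * U = 1) : ‖U‖ ≤ 1 := by
  have h1 := Matrix.l2_opNorm_conjTranspose_mul_self U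
  rw [h] at h1
  have h2 : ‖(1 : Matrix d d ℂ)‖ ≤ 1 := norm_one_matrix_le
  nlinarith [norm_nonneg U]

/-- The columns of a matrix have Euclidean norm at most its operator norm. -/
lemma sum_norm_sq_col_le (B : Matrix d d ℂ) (j : d) : ∑ i, ‖B i j‖ ^ 2 ≤ ‖B‖ ^ 2 := by
  have h := Matrix.l2_opNorm_mulVec B (EuclideanSpace.single j 1)
  simp only [PiLp.norm_single, norm_one, mul_one] at h
  rw [EuclideanSpace.norm_eq] at h
  have h2 := Real.sqrt_le_left (norm_nonneg B) |>.1 h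
  simpa using h2

lemma sum_norm_sq_row_le (B : Matrix d d ℂ) (i : d) : ∑ j, ‖B i j‖ ^ 2 ≤ ‖B‖ ^ 2 := by
  have h := sum_norm_sq_col_le Bᴴ i
  simpa [Matrix.l2_opNorm_conjTranspose] using h

/-- The norm of a diagonal entry of `A * B`, by Cauchy–Schwarz. -/
lemma sum_norm_mul_norm_le (A B : Matrix d d ℂ) (i : d) :
    ∑ j, ‖A i j‖ * ‖B j i‖ ≤ ‖A‖ * ‖B‖ := by
  have h := Finset.sum_mul_sq_le_sq_mul_sq Finset.univ (fun j => ‖A i j‖) (fun j => ‖B j i‖)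
  have h1 := sum_norm_sq_row_le A i
  have h2 := sum_norm_sq_col_le B i
  refine le_of_sq_le_sq ?_ (by positivity)
  calc _ ≤ _ := h
    _ ≤ ‖A‖ ^ 2 * ‖B‖ ^ 2 := mul_le_mul h1 h2 (by positivity) (by positivity)
    _ = _ := by ring

lemma traceNorm_nonneg (A : Matrix d d ℂ) : 0 ≤ traceNorm A :=
  Finset.sum_nonneg fun _ _ => Real.sqrt_nonneg _

/-- The eigenvector matrix `V` of `MᴴM` diagonalises it. -/
lemma conjTranspose_mul_self_diagonalised (M : Matrix d d ℂ) :
    let hM := Matrix.isHermitian_conjTranspose_mul_self M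
    let V : Matrix d d ℂ := hM.eigenvectorUnitary
    (M * V)ᴴ * (M * V) = diagonal fun i => (hM.eigenvalues i : ℂ) := by
  intro hM V
  have h := hM.spectral_theorem
  have hV : Vᴴ * V = 1 := by
    simpa [star_eq_conjTranspose] using Unitary.coe_star_mul_self hM.eigenvectorUnitary
  rw [Unitary.conjStarAlgAut_apply] at h
  have h' : Mᴴ * M = V * diagonal (RCLike.ofReal ∘ hM.eigenvalues) * Vᴴ := h
  calc (M * V)ᴴ * (M * V) = Vᴴ * (Mᴴ * M) * V := by
        simp only [conjTranspose_mul, Matrix.mul_assoc]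
    _ = (Vᴴ * V) * diagonal (RCLike.ofReal ∘ hM.eigenvalues) * (Vᴴ * V) := by
        refine (congrArg (fun X => Vᴴ * X * V) h').trans ?_
        simp only [Matrix.mul_assoc]
    _ = _ := by rw [hV, Matrix.one_mul, Matrix.mul_one]; rfl

/-- The trace norm is attained: the polar decomposition gives a contraction `O` with
`Tr (O M) = ‖M‖₁`. -/
lemma exists_trace_mul_eq_traceNorm (M : Matrix d d ℂ) :
    ∃ O : Matrix d d ℂ, ‖O‖ ≤ 1 ∧ (O * M).trace = traceNorm M := by
  set hM := Matrix.isHermitian_conjTranspose_mul_self M with hMdef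
  set V := (hM.eigenvectorUnitary : Matrix d d ℂ) with hVdef
  have hdiag : (M * V)ᴴ * (M * V) = diagonal fun i => (hM.eigenvalues i : ℂ) :=
    conjTranspose_mul_self_diagonalised M
  have hV : Vᴴ * V = 1 := by
    simpa [star_eq_conjTranspose] using Unitary.coe_star_mul_self hM.eigenvectorUnitary
  have hV' : V * Vᴴ = 1 := by
    simpa [star_eq_conjTranspose] using Unitary.coe_mul_star_self hM.eigenvectorUnitary
  have hpos : ∀ i, 0 ≤ hM.eigenvalues i :=
    (Matrix.posSemidef_conjTranspose_mul_self M).eigenvalues_nonneg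
  -- On the kernel of `MᴴM` the inverse square root is zero.
  set D : Matrix d d ℂ := diagonal fun i => (((Real.sqrt (hM.eigenvalues i))⁻¹ : ℝ) : ℂ) with hD
  refine ⟨V * D * (M * V)ᴴ, ?_, ?_⟩
  · have hDH : Dᴴ = D := by
      rw [hD, diagonal_conjTranspose]
      congr 1
      ext i
      simp
    have h1 : (V * D * (M * V)ᴴ) * (V * D * (M * V)ᴴ)ᴴ =
        V * (D * (diagonal fun i => (hM.eigenvalues i : ℂ)) * D) * Vᴴ := by
      rw [← hdiag]
      simp only [conjTranspose_mul, conjTranspose_conjTranspose, hDH, Matrix.mul_assoc]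
    have h2 : ‖D * (diagonal fun i => (hM.eigenvalues i : ℂ)) * D‖ ≤ 1 := by
      rw [hD, diagonal_mul_diagonal, diagonal_mul_diagonal, l2_opNorm_diagonal]
      refine (pi_norm_le_iff_of_nonneg zero_le_one).2 fun i => ?_
      rw [← Complex.ofReal_mul, ← Complex.ofReal_mul, Complex.norm_real]
      rcases (hpos i).eq_or_lt with h0 | h0
      · simp [← h0]
      · have hs := Real.sqrt_pos.2 h0
        have : (Real.sqrt (hM.eigenvalues i))⁻¹ * hM.eigenvalues i *
            (Real.sqrt (hM.eigenvalues i))⁻¹ = 1 := by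
          rw [mul_assoc, mul_comm (hM.eigenvalues i), ← mul_assoc, ← mul_inv,
            Real.mul_self_sqrt (hpos i), inv_mul_cancel₀ h0.ne']
        rw [this]; simp
    have hVn : ‖V‖ ≤ 1 := norm_le_one_of_conjTranspose_mul_self hV
    have hVn' : ‖Vᴴ‖ ≤ 1 := by rwa [l2_opNorm_conjTranspose]
    have h3 := l2_opNorm_conjTranspose_mul_self (V * D * (M * V)ᴴ)ᴴ
    rw [conjTranspose_conjTranspose, h1, l2_opNorm_conjTranspose] at h3
    have h4 : ‖V * (D * (diagonal fun i => (hM.eigenvalues i : ℂ)) * D) * Vᴴ‖ ≤ 1 := by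
      refine (norm_mul_le _ _).trans (mul_le_one₀ ?_ (norm_nonneg _) hVn')
      exact (norm_mul_le _ _).trans (mul_le_one₀ hVn (norm_nonneg _) h2)
    nlinarith [norm_nonneg (V * D * (M * V)ᴴ)]
  · have h1 : (V * D * (M * V)ᴴ * M).trace = (D * ((M * V)ᴴ * (M * V))).trace := by
      rw [Matrix.mul_assoc, Matrix.mul_assoc, trace_mul_comm]
      simp only [Matrix.mul_assoc]
    rw [h1, hdiag, hD, diagonal_mul_diagonal, trace_diagonal, traceNorm, Complex.ofReal_sum]
    refine Finset.sum_congr rfl fun i _ => ?_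
    rw [← Complex.ofReal_mul]
    change (((√(hM.eigenvalues i))⁻¹ * hM.eigenvalues i : ℝ) : ℂ) = ((√(hM.eigenvalues i) : ℝ) : ℂ)
    congr 1
    rcases (hpos i).eq_or_lt with h0 | h0
    · simp [← h0]
    · have hs := Real.sqrt_pos.2 h0
      rw [inv_mul_eq_iff_eq_mul₀ hs.ne', Real.mul_self_sqrt (hpos i)]

/-- Hölder's inequality for the trace norm and the operator norm. -/
lemma norm_trace_mul_le (O M : Matrix d d ℂ) : ‖(O * M).trace‖ ≤ ‖O‖ * traceNorm M := by
  set hM := Matrix.isHermitian_conjTranspose_mul_self M with hMdef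
  set V := (hM.eigenvectorUnitary : Matrix d d ℂ) with hVdef
  have hdiag : (M * V)ᴴ * (M * V) = diagonal fun i => (hM.eigenvalues i : ℂ) :=
    conjTranspose_mul_self_diagonalised M
  have hV : Vᴴ * V = 1 := by
    simpa [star_eq_conjTranspose] using Unitary.coe_star_mul_self hM.eigenvectorUnitary
  have hV' : V * Vᴴ = 1 := by
    simpa [star_eq_conjTranspose] using Unitary.coe_mul_star_self hM.eigenvectorUnitary
  have hpos : ∀ i, 0 ≤ hM.eigenvalues i :=
    (Matrix.posSemidef_conjTranspose_mul_self M).eigenvalues_nonneg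
  have hcol : ∀ i, ∑ j, ‖(M * V) j i‖ ^ 2 = hM.eigenvalues i := fun i => by
    have h := congrFun (congrFun hdiag i) i
    rw [mul_apply, diagonal_apply_eq] at h
    have h2 : ∀ j, (M * V)ᴴ i j * (M * V) j i = ((‖(M * V) j i‖ ^ 2 : ℝ) : ℂ) := fun j => by
      rw [conjTranspose_apply, ← Complex.normSq_eq_norm_sq, Complex.normSq_eq_conj_mul_self]
      rfl
    simp only [h2] at h
    exact_mod_cast h
  have htr : (O * M).trace = ∑ i, ∑ j, (Vᴴ * O) i j * (M * V) j i := by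
    have : (O * M).trace = ((Vᴴ * O) * (M * V)).trace := by
      rw [Matrix.mul_assoc, trace_mul_comm Vᴴ]
      simp only [Matrix.mul_assoc, hV', Matrix.mul_one]
    rw [this]
    simp only [Matrix.trace, Matrix.diag, mul_apply]
  have hn : ‖Vᴴ * O‖ ≤ ‖O‖ := by
    refine (norm_mul_le _ _).trans (mul_le_of_le_one_left (norm_nonneg _) ?_)
    rw [l2_opNorm_conjTranspose]
    exact norm_le_one_of_conjTranspose_mul_self hV
  rw [htr, traceNorm, Finset.mul_sum]
  refine (norm_sum_le _ _).trans (Finset.sum_le_sum fun i _ => ?_)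
  refine (norm_sum_le _ _).trans ?_
  simp only [norm_mul]
  have h := Finset.sum_mul_sq_le_sq_mul_sq Finset.univ (fun j => ‖(Vᴴ * O) i j‖)
    (fun j => ‖(M * V) j i‖)
  rw [hcol i] at h
  have h1 := (sum_norm_sq_row_le (Vᴴ * O) i).trans (pow_le_pow_left₀ (norm_nonneg _) hn 2)
  refine le_of_sq_le_sq ?_ (mul_nonneg (norm_nonneg _) (Real.sqrt_nonneg _))
  rw [mul_pow, Real.sq_sqrt (hpos i)]
  exact h.trans (mul_le_mul_of_nonneg_right h1 (hpos i))

/-- Duality: a bound on all `|Tr (O M)|` with `‖O‖ ≤ 1` bounds the trace norm. -/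
lemma traceNorm_le_of_forall {M : Matrix d d ℂ} {c : ℝ}
    (h : ∀ O : Matrix d d ℂ, ‖O‖ ≤ 1 → ‖(O * M).trace‖ ≤ c) : traceNorm M ≤ c := by
  obtain ⟨O, hO, hOM⟩ := exists_trace_mul_eq_traceNorm M
  have h1 := h O hO
  rw [hOM, Complex.norm_real, Real.norm_eq_abs] at h1
  exact (le_abs_self _).trans h1

lemma traceNorm_add_le (A B : Matrix d d ℂ) : traceNorm (A + B) ≤ traceNorm A + traceNorm B := by
  refine traceNorm_le_of_forall fun O hO => ?_
  rw [Matrix.mul_add, trace_add]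
  refine (norm_add_le _ _).trans (add_le_add ?_ ?_)
  · exact (norm_trace_mul_le O A).trans (mul_le_of_le_one_left (traceNorm_nonneg A) hO)
  · exact (norm_trace_mul_le O B).trans (mul_le_of_le_one_left (traceNorm_nonneg B) hO)

lemma traceNorm_zero : traceNorm (0 : Matrix d d ℂ) = 0 := by
  refine le_antisymm (traceNorm_le_of_forall fun O _ => by simp) (traceNorm_nonneg _)

lemma traceNorm_eq_zero {A : Matrix d d ℂ} (h : traceNorm A = 0) : A = 0 := by
  have h1 := norm_trace_mul_le Aᴴ A
  rw [h, mul_zero] at h1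
  exact Matrix.trace_conjTranspose_mul_self_eq_zero_iff.1 (norm_le_zero_iff.1 h1)

/-! ### Gibbs weights -/

/-- The diagonal form of the exponential of a Hermitian matrix. -/
lemma exp_smul_eq_conj_diagonal {H : Matrix d d ℂ} (hH : H.IsHermitian) (z : ℂ) :
    NormedSpace.exp (z • H) = (hH.eigenvectorUnitary : Matrix d d ℂ) *
      diagonal (fun i => Complex.exp (z * hH.eigenvalues i)) *
        (hH.eigenvectorUnitary : Matrix d d ℂ)ᴴ := by
  set V := (hH.eigenvectorUnitary : Matrix d d ℂ) with hVdef
  have hV' : V * Vᴴ = 1 := by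
    simpa [star_eq_conjTranspose] using Unitary.coe_mul_star_self hH.eigenvectorUnitary
  have hinv : V⁻¹ = Vᴴ := Matrix.inv_eq_right_inv hV'
  have hu : IsUnit V := IsUnit.of_mul_eq_one _ hV'
  have h := hH.spectral_theorem
  rw [Unitary.conjStarAlgAut_apply] at h
  have h' : H = V * diagonal (RCLike.ofReal ∘ hH.eigenvalues) * V⁻¹ := by rw [hinv]; exact h
  have h2 : z • H = V * diagonal (fun i => z * hH.eigenvalues i) * V⁻¹ := by
    conv_lhs => rw [h']
    rw [← smul_mul_assoc, ← Matrix.mul_smul, ← diagonal_smul]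
    rfl
  rw [h2, Matrix.exp_conj _ _ hu, Matrix.exp_diagonal, hinv]
  congr 3
  ext i
  rw [Pi.coe_exp, Complex.exp_eq_exp_ℂ]

lemma trace_exp_smul {H : Matrix d d ℂ} (hH : H.IsHermitian) (z : ℂ) :
    (NormedSpace.exp (z • H)).trace = ∑ i, Complex.exp (z * hH.eigenvalues i) := by
  have hV : (hH.eigenvectorUnitary : Matrix d d ℂ)ᴴ *
      (hH.eigenvectorUnitary : Matrix d d ℂ) = 1 := by
    simpa [star_eq_conjTranspose] using Unitary.coe_star_mul_self hH.eigenvectorUnitary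
  rw [exp_smul_eq_conj_diagonal hH, trace_mul_comm, ← Matrix.mul_assoc, hV, Matrix.one_mul,
    trace_diagonal]

/-- The partition function `Tr e^{-βH}` as a real number. -/
def partitionFn (H : Matrix d d ℂ) (β : ℝ) : ℝ := (NormedSpace.exp ((-β : ℂ) • H)).trace.re

lemma partitionFn_eq {H : Matrix d d ℂ} (hH : H.IsHermitian) (β : ℝ) :
    partitionFn H β = ∑ i, Real.exp (-β * hH.eigenvalues i) := by
  rw [partitionFn, trace_exp_smul hH, Complex.re_sum]
  refine Finset.sum_congr rfl fun i _ => ?_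
  rw [← Complex.exp_ofReal_re]
  push_cast
  rfl

lemma trace_exp_eq_partitionFn {H : Matrix d d ℂ} (hH : H.IsHermitian) (β : ℝ) :
    (NormedSpace.exp ((-β : ℂ) • H)).trace = partitionFn H β := by
  rw [partitionFn_eq hH, trace_exp_smul hH]
  push_cast
  rfl

lemma partitionFn_pos [Nonempty d] {H : Matrix d d ℂ} (hH : H.IsHermitian) (β : ℝ) :
    0 < partitionFn H β := by
  rw [partitionFn_eq hH]
  exact Finset.sum_pos (fun i _ => Real.exp_pos _) Finset.univ_nonempty

/-- The interpolated Hölder bound `|Tr (O e^{-sH} B₁ e^{-(β-s)H} B₂)| ≤ ‖O‖ ‖B₁‖ ‖B₂‖ Tr e^{-βH}`.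
In an eigenbasis of `H` the weights are split by Young's inequality
`p^s q^{1-s} ≤ s p + (1 - s) q`. -/
lemma norm_trace_gibbs_split_le {H : Matrix d d ℂ} (hH : H.IsHermitian) {s β : ℝ} (hs : 0 ≤ s)
    (hsβ : s ≤ β) (O B₁ B₂ : Matrix d d ℂ) :
    ‖(O * NormedSpace.exp ((-s : ℂ) • H) * B₁ * NormedSpace.exp (((-(β - s) : ℝ) : ℂ) • H)
      * B₂).trace‖ ≤ ‖O‖ * ‖B₁‖ * ‖B₂‖ * partitionFn H β := by
  set V := (hH.eigenvectorUnitary : Matrix d d ℂ) with hVdef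
  set E := hH.eigenvalues with hE
  have hV : Vᴴ * V = 1 := by
    simpa [star_eq_conjTranspose] using Unitary.coe_star_mul_self hH.eigenvectorUnitary
  have hVn : ‖V‖ ≤ 1 := norm_le_one_of_conjTranspose_mul_self hV
  have hVn' : ‖Vᴴ‖ ≤ 1 := by rwa [l2_opNorm_conjTranspose]
  have hconj : ∀ M : Matrix d d ℂ, ‖Vᴴ * M * V‖ ≤ ‖M‖ := fun M => by
    refine (norm_mul_le _ _).trans ?_
    refine (mul_le_of_le_one_right (norm_nonneg _) hVn).trans ?_
    exact (norm_mul_le _ _).trans (mul_le_of_le_one_left (norm_nonneg _) hVn')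
  set C := Vᴴ * (B₂ * O) * V with hC
  set B := Vᴴ * B₁ * V with hB
  have htr : (O * NormedSpace.exp ((-s : ℂ) • H) * B₁ * NormedSpace.exp (((-(β - s) : ℝ) : ℂ) • H)
      * B₂).trace = ∑ j, ∑ i, C j i * Complex.exp ((-s : ℂ) * E i) * B i j *
        Complex.exp (((-(β - s) : ℝ) : ℂ) * E j) := by
    rw [exp_smul_eq_conj_diagonal hH, exp_smul_eq_conj_diagonal hH]
    have : (O * (V * diagonal (fun i => Complex.exp ((-s : ℂ) * E i)) * Vᴴ) * B₁ *
        (V * diagonal (fun i => Complex.exp (((-(β - s) : ℝ) : ℂ) * E i)) * Vᴴ) * B₂).trace =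
        (C * diagonal (fun i => Complex.exp ((-s : ℂ) * E i)) * B *
          diagonal (fun i => Complex.exp (((-(β - s) : ℝ) : ℂ) * E i))).trace := by
      refine Eq.trans ?_ ((trace_mul_comm (O * V * diagonal (fun i => Complex.exp ((-s : ℂ) * E i))
        * B * diagonal (fun i => Complex.exp (((-(β - s) : ℝ) : ℂ) * E i))) (Vᴴ * B₂)).trans ?_)
      · simp only [hB, Matrix.mul_assoc]
      · simp only [hC, Matrix.mul_assoc]
    rw [this]
    simp only [Matrix.trace, Matrix.diag, mul_diagonal]
    refine Finset.sum_congr rfl fun j _ => ?_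
    rw [mul_apply, Finset.sum_mul]
    refine Finset.sum_congr rfl fun i _ => ?_
    rw [mul_diagonal]
  have hnorm : ∀ i j, ‖C j i * Complex.exp ((-s : ℂ) * E i) * B i j *
        Complex.exp (((-(β - s) : ℝ) : ℂ) * E j)‖ ≤
      s / β * (Real.exp (-β * E i) * (‖B i j‖ * ‖C j i‖)) +
      (β - s) / β * (Real.exp (-β * E j) * (‖C j i‖ * ‖B i j‖)) +
      (if β = 0 then ‖C j i‖ * ‖B i j‖ else 0) := fun i j => by
    have e1 : ‖Complex.exp ((-s : ℂ) * E i)‖ = Real.exp (-s * E i) := by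
      rw [Complex.norm_exp]; simp
    have e2 : ‖Complex.exp (((-(β - s) : ℝ) : ℂ) * E j)‖ = Real.exp (-(β - s) * E j) := by
      rw [Complex.norm_exp, ← Complex.ofReal_mul, Complex.ofReal_re]
    rw [norm_mul, norm_mul, norm_mul, e1, e2]
    by_cases hβ : β = 0
    · have : s = 0 := le_antisymm (hsβ.trans hβ.le) hs
      simp [hβ, this]
    · have hβ' : 0 < β := lt_of_le_of_ne (hs.trans hsβ) (Ne.symm hβ)
      have hy : Real.exp (-s * E i) * Real.exp (-(β - s) * E j) ≤
          s / β * Real.exp (-β * E i) + (β - s) / β * Real.exp (-β * E j) := by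
        have hc := convexOn_exp.2 (Set.mem_univ (-β * E i)) (Set.mem_univ (-β * E j))
          (by positivity : 0 ≤ s / β) (div_nonneg (sub_nonneg.2 hsβ) hβ'.le)
          (by field_simp; ring)
        rw [← Real.exp_add]
        refine (le_of_eq (congrArg Real.exp ?_)).trans hc
        simp only [smul_eq_mul]
        field_simp
      rw [if_neg hβ, add_zero]
      have := mul_le_mul_of_nonneg_right hy (mul_nonneg (norm_nonneg (C j i)) (norm_nonneg (B i j)))
      linarith
  have hCn : ‖C‖ ≤ ‖B₂‖ * ‖O‖ := (hconj _).trans (norm_mul_le _ _)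
  have hBn : ‖B‖ ≤ ‖B₁‖ := hconj _
  have hBC : ‖B‖ * ‖C‖ ≤ ‖O‖ * ‖B₁‖ * ‖B₂‖ := by
    refine (mul_le_mul hBn hCn (norm_nonneg _) (norm_nonneg _)).trans (le_of_eq (by ring))
  have hCB : ‖C‖ * ‖B‖ ≤ ‖O‖ * ‖B₁‖ * ‖B₂‖ := by rwa [mul_comm]
  set c := ‖O‖ * ‖B₁‖ * ‖B₂‖ with hc
  have hβ0 : 0 ≤ β := hs.trans hsβ
  rw [htr]
  refine (norm_sum_le _ _).trans ((Finset.sum_le_sum fun j _ => (norm_sum_le _ _).trans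
    (Finset.sum_le_sum fun i _ => hnorm i j)).trans ?_)
  simp only [Finset.sum_add_distrib, ← Finset.mul_sum]
  rw [Finset.sum_comm (f := fun x y => Real.exp (-β * E y) * (‖B y x‖ * ‖C x y‖))]
  simp only [← Finset.mul_sum]
  have t1 : ∑ i, Real.exp (-β * E i) * ∑ j, ‖B i j‖ * ‖C j i‖ ≤ c * partitionFn H β := by
    rw [partitionFn_eq hH, Finset.mul_sum]
    refine Finset.sum_le_sum fun i _ => ?_
    rw [mul_comm]
    exact mul_le_mul_of_nonneg_right ((sum_norm_mul_norm_le B C i).trans hBC) (Real.exp_pos _).le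
  have t2 : ∑ i, Real.exp (-β * E i) * ∑ j, ‖C i j‖ * ‖B j i‖ ≤ c * partitionFn H β := by
    rw [partitionFn_eq hH, Finset.mul_sum]
    refine Finset.sum_le_sum fun i _ => ?_
    rw [mul_comm]
    exact mul_le_mul_of_nonneg_right ((sum_norm_mul_norm_le C B i).trans hCB) (Real.exp_pos _).le
  by_cases hβ : β = 0
  · subst hβ
    simpa using t2
  · simp only [if_neg hβ, Finset.sum_const_zero, add_zero]
    have h1 := mul_le_mul_of_nonneg_left t1 (div_nonneg hs hβ0)
    have h2 := mul_le_mul_of_nonneg_left t2 (div_nonneg (sub_nonneg.2 hsβ) hβ0)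
    refine (add_le_add h1 h2).trans (le_of_eq ?_)
    field_simp
    ring

end TraceNorm

/-! ### The time-ordered exponential -/

noncomputable section Dyson

open scoped Matrix.Norms.L2Operator
open Matrix MeasureTheory Filter Topology

variable {d : Type*} [Fintype d]

/-- The coordinate functional `M ↦ M i j`. -/
def entryCLM (i j : d) : Matrix d d ℂ →L[ℂ] ℂ :=
  LinearMap.toContinuousLinearMap (Matrix.entryLinearMap ℂ ℂ i j)

@[simp] lemma entryCLM_apply (i j : d) (M : Matrix d d ℂ) : entryCLM i j M = M i j := rfl

variable [DecidableEq d]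

lemma continuous_dysonTerm {K : ℝ → ℝ → Matrix d d ℂ} (hK : Continuous (Function.uncurry K))
    (t₀ : ℝ) (n : ℕ) : Continuous fun p : ℝ × ℝ => dysonTerm (K p.1) t₀ n p.2 := by
  induction n with
  | zero => exact continuous_const
  | succ n ih =>
    refine continuous_matrix fun i j => continuous_const.mul ?_
    refine intervalIntegral.continuous_parametric_intervalIntegral_of_continuous (μ := volume)
      (f := fun (p : ℝ × ℝ) (s : ℝ) => (K p.1 s * dysonTerm (K p.1) t₀ n s) i j) ?_ continuous_snd
    have h1 : Continuous fun q : (ℝ × ℝ) × ℝ => K q.1.1 q.2 :=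
      hK.comp (by fun_prop : Continuous fun q : (ℝ × ℝ) × ℝ => (q.1.1, q.2))
    have h2 : Continuous fun q : (ℝ × ℝ) × ℝ => dysonTerm (K q.1.1) t₀ n q.2 :=
      ih.comp (by fun_prop : Continuous fun q : (ℝ × ℝ) × ℝ => (q.1.1, q.2))
    exact (h1.mul h2).matrix_elem i j

lemma dysonTerm_succ {K : ℝ → ℝ → Matrix d d ℂ} (hK : Continuous (Function.uncurry K))
    (t₀ : ℝ) (n : ℕ) (ω t : ℝ) : dysonTerm (K ω) t₀ (n + 1) t =
      (-Complex.I) • ∫ s in t₀..t, K ω s * dysonTerm (K ω) t₀ n s := by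
  have hc : Continuous fun s => K ω s * dysonTerm (K ω) t₀ n s :=
    (hK.comp (by fun_prop : Continuous fun s : ℝ => (ω, s))).mul
      ((continuous_dysonTerm hK t₀ n).comp (by fun_prop : Continuous fun s : ℝ => (ω, s)))
  ext i j
  have h := (entryCLM i j).intervalIntegral_comp_comm (hc.intervalIntegrable (μ := volume) t₀ t)
  simp only [entryCLM_apply] at h
  rw [Matrix.smul_apply, ← h]
  rfl

lemma norm_dysonTerm_le {K : ℝ → ℝ → Matrix d d ℂ} (hK : Continuous (Function.uncurry K))
    {t₀ ω C ρ : ℝ} (hC : ∀ s, |s - t₀| ≤ ρ → ‖K ω s‖ ≤ C) (n : ℕ) :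
    ∀ t, |t - t₀| ≤ ρ → ‖dysonTerm (K ω) t₀ n t‖ ≤ (C * |t - t₀|) ^ n / n.factorial := by
  induction n with
  | zero => intro t _; simpa [dysonTerm] using norm_one_matrix_le
  | succ n ih =>
    intro t ht
    rw [dysonTerm_succ hK, norm_smul, norm_neg, Complex.norm_I, one_mul]
    have hC0 : 0 ≤ C := (norm_nonneg _).trans
      (hC t₀ (by rw [sub_self, abs_zero]; exact (abs_nonneg _).trans ht))
    refine (intervalIntegral.norm_integral_le_integral_norm_uIoc).trans ?_
    have hle : ∀ s ∈ Set.uIoc t₀ t, ‖K ω s * dysonTerm (K ω) t₀ n s‖ ≤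
        C ^ (n + 1) / n.factorial * |s - t₀| ^ n := fun s hs => by
      have hs' : |s - t₀| ≤ ρ :=
        (Set.abs_sub_left_of_mem_uIcc (Set.uIoc_subset_uIcc hs)).trans ht
      refine (norm_mul_le _ _).trans ((mul_le_mul (hC s hs') (ih s hs') (norm_nonneg _) hC0).trans
        (le_of_eq ?_))
      rw [mul_pow]; ring
    have hc : Continuous fun s => K ω s * dysonTerm (K ω) t₀ n s :=
      (hK.comp (by fun_prop : Continuous fun s : ℝ => (ω, s))).mul
        ((continuous_dysonTerm hK t₀ n).comp (by fun_prop : Continuous fun s : ℝ => (ω, s)))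
    refine (setIntegral_mono_on (hc.norm.integrableOn_uIoc)
      (Continuous.integrableOn_uIoc (by fun_prop)) measurableSet_uIoc hle).trans (le_of_eq ?_)
    rw [integral_const_mul, integral_pow_abs_sub_uIoc, mul_pow, Nat.factorial_succ]
    push_cast
    have : (n.factorial : ℝ) ≠ 0 := by positivity
    field_simp

/-- Local uniform domination of the Dyson series by an exponential series. -/
lemma exists_bound_dysonTerm {K : ℝ → ℝ → Matrix d d ℂ} (hK : Continuous (Function.uncurry K))
    (t₀ ρ : ℝ) : ∃ C : ℝ, 0 ≤ C ∧ ∀ ω, |ω| ≤ ρ → ∀ t, |t - t₀| ≤ ρ → ‖K ω t‖ ≤ C ∧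
      ∀ n, ‖dysonTerm (K ω) t₀ n t‖ ≤ (C * ρ) ^ n / n.factorial := by
  obtain ⟨C, hC⟩ := (isCompact_Icc.prod isCompact_Icc).exists_bound_of_continuousOn
    (s := Set.Icc (-ρ) ρ ×ˢ Set.Icc (t₀ - ρ) (t₀ + ρ)) hK.continuousOn
  have hC' : ∀ ω, |ω| ≤ ρ → ∀ t, |t - t₀| ≤ ρ → ‖K ω t‖ ≤ C := fun ω hω t ht =>
    hC (ω, t) ⟨abs_le.1 hω, by
      have := abs_le.1 ht
      exact ⟨by linarith [this.1], by linarith [this.2]⟩⟩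
  refine ⟨max C 0, le_max_right _ _, fun ω hω t ht =>
    ⟨(hC' ω hω t ht).trans (le_max_left _ _), fun n => ?_⟩⟩
  refine (norm_dysonTerm_le hK (fun s hs => (hC' ω hω s hs).trans (le_max_left C 0)) n t
    ht).trans ?_
  have := le_max_right C 0
  gcongr

lemma summable_dysonTerm {K : ℝ → ℝ → Matrix d d ℂ} (hK : Continuous (Function.uncurry K))
    (t₀ ω t : ℝ) : Summable fun n => dysonTerm (K ω) t₀ n t := by
  obtain ⟨C, hC0, hC⟩ := exists_bound_dysonTerm hK t₀ (max |ω| |t - t₀|)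
  exact Summable.of_norm_bounded (Real.summable_pow_div_factorial _)
    (hC ω (le_max_left _ _) t (le_max_right _ _)).2

lemma continuous_timeOrderedExp {K : ℝ → ℝ → Matrix d d ℂ} (hK : Continuous (Function.uncurry K))
    (t₀ : ℝ) : Continuous fun p : ℝ × ℝ => timeOrderedExp (K p.1) t₀ p.2 := by
  refine continuous_iff_continuousAt.2 fun p => ?_
  set ρ := max |p.1| |p.2 - t₀| + 1 with hρ
  obtain ⟨C, hC0, hC⟩ := exists_bound_dysonTerm hK t₀ ρ
  have hon : ContinuousOn (fun p : ℝ × ℝ => timeOrderedExp (K p.1) t₀ p.2)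
      {p : ℝ × ℝ | |p.1| < ρ ∧ |p.2 - t₀| < ρ} :=
    continuousOn_tsum (fun n => (continuous_dysonTerm hK t₀ n).continuousOn)
      (Real.summable_pow_div_factorial (C * ρ)) fun n q hq => (hC q.1 hq.1.le q.2 hq.2.le).2 n
  refine hon.continuousAt (IsOpen.mem_nhds ?_ ⟨?_, ?_⟩)
  · have h1 : Continuous fun p : ℝ × ℝ => |p.1| := by fun_prop
    have h2 : Continuous fun p : ℝ × ℝ => |p.2 - t₀| := by fun_prop
    exact (isOpen_lt h1 continuous_const).inter (isOpen_lt h2 continuous_const)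
  · exact (le_max_left _ _).trans_lt (lt_add_one _)
  · exact (le_max_right _ _).trans_lt (lt_add_one _)

lemma timeOrderedExp_eq_integral {K : ℝ → ℝ → Matrix d d ℂ}
    (hK : Continuous (Function.uncurry K)) (t₀ ω t : ℝ) :
    timeOrderedExp (K ω) t₀ t =
      1 + (-Complex.I) • ∫ s in t₀..t, K ω s * timeOrderedExp (K ω) t₀ s := by
  set ρ := max |ω| |t - t₀| with hρ
  obtain ⟨C, hC0, hC⟩ := exists_bound_dysonTerm hK t₀ ρ
  have hsum := summable_dysonTerm hK t₀ ω t
  rw [timeOrderedExp, hsum.tsum_eq_zero_add]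
  congr 1
  simp only [dysonTerm_succ hK]
  have h := intervalIntegral.hasSum_integral_of_dominated_convergence (μ := volume) (a := t₀)
    (b := t) (F := fun n s => K ω s * dysonTerm (K ω) t₀ n s)
    (f := fun s => K ω s * timeOrderedExp (K ω) t₀ s)
    (fun n _ => C * ((C * ρ) ^ n / n.factorial)) (fun n => ?_) (fun n => ?_) ?_ ?_ ?_
  · rw [← h.tsum_eq, ← h.summable.tsum_const_smul]
  · have hc : Continuous fun s => K ω s * dysonTerm (K ω) t₀ n s :=
      (hK.comp (by fun_prop : Continuous fun s : ℝ => (ω, s))).mul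
        ((continuous_dysonTerm hK t₀ n).comp (by fun_prop : Continuous fun s : ℝ => (ω, s)))
    exact hc.aestronglyMeasurable
  · refine .of_forall fun s hs => ?_
    have hs' : |s - t₀| ≤ ρ :=
      (Set.abs_sub_left_of_mem_uIcc (Set.uIoc_subset_uIcc hs)).trans (le_max_right _ _)
    obtain ⟨h1, h2⟩ := hC ω (le_max_left _ _) s hs'
    exact (norm_mul_le _ _).trans (mul_le_mul h1 (h2 n) (norm_nonneg _) hC0)
  · exact .of_forall fun s _ => (Real.summable_pow_div_factorial (C * ρ)).mul_left C
  · exact intervalIntegrable_const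
  · exact .of_forall fun s _ => (summable_dysonTerm hK t₀ ω s).hasSum.mul_left (K ω s)

lemma timeOrderedExp_self {K : ℝ → ℝ → Matrix d d ℂ} (hK : Continuous (Function.uncurry K))
    (t₀ ω : ℝ) : timeOrderedExp (K ω) t₀ t₀ = 1 := by
  rw [timeOrderedExp_eq_integral hK, intervalIntegral.integral_same, smul_zero, add_zero]

lemma hasDerivAt_timeOrderedExp {K : ℝ → ℝ → Matrix d d ℂ}
    (hK : Continuous (Function.uncurry K)) (t₀ ω t : ℝ) :
    HasDerivAt (fun t => timeOrderedExp (K ω) t₀ t)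
      ((-Complex.I) • (K ω t * timeOrderedExp (K ω) t₀ t)) t := by
  have hc : Continuous fun s => K ω s * timeOrderedExp (K ω) t₀ s :=
    (hK.comp (by fun_prop : Continuous fun s : ℝ => (ω, s))).mul
      ((continuous_timeOrderedExp hK t₀).comp (by fun_prop : Continuous fun s : ℝ => (ω, s)))
  have h := (((hc.integral_hasStrictDerivAt t₀ t).hasDerivAt).const_smul (-Complex.I)).const_add
    (1 : Matrix d d ℂ)
  exact h.congr_of_eventuallyEq (.of_forall fun t => timeOrderedExp_eq_integral hK t₀ ω t)

lemma HasDerivAt.matrix_conjTranspose {F : ℝ → Matrix d d ℂ} {F' : Matrix d d ℂ} {t : ℝ}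
    (h : HasDerivAt F F' t) : HasDerivAt (fun t => (F t)ᴴ) F'ᴴ t :=
  h.star

/-- The time-ordered exponential of a Hermitian generator is unitary. -/
lemma conjTranspose_mul_timeOrderedExp {K : ℝ → ℝ → Matrix d d ℂ}
    (hK : Continuous (Function.uncurry K)) (hKh : ∀ ω t, (K ω t).IsHermitian) (t₀ ω t : ℝ) :
    (timeOrderedExp (K ω) t₀ t)ᴴ * timeOrderedExp (K ω) t₀ t = 1 := by
  have hd : ∀ t, HasDerivAt
      (fun t => (timeOrderedExp (K ω) t₀ t)ᴴ * timeOrderedExp (K ω) t₀ t) 0 t := fun t => by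
    have h := hasDerivAt_timeOrderedExp hK t₀ ω t
    refine (h.matrix_conjTranspose.mul h).congr_deriv ?_
    rw [conjTranspose_smul, conjTranspose_mul, (hKh ω t).eq]
    simp [Matrix.mul_assoc]
  have hconst := is_const_of_deriv_eq_zero (fun t => (hd t).differentiableAt)
    (fun t => (hd t).deriv) t t₀
  rw [hconst, timeOrderedExp_self hK]
  simp

end Dyson

/-! ### Fourier decay of the thermal frequency weights -/

noncomputable section Weights

open MeasureTheory Filter Topology

/-- The thermal interpolation `e^{pω} / (e^{qω} + e^{-qω})`. -/
def thermalRatio (p q ω : ℝ) : ℝ := Real.exp (p * ω) / (Real.exp (q * ω) + Real.exp (-(q * ω)))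

lemma thermalRatio_nonneg (p q ω : ℝ) : 0 ≤ thermalRatio p q ω := by
  unfold thermalRatio; positivity

lemma thermalRatio_le_one {p q : ℝ} (hpq : |p| ≤ q) (ω : ℝ) : thermalRatio p q ω ≤ 1 := by
  unfold thermalRatio
  rw [div_le_one (by positivity)]
  have h := abs_le.1 hpq
  rcases le_total 0 ω with hω | hω
  · have : Real.exp (p * ω) ≤ Real.exp (q * ω) := Real.exp_le_exp.2 (by nlinarith)
    linarith [Real.exp_pos (-(q * ω))]
  · have : Real.exp (p * ω) ≤ Real.exp (-(q * ω)) := Real.exp_le_exp.2 (by nlinarith)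
    linarith [Real.exp_pos (q * ω)]

@[fun_prop]
lemma continuous_thermalRatio (p q : ℝ) : Continuous (thermalRatio p q) := by
  unfold thermalRatio
  exact Continuous.div (by fun_prop) (by fun_prop) fun ω => by positivity

/-- The derivative of `thermalRatio p q`. -/
def thermalRatioDeriv (p q ω : ℝ) : ℝ :=
  (p * Real.exp (p * ω) * (Real.exp (q * ω) + Real.exp (-(q * ω)))
    - Real.exp (p * ω) * (q * Real.exp (q * ω) - q * Real.exp (-(q * ω))))
    / (Real.exp (q * ω) + Real.exp (-(q * ω))) ^ 2

lemma hasDerivAt_thermalRatio (p q ω : ℝ) :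
    HasDerivAt (thermalRatio p q) (thermalRatioDeriv p q ω) ω := by
  have hl : ∀ c : ℝ, HasDerivAt (fun ω => Real.exp (c * ω)) (c * Real.exp (c * ω)) ω := fun c => by
    refine ((hasDerivAt_id' ω).const_mul c).exp.congr_deriv (by ring)
  have hd : HasDerivAt (fun ω => Real.exp (q * ω) + Real.exp (-(q * ω)))
      (q * Real.exp (q * ω) - q * Real.exp (-(q * ω))) ω := by
    have h2 : HasDerivAt (fun ω => Real.exp (-(q * ω))) (-q * Real.exp (-(q * ω))) ω := by
      simpa using hl (-q)
    exact ((hl q).add h2).congr_deriv (by ring)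
  exact (hl p).div hd (by positivity)

lemma continuous_thermalRatioDeriv (p q : ℝ) : Continuous (thermalRatioDeriv p q) := by
  unfold thermalRatioDeriv
  exact Continuous.div (by fun_prop) (by fun_prop) fun ω => by positivity

/-- Each half of the derivative of the thermal interpolation is dominated by the derivative of a
logistic function. -/
lemma mul_exp_div_sq_le {m k x : ℝ} (hm : 0 ≤ m) (hmk : m ≤ k) :
    m * Real.exp (-(m * x)) / (1 + Real.exp (-(k * x))) ^ 2
      ≤ 4 * (m * Real.exp (-(m * x)) / (1 + Real.exp (-(m * x))) ^ 2) := by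
  have h : 1 + Real.exp (-(m * x)) ≤ 2 * (1 + Real.exp (-(k * x))) := by
    rcases le_total 0 x with hx | hx
    · have : Real.exp (-(m * x)) ≤ 1 := Real.exp_le_one_iff.2 (by nlinarith)
      linarith [Real.exp_pos (-(k * x))]
    · have : Real.exp (-(m * x)) ≤ Real.exp (-(k * x)) := Real.exp_le_exp.2 (by nlinarith)
      linarith [Real.exp_pos (-(k * x))]
  rw [mul_div_assoc', div_le_div_iff₀ (by positivity) (by positivity)]
  have h2 : (1 + Real.exp (-(m * x))) ^ 2 ≤ 4 * (1 + Real.exp (-(k * x))) ^ 2 := by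
    refine (pow_le_pow_left₀ (by positivity) h 2).trans (le_of_eq (by ring))
  have h3 := mul_le_mul_of_nonneg_left h2 (by positivity : 0 ≤ m * Real.exp (-(m * x)))
  linarith

/-- The thermal interpolation has bounded variation, uniformly in its parameters. -/
lemma integral_abs_thermalRatioDeriv_le {p q : ℝ} (hpq : |p| ≤ q) {a b : ℝ} (hab : a ≤ b) :
    ∫ ω in a..b, |thermalRatioDeriv p q ω| ≤ 8 := by
  have hp := abs_le.1 hpq
  set m := q - p with hm
  set m' := q + p with hm'
  have hm0 : 0 ≤ m := by simp only [hm]; linarith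
  have hm0' : 0 ≤ m' := by simp only [hm']; linarith
  set l : ℝ → ℝ → ℝ := fun c x => c * Real.exp (-(c * x)) / (1 + Real.exp (-(c * x))) ^ 2 with hl
  have hpt : ∀ x, |thermalRatioDeriv p q x| ≤ 4 * l m x + 4 * l m' (-x) := fun x => by
    have h1 := mul_exp_div_sq_le (x := x) hm0 (by linarith : m ≤ 2 * q)
    have h2 := mul_exp_div_sq_le (x := -x) hm0' (by linarith : m' ≤ 2 * q)
    have e : thermalRatioDeriv p q x =
        -(m * Real.exp (-(m * x)) / (1 + Real.exp (-(2 * q * x))) ^ 2) +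
        m' * Real.exp (-(m' * -x)) / (1 + Real.exp (-(2 * q * -x))) ^ 2 := by
      have e1 : Real.exp (-(m * x)) = Real.exp (p * x) * Real.exp (-(q * x)) := by
        rw [← Real.exp_add]; congr 1; simp only [hm]; ring
      have e2 : Real.exp (-(m' * -x)) = Real.exp (p * x) * Real.exp (q * x) := by
        rw [← Real.exp_add]; congr 1; simp only [hm']; ring
      have e3 : Real.exp (-(2 * q * x)) = Real.exp (-(q * x)) ^ 2 := by
        rw [← Real.exp_nat_mul]; congr 1; push_cast; ring
      have e4 : Real.exp (-(2 * q * -x)) = Real.exp (q * x) ^ 2 := by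
        rw [← Real.exp_nat_mul]; congr 1; push_cast; ring
      rw [thermalRatioDeriv, e1, e2, e3, e4]
      have hinv : Real.exp (-(q * x)) = (Real.exp (q * x))⁻¹ := Real.exp_neg _
      rw [hinv]
      have hy : Real.exp (q * x) ≠ 0 := (Real.exp_pos _).ne'
      have hy2 : Real.exp (q * x) ^ 2 + 1 ≠ 0 := by positivity
      have hy3 : 1 + Real.exp (q * x) ^ 2 ≠ 0 := by positivity
      simp only [hm, hm']
      field_simp
      ring
    rw [e]
    have n1 : 0 ≤ m * Real.exp (-(m * x)) / (1 + Real.exp (-(2 * q * x))) ^ 2 := by positivity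
    have n2 : 0 ≤ m' * Real.exp (-(m' * -x)) / (1 + Real.exp (-(2 * q * -x))) ^ 2 := by positivity
    refine (abs_add_le _ _).trans ?_
    rw [abs_neg, abs_of_nonneg n1, abs_of_nonneg n2]
    exact add_le_add h1 h2
  have hσd : ∀ c x : ℝ, HasDerivAt (fun x => (1 + Real.exp (-(c * x)))⁻¹) (l c x) x := fun c x => by
    have h1 : HasDerivAt (fun x => 1 + Real.exp (-(c * x))) (Real.exp (-(c * x)) * -(c * 1)) x :=
      (((hasDerivAt_id' x).const_mul c).neg.exp).const_add 1
    refine (h1.inv (by positivity)).congr_deriv ?_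
    simp only [hl]; ring
  have hlc : ∀ c, Continuous (l c) := fun c =>
    Continuous.div (by fun_prop) (by fun_prop) fun ω => by positivity
  have hW : ∀ x, HasDerivAt (fun x => 4 * (1 + Real.exp (-(m * x)))⁻¹
      - 4 * (1 + Real.exp (-(m' * -x)))⁻¹) (4 * l m x + 4 * l m' (-x)) x := fun x => by
    have h2 := (hσd m' (-x)).scomp x (hasDerivAt_neg x)
    refine (((hσd m x).const_mul 4).sub (h2.const_mul 4)).congr_deriv ?_
    simp
  have hc' : Continuous fun x => 4 * l m x + 4 * l m' (-x) :=
    ((hlc m).const_mul 4).add (((hlc m').comp continuous_neg).const_mul 4)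
  refine (intervalIntegral.integral_mono_on hab
    ((continuous_thermalRatioDeriv p q).abs.intervalIntegrable _ _)
    (hc'.intervalIntegrable _ _) fun x _ => hpt x).trans ?_
  rw [intervalIntegral.integral_eq_sub_of_hasDerivAt (fun x _ => hW x) (hc'.intervalIntegrable _ _)]
  have hb : ∀ y : ℝ, 0 ≤ (1 + Real.exp y)⁻¹ ∧ (1 + Real.exp y)⁻¹ ≤ 1 := fun y =>
    ⟨by positivity, inv_le_one_of_one_le₀ (by linarith [Real.exp_pos y])⟩
  linarith [(hb (-(m * b))).2, (hb (-(m' * -b))).1, (hb (-(m * a))).1, (hb (-(m' * -a))).2]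

/-- The symmetrised frequency density `G(ω) = g(ω) + g(-ω)`: a nonnegative function of total mass
two which vanishes at infinity, is locally absolutely continuous, and has `‖G'‖₁ ≤ M`. -/
structure IsSymmetrisedDensity (G : ℝ → ℝ) (M : ℝ) : Prop where
  nonneg : ∀ ω, 0 ≤ G ω
  integrable : Integrable G
  integral_eq : ∫ ω, G ω = 2
  tendsto : Tendsto G (cocompact ℝ) (𝓝 0)
  absolutelyContinuous : ∀ a b, AbsolutelyContinuousOnInterval G a b
  integrable_deriv : Integrable (deriv G)
  integral_abs_deriv_le : ∫ ω, |deriv G ω| ≤ M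

/-- The frequency weight `G(ω) e^{pω} / (e^{qω} + e^{-qω})`. -/
def thermalWeight (G : ℝ → ℝ) (p q ω : ℝ) : ℂ := ((G ω * thermalRatio p q ω : ℝ) : ℂ)

variable {G : ℝ → ℝ} {M p q : ℝ}

lemma integrable_thermalWeight_real (hG : IsSymmetrisedDensity G M) (hpq : |p| ≤ q) :
    Integrable fun ω => G ω * thermalRatio p q ω :=
  hG.integrable.mul_bdd (c := 1) (continuous_thermalRatio p q).aestronglyMeasurable
    (.of_forall fun ω => by
      rw [Real.norm_eq_abs, abs_of_nonneg (thermalRatio_nonneg p q ω)]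
      exact thermalRatio_le_one hpq ω)

lemma integrable_thermalWeight (hG : IsSymmetrisedDensity G M) (hpq : |p| ≤ q) :
    Integrable (thermalWeight G p q) :=
  (integrable_thermalWeight_real hG hpq).ofReal

lemma norm_thermalWeight_le (hG : IsSymmetrisedDensity G M) (hpq : |p| ≤ q) (ω : ℝ) :
    ‖thermalWeight G p q ω‖ ≤ G ω := by
  rw [thermalWeight, Complex.norm_real, norm_mul, Real.norm_eq_abs, Real.norm_eq_abs,
    abs_of_nonneg (hG.nonneg ω), abs_of_nonneg (thermalRatio_nonneg p q ω)]
  exact mul_le_of_le_one_right (hG.nonneg ω) (thermalRatio_le_one hpq ω)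

lemma norm_weightFourier_thermalWeight_le (hG : IsSymmetrisedDensity G M) (hpq : |p| ≤ q) (c : ℝ) :
    ‖weightFourier (thermalWeight G p q) c‖ ≤ 2 := by
  rw [← hG.integral_eq]
  refine norm_integral_le_of_norm_le hG.integrable (.of_forall fun ω => ?_)
  rw [norm_mul, norm_phase, mul_one]
  exact norm_thermalWeight_le hG hpq ω

/-- An oscillating primitive of the thermal interpolation is of size `1 / |c|`. -/
lemma abs_integral_thermalRatio_mul_cos_le (hpq : |p| ≤ q) {c : ℝ} (hc : c ≠ 0) (θ x : ℝ) :
    |∫ ω in (0 : ℝ)..x, thermalRatio p q ω * Real.cos (c * ω + θ)| ≤ 10 / |c| := by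
  have hs : ∀ ω, HasDerivAt (fun ω => Real.sin (c * ω + θ) / c) (Real.cos (c * ω + θ)) ω :=
    fun ω => by
      have h1 : HasDerivAt (fun ω => c * ω + θ) (c * 1) ω :=
        ((hasDerivAt_id' ω).const_mul c).add_const θ
      refine (h1.sin.div_const c).congr_deriv ?_
      field_simp
  have hd := continuous_thermalRatioDeriv p q
  rw [intervalIntegral.integral_mul_deriv_eq_deriv_mul (fun ω _ => hasDerivAt_thermalRatio p q ω)
    (fun ω _ => hs ω) (hd.intervalIntegrable _ _)
    (Continuous.intervalIntegrable (by fun_prop) _ _)]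
  have hsin : ∀ ω, |Real.sin (c * ω + θ) / c| ≤ 1 / |c| := fun ω => by
    rw [abs_div]
    exact div_le_div_of_nonneg_right (Real.abs_sin_le_one _) (abs_nonneg c)
  have hc0 : 0 ≤ 1 / |c| := by positivity
  have hbdry : ∀ ω, |thermalRatio p q ω * (Real.sin (c * ω + θ) / c)| ≤ 1 / |c| := fun ω => by
    rw [abs_mul, abs_of_nonneg (thermalRatio_nonneg p q ω)]
    exact (mul_le_mul (thermalRatio_le_one hpq ω) (hsin ω) (abs_nonneg _) zero_le_one).trans
      (one_mul _).le
  have hint : |∫ ω in (0 : ℝ)..x, thermalRatioDeriv p q ω * (Real.sin (c * ω + θ) / c)|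
      ≤ 8 * (1 / |c|) := by
    have hmain : ∀ a b : ℝ, a ≤ b →
        |∫ ω in a..b, thermalRatioDeriv p q ω * (Real.sin (c * ω + θ) / c)| ≤ 8 * (1 / |c|) :=
      fun a b hab => by
        have h1 := intervalIntegral.norm_integral_le_of_norm_le hab (μ := volume)
          (f := fun ω => thermalRatioDeriv p q ω * (Real.sin (c * ω + θ) / c))
          (g := fun ω => |thermalRatioDeriv p q ω| * (1 / |c|)) (.of_forall fun ω _ => by
            rw [Real.norm_eq_abs, abs_mul]
            exact mul_le_mul_of_nonneg_left (hsin ω) (abs_nonneg _))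
          (Continuous.intervalIntegrable (by fun_prop) _ _)
        rw [intervalIntegral.integral_mul_const] at h1
        exact h1.trans (mul_le_mul_of_nonneg_right (integral_abs_thermalRatioDeriv_le hpq hab) hc0)
    rcases le_total 0 x with hx | hx
    · exact hmain 0 x hx
    · rw [intervalIntegral.integral_symm, abs_neg]
      exact hmain x 0 hx
  have h3 := (abs_sub _ _).trans (add_le_add ((abs_sub _ _).trans (add_le_add (hbdry x) (hbdry 0)))
    hint)
  refine h3.trans (le_of_eq ?_)
  ring

/-- Integration by parts against the absolutely continuous density gives decay `1 / |c|` of the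
Fourier transform. The phase is absorbed into `θ`, which keeps the computation real. -/
lemma norm_weightFourier_thermalWeight_le_div (hG : IsSymmetrisedDensity G M) (hpq : |p| ≤ q)
    {c : ℝ} (hc : c ≠ 0) : ‖weightFourier (thermalWeight G p q) c‖ ≤ 10 * M / |c| := by
  set z := weightFourier (thermalWeight G p q) c with hz
  set θ := -Complex.arg z with hθ
  have hw := integrable_thermalWeight hG hpq
  have hwr := integrable_thermalWeight_real hG hpq
  have hre : ‖z‖ = ∫ ω, G ω * thermalRatio p q ω * Real.cos (c * ω + θ) := by
    have h1 : (‖z‖ : ℂ) = phase θ * z := by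
      conv_rhs => rw [← Complex.norm_mul_exp_arg_mul_I z]
      rw [phase, hθ, mul_left_comm, ← Complex.exp_add]
      simp
    have hi : Integrable fun ω => phase θ * (thermalWeight G p q ω * phase (c * ω)) :=
      (integrable_weight_mul hw (F := fun ω => phase (c * ω)) (by fun_prop)
        (fun ω => (norm_phase _).le)).const_mul _
    rw [hz, weightFourier, ← integral_const_mul] at h1
    have h2 := congrArg Complex.re h1
    rw [Complex.ofReal_re] at h2
    refine (show ‖z‖ = _ from h2).trans ?_
    have h3 := integral_re hi
    simp only [RCLike.re_to_complex] at h3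
    rw [← h3]
    refine integral_congr_ae (.of_forall fun ω => ?_)
    have e : phase θ * (thermalWeight G p q ω * phase (c * ω)) =
        ((G ω * thermalRatio p q ω : ℝ) : ℂ) * phase (c * ω + θ) := by
      rw [phase_add, thermalWeight]; ring
    simp only [e, Complex.re_ofReal_mul]
    rw [phase, Complex.exp_ofReal_mul_I_re]
  set v : ℝ → ℝ := fun x => ∫ ω in (0 : ℝ)..x, thermalRatio p q ω * Real.cos (c * ω + θ) with hv
  have hfc : Continuous fun ω => thermalRatio p q ω * Real.cos (c * ω + θ) := by fun_prop
  have hvd : ∀ x, deriv v x = thermalRatio p q x * Real.cos (c * x + θ) := fun x =>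
    hfc.deriv_integral _ 0 x
  have hvb : ∀ x, |v x| ≤ 10 / |c| := abs_integral_thermalRatio_mul_cos_le hpq hc θ
  have hb0 : 0 ≤ 10 / |c| := by positivity
  have hi : Integrable fun ω => G ω * thermalRatio p q ω * Real.cos (c * ω + θ) :=
    hwr.mul_bdd (c := 1) (Continuous.aestronglyMeasurable (by fun_prop))
      (.of_forall fun ω => Real.abs_cos_le_one _)
  have hle : ∀ R : ℝ, 0 ≤ R → ∫ ω in (-R)..R, G ω * thermalRatio p q ω * Real.cos (c * ω + θ) ≤
      (|G R| + |G (-R)|) * (10 / |c|) + 10 * M / |c| := fun R hR => by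
    have hac : AbsolutelyContinuousOnInterval v (-R) R :=
      (hfc.intervalIntegrable _ _).absolutelyContinuousOnInterval_intervalIntegral
        (by rw [Set.mem_uIcc]; left; constructor <;> linarith)
    have hparts := (hG.absolutelyContinuous (-R) R).integral_mul_deriv_eq_deriv_mul hac
    simp only [hvd] at hparts
    simp only [mul_assoc]
    rw [hparts]
    have h1 : |∫ x in (-R)..R, deriv G x * v x| ≤ M * (10 / |c|) := by
      have h2 := intervalIntegral.norm_integral_le_of_norm_le (by linarith : -R ≤ R) (μ := volume)
        (f := fun x => deriv G x * v x) (g := fun x => |deriv G x| * (10 / |c|))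
        (.of_forall fun ω _ => by
          rw [Real.norm_eq_abs, abs_mul]
          exact mul_le_mul_of_nonneg_left (hvb ω) (abs_nonneg _))
        ((hG.integrable_deriv.abs.mul_const _).intervalIntegrable)
      refine h2.trans ?_
      rw [intervalIntegral.integral_mul_const]
      refine mul_le_mul_of_nonneg_right (le_trans ?_ hG.integral_abs_deriv_le) hb0
      rw [intervalIntegral.integral_of_le (by linarith)]
      exact setIntegral_le_integral hG.integrable_deriv.abs (.of_forall fun _ => abs_nonneg _)
    have h2 : G R * v R ≤ |G R| * (10 / |c|) := (le_abs_self _).trans (by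
      rw [abs_mul]; exact mul_le_mul_of_nonneg_left (hvb R) (abs_nonneg _))
    have h3 : -(G (-R) * v (-R)) ≤ |G (-R)| * (10 / |c|) := (neg_le_abs _).trans (by
      rw [abs_mul]; exact mul_le_mul_of_nonneg_left (hvb (-R)) (abs_nonneg _))
    have h4 := (abs_le.1 h1).1
    have h5 : M * (10 / |c|) = 10 * M / |c| := by ring
    linarith
  have hlim1 : Tendsto (fun R : ℝ => ∫ ω in (-R)..R,
      G ω * thermalRatio p q ω * Real.cos (c * ω + θ)) atTop
      (𝓝 (∫ ω, G ω * thermalRatio p q ω * Real.cos (c * ω + θ))) :=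
    intervalIntegral_tendsto_integral hi tendsto_neg_atTop_atBot tendsto_id
  have hG1 : Tendsto (fun R : ℝ => G R) atTop (𝓝 0) := hG.tendsto.mono_left atTop_le_cocompact
  have hG2 : Tendsto (fun R : ℝ => G (-R)) atTop (𝓝 0) :=
    (hG.tendsto.mono_left atBot_le_cocompact).comp tendsto_neg_atTop_atBot
  have hlim2 : Tendsto (fun R : ℝ => (|G R| + |G (-R)|) * (10 / |c|) + 10 * M / |c|) atTop
      (𝓝 ((|(0 : ℝ)| + |(0 : ℝ)|) * (10 / |c|) + 10 * M / |c|)) :=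
    ((hG1.abs.add hG2.abs).mul_const _).add_const _
  rw [hre]
  refine (le_of_tendsto_of_tendsto hlim1 hlim2
    ((eventually_ge_atTop 0).mono fun R hR => hle R hR)).trans (le_of_eq ?_)
  simp

lemma norm_weightFourier_thermalWeight_le_one_add (hG : IsSymmetrisedDensity G M) (hpq : |p| ≤ q)
    (c : ℝ) : ‖weightFourier (thermalWeight G p q) c‖ ≤ (2 + 10 * M) * (1 + |c|)⁻¹ := by
  have hM : 0 ≤ M := (integral_nonneg fun _ => abs_nonneg _).trans hG.integral_abs_deriv_le
  rw [← div_eq_mul_inv, le_div_iff₀ (by positivity), mul_add, mul_one]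
  refine add_le_add (norm_weightFourier_thermalWeight_le hG hpq c) ?_
  rcases eq_or_ne c 0 with rfl | hc
  · simp only [abs_zero, mul_zero]; positivity
  · exact (le_div_iff₀ (abs_pos.2 hc)).1 (norm_weightFourier_thermalWeight_le_div hG hpq hc)

end Weights

noncomputable section Weights

open MeasureTheory Filter Topology

/-- The symmetrised density `g(ω) + g(-ω)`. -/
def symmetrisedDensity (g : ℝ → ℝ) (ω : ℝ) : ℝ := g ω + g (-ω)

lemma gammaFilter_add_gammaTilde (g : ℝ → ℝ) (β ω : ℝ) :
    gammaFilter g β ω + gammaTilde g β ω = symmetrisedDensity g ω := by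
  have : 1 + Real.exp (β * ω) ≠ 0 := by positivity
  simp only [gammaTilde, gammaFilter, symmetrisedDensity]
  field_simp

lemma gammaTilde_eq_gammaFilter_neg (g : ℝ → ℝ) (β ω : ℝ) :
    gammaTilde g β ω = gammaFilter g β (-ω) := by
  have h1 : 1 + Real.exp (β * ω) ≠ 0 := by positivity
  have h2 : 1 + Real.exp (β * -ω) ≠ 0 := by positivity
  have h3 : Real.exp (β * -ω) * Real.exp (β * ω) = 1 := by
    rw [← Real.exp_add]; simp
  simp only [gammaTilde, gammaFilter, neg_neg]
  rw [div_mul_eq_mul_div, div_eq_div_iff h1 h2]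
  linear_combination (g ω + g (-ω)) * h3

/-- The hypotheses on `γ` and `γ̃` amount to regularity of `G(ω) = g(ω) + g(-ω)`, because
`γ + γ̃ = G` and `γ̃(ω) = γ(-ω)`. -/
lemma isSymmetrisedDensity {g : ℝ → ℝ} {β : ℝ} (hg0 : ∀ ω, 0 ≤ g ω) (hg : Integrable g)
    (hg1 : ∫ ω, g ω = 1) (hlim : Tendsto (gammaFilter g β) (cocompact ℝ) (𝓝 0))
    (h1 : HasL1Deriv (gammaFilter g β)) (h2 : HasL1Deriv (gammaTilde g β)) :
    IsSymmetrisedDensity (symmetrisedDensity g)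
      (l1NormDeriv (gammaFilter g β) + l1NormDeriv (gammaTilde g β)) := by
  have hsum : symmetrisedDensity g = gammaFilter g β + gammaTilde g β :=
    funext fun ω => (gammaFilter_add_gammaTilde g β ω).symm
  -- Absolute continuity makes both summands differentiable almost everywhere.
  have hdiff : ∀ h : ℝ → ℝ, (∀ a b, AbsolutelyContinuousOnInterval h a b) →
      ∀ᵐ x, DifferentiableAt ℝ h x := fun h hh => by
    have hn : ∀ᵐ x, ∀ n : ℕ, x ∈ Set.uIcc (-(n : ℝ)) n → DifferentiableAt ℝ h x :=
      ae_all_iff.2 fun n => (hh (-(n : ℝ)) n).ae_differentiableAt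
    filter_upwards [hn] with x hx
    obtain ⟨n, hn⟩ := exists_nat_ge |x|
    exact hx n (by
      rw [Set.uIcc_of_le (by linarith [abs_nonneg x])]
      exact abs_le.1 hn)
  have hae : deriv (symmetrisedDensity g) =ᵐ[volume]
      deriv (gammaFilter g β) + deriv (gammaTilde g β) := by
    filter_upwards [hdiff _ h1.1, hdiff _ h2.1] with x hx1 hx2
    rw [hsum, deriv_add hx1 hx2]
    rfl
  exact
    { nonneg := fun ω => add_nonneg (hg0 _) (hg0 _)
      integrable := hg.add hg.comp_neg
      integral_eq := by
        have := integral_add hg hg.comp_neg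
        simp only [symmetrisedDensity]
        rw [this, integral_neg_eq_self g volume, hg1]
        norm_num
      tendsto := by
        have ht : Tendsto (gammaTilde g β) (cocompact ℝ) (𝓝 0) := by
          have := hlim.comp (Homeomorph.neg ℝ).isClosedEmbedding.tendsto_cocompact
          exact this.congr fun ω => (gammaTilde_eq_gammaFilter_neg g β ω).symm
        rw [hsum, ← add_zero (0 : ℝ)]
        exact hlim.add ht
      absolutelyContinuous := fun a b => by rw [hsum]; exact (h1.1 a b).add (h2.1 a b)
      integrable_deriv := (h1.2.add h2.2).congr hae.symm
      integral_abs_deriv_le := by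
        rw [l1NormDeriv, l1NormDeriv, ← integral_add h1.2.abs h2.2.abs]
        refine integral_mono_ae ((h1.2.add h2.2).congr hae.symm).abs (h1.2.abs.add h2.2.abs) ?_
        filter_upwards [hae] with x hx
        rw [hx]
        exact abs_add_le _ _ }

/-- The truncated kernel `1_{|x| ≤ σ} / (1 + |x|)`. -/
def truncatedKernel (σ x : ℝ) : ℝ := (Set.Iic σ).indicator (fun y => (1 + y)⁻¹) |x|

lemma truncatedKernel_nonneg (σ x : ℝ) : 0 ≤ truncatedKernel σ x :=
  Set.indicator_apply_nonneg fun _ => by positivity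

lemma integrable_truncatedKernel (σ : ℝ) : Integrable (truncatedKernel σ) := by
  have h : truncatedKernel σ = (Set.Icc (-σ) σ).indicator fun x => (1 + |x|)⁻¹ := by
    ext x
    simp only [truncatedKernel, Set.indicator, Set.mem_Iic, Set.mem_Icc, abs_le]
  rw [h, integrable_indicator_iff measurableSet_Icc]
  refine ContinuousOn.integrableOn_compact isCompact_Icc (Continuous.continuousOn ?_)
  exact Continuous.inv₀ (by fun_prop) fun x => by positivity

lemma integral_truncatedKernel {σ : ℝ} (hσ : 0 ≤ σ) :
    ∫ x, truncatedKernel σ x = 2 * Real.log (1 + σ) := by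
  simp only [truncatedKernel]
  rw [integral_comp_abs, setIntegral_indicator measurableSet_Iic, Set.Ioi_inter_Iic,
    ← intervalIntegral.integral_of_le hσ]
  have hd : ∀ x ∈ Set.uIcc 0 σ, HasDerivAt (fun x => Real.log (1 + x)) (1 + x)⁻¹ x := fun x hx => by
    rw [Set.uIcc_of_le hσ] at hx
    have h1 : (1 : ℝ) + x ≠ 0 := by linarith [hx.1]
    simpa using ((hasDerivAt_id' x).const_add 1).log h1
  rw [intervalIntegral.integral_eq_sub_of_hasDerivAt hd]
  · simp
  · refine ContinuousOn.intervalIntegrable (ContinuousOn.inv₀ (by fun_prop) fun x hx => ?_)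
    rw [Set.uIcc_of_le hσ] at hx
    linarith [hx.1]

lemma inv_one_add_abs_le {σ : ℝ} (hσ : 0 ≤ σ) (x : ℝ) :
    (1 + |x|)⁻¹ ≤ truncatedKernel σ x + (1 + σ)⁻¹ := by
  by_cases h : |x| ≤ σ
  · rw [truncatedKernel, Set.indicator_of_mem (Set.mem_Iic.2 h)]
    have : 0 ≤ (1 + σ)⁻¹ := by positivity
    linarith
  · rw [truncatedKernel, Set.indicator_of_notMem (by exact h), zero_add]
    exact inv_anti₀ (by positivity) (by linarith)

variable {G : ℝ → ℝ} {M p q : ℝ}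

/-- The coupling averaged against the Fourier transform of a thermal weight. The decay `1 / |c|`
integrates to a logarithm over the time scale `σ`. -/
lemma integral_coupling_mul_weightFourier_le (hG : IsSymmetrisedDensity G M) (hpq : |p| ≤ q)
    {u : ℝ → ℝ} (hu : Continuous u) {a T σ u₀ U : ℝ} (haT : a ≤ T) (hσ : 0 ≤ σ)
    (hu₀ : ∀ s, |u s| ≤ u₀) (hU : ∫ s in a..T, |u s| ≤ U) (c : ℝ) :
    ∫ s in a..T, |u s| * (‖weightFourier (thermalWeight G p q) (c + s)‖
      + ‖weightFourier (thermalWeight G p q) (c - s)‖) ≤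
      (2 + 10 * M) * (4 * u₀ * Real.log (1 + σ) + 2 * (U * (1 + σ)⁻¹)) := by
  have hM : 0 ≤ M := (integral_nonneg fun _ => abs_nonneg _).trans hG.integral_abs_deriv_le
  have hŵ := continuous_weightFourier (integrable_thermalWeight hG hpq)
  have hu₀' : 0 ≤ u₀ := (abs_nonneg _).trans (hu₀ 0)
  have hk := integrable_truncatedKernel σ
  have hk1 : Integrable fun s => truncatedKernel σ (c + s) := hk.comp_add_left c
  have hk2 : Integrable fun s => truncatedKernel σ (c - s) := hk.comp_sub_left c
  have hpt : ∀ s, |u s| * (‖weightFourier (thermalWeight G p q) (c + s)‖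
      + ‖weightFourier (thermalWeight G p q) (c - s)‖) ≤
      (2 + 10 * M) * (u₀ * (truncatedKernel σ (c + s) + truncatedKernel σ (c - s))
        + |u s| * (2 * (1 + σ)⁻¹)) := fun s => by
    have h1 := (norm_weightFourier_thermalWeight_le_one_add hG hpq (c + s)).trans
      (mul_le_mul_of_nonneg_left (inv_one_add_abs_le hσ (c + s)) (by positivity))
    have h2 := (norm_weightFourier_thermalWeight_le_one_add hG hpq (c - s)).trans
      (mul_le_mul_of_nonneg_left (inv_one_add_abs_le hσ (c - s)) (by positivity))
    have h3 := mul_le_mul_of_nonneg_left (add_le_add h1 h2) (abs_nonneg (u s))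
    have h4 := mul_le_mul_of_nonneg_right (hu₀ s) (add_nonneg
      (truncatedKernel_nonneg σ (c + s)) (truncatedKernel_nonneg σ (c - s)))
    have h5 := mul_le_mul_of_nonneg_left h4 (by positivity : 0 ≤ 2 + 10 * M)
    refine h3.trans ?_
    linarith
  have hi1 : IntervalIntegrable (fun s => u₀ * (truncatedKernel σ (c + s)
      + truncatedKernel σ (c - s))) volume a T := ((hk1.add hk2).const_mul u₀).intervalIntegrable
  have hi2 : IntervalIntegrable (fun s => |u s| * (2 * (1 + σ)⁻¹)) volume a T :=
    Continuous.intervalIntegrable (by fun_prop) _ _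
  refine (intervalIntegral.integral_mono_on haT (Continuous.intervalIntegrable (by fun_prop) _ _)
    ((hi1.add hi2).const_mul (2 + 10 * M)) fun s _ => hpt s).trans ?_
  rw [intervalIntegral.integral_const_mul]
  refine mul_le_mul_of_nonneg_left ?_ (by positivity)
  rw [intervalIntegral.integral_add hi1 hi2, intervalIntegral.integral_const_mul,
    intervalIntegral.integral_mul_const]
  have hle : ∫ s in a..T, (truncatedKernel σ (c + s) + truncatedKernel σ (c - s)) ≤
      4 * Real.log (1 + σ) := by
    rw [intervalIntegral.integral_of_le haT]
    refine (setIntegral_le_integral (hk1.add hk2) (.of_forall fun s => add_nonneg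
      (truncatedKernel_nonneg _ _) (truncatedKernel_nonneg _ _))).trans (le_of_eq ?_)
    rw [integral_add' hk1 hk2, integral_add_left_eq_self (truncatedKernel σ) c,
      integral_sub_left_eq_self (truncatedKernel σ) volume c, integral_truncatedKernel hσ]
    ring
  have h1 := mul_le_mul_of_nonneg_left hle hu₀'
  have h2 := mul_le_mul_of_nonneg_right hU (by positivity : (0:ℝ) ≤ 2 * (1 + σ)⁻¹)
  linarith

/-! ### The Gaussian filter -/

/-- The normalisation `(2π)^{-1/4} σ^{-1/2}` of the Gaussian filter, i.e. its value at zero. -/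
def gaussianPeak (σ : ℝ) : ℝ := 1 / ((2 * Real.pi) ^ (1 / 4 : ℝ) * σ ^ (1 / 2 : ℝ))

lemma gaussianFilter_eq (σ t : ℝ) :
    gaussianFilter σ t = gaussianPeak σ * Real.exp (-t ^ 2 / (4 * σ ^ 2)) := rfl

lemma gaussianPeak_pos {σ : ℝ} (hσ : 0 < σ) : 0 < gaussianPeak σ := by
  unfold gaussianPeak; positivity

lemma gaussianPeak_le {σ : ℝ} (hσ : 0 < σ) : gaussianPeak σ ≤ 1 / √σ := by
  rw [gaussianPeak, ← Real.sqrt_eq_rpow]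
  have h1 : (1 : ℝ) ≤ (2 * Real.pi) ^ (1 / 4 : ℝ) :=
    Real.one_le_rpow (by linarith [Real.pi_gt_three]) (by norm_num)
  exact one_div_le_one_div_of_le (Real.sqrt_pos.2 hσ)
    (le_mul_of_one_le_left (Real.sqrt_nonneg σ) h1)

lemma continuous_gaussianFilter (σ : ℝ) : Continuous (gaussianFilter σ) := by
  unfold gaussianFilter; fun_prop

lemma gaussianFilter_nonneg {σ : ℝ} (hσ : 0 < σ) (t : ℝ) : 0 ≤ gaussianFilter σ t := by
  rw [gaussianFilter_eq]; have := gaussianPeak_pos hσ; positivity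

lemma gaussianFilter_le {σ : ℝ} (hσ : 0 < σ) (t : ℝ) : gaussianFilter σ t ≤ gaussianPeak σ := by
  rw [gaussianFilter_eq]
  refine mul_le_of_le_one_right (gaussianPeak_pos hσ).le (Real.exp_le_one_iff.2 ?_)
  exact div_nonpos_of_nonpos_of_nonneg (by nlinarith) (by positivity)

/-- The derivative of the Gaussian filter. -/
def gaussianFilterDeriv (σ t : ℝ) : ℝ := -(t / (2 * σ ^ 2)) * gaussianFilter σ t

lemma continuous_gaussianFilterDeriv (σ : ℝ) : Continuous (gaussianFilterDeriv σ) := by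
  have := continuous_gaussianFilter σ
  unfold gaussianFilterDeriv; fun_prop

lemma hasDerivAt_gaussianFilter (σ t : ℝ) :
    HasDerivAt (gaussianFilter σ) (gaussianFilterDeriv σ t) t := by
  have h1 : HasDerivAt (fun t : ℝ => -t ^ 2 / (4 * σ ^ 2)) (-(2 * t) / (4 * σ ^ 2)) t := by
    have := ((hasDerivAt_pow 2 t).neg).div_const (4 * σ ^ 2)
    simpa using this
  refine (h1.exp.const_mul (gaussianPeak σ)).congr_deriv ?_
  rw [gaussianFilterDeriv, gaussianFilter_eq]
  by_cases hσ : σ = 0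
  · simp [hσ]
  · field_simp; ring

/-- The total variation of the Gaussian filter on a symmetric interval, boundary jumps excluded,
is at most twice its peak. -/
lemma integral_abs_gaussianFilterDeriv_le {σ T : ℝ} (hσ : 0 < σ) (hT : 0 ≤ T) :
    ∫ t in (-T)..T, |gaussianFilterDeriv σ t| ≤ 2 * gaussianPeak σ := by
  have hc := continuous_gaussianFilterDeriv σ
  have hi : ∀ a b, IntervalIntegrable (gaussianFilterDeriv σ) volume a b := fun a b =>
    hc.intervalIntegrable a b
  have hf := gaussianFilter_nonneg hσ
  have hp : gaussianFilter σ 0 = gaussianPeak σ := by simp [gaussianFilter_eq]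
  have h1 : ∫ t in (-T)..0, |gaussianFilterDeriv σ t| ≤ gaussianPeak σ := by
    have : ∫ t in (-T)..0, |gaussianFilterDeriv σ t| = ∫ t in (-T)..0, gaussianFilterDeriv σ t := by
      refine intervalIntegral.integral_congr fun t ht => ?_
      rw [Set.uIcc_of_le (by linarith)] at ht
      refine abs_of_nonneg (mul_nonneg (neg_nonneg.2 ?_) (hf t))
      exact div_nonpos_of_nonpos_of_nonneg ht.2 (by positivity)
    rw [this, intervalIntegral.integral_eq_sub_of_hasDerivAt
      (fun t _ => hasDerivAt_gaussianFilter σ t) (hi _ _), hp]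
    linarith [hf (-T)]
  have h2 : ∫ t in (0 : ℝ)..T, |gaussianFilterDeriv σ t| ≤ gaussianPeak σ := by
    have : ∫ t in (0 : ℝ)..T, |gaussianFilterDeriv σ t| =
        ∫ t in (0 : ℝ)..T, -gaussianFilterDeriv σ t := by
      refine intervalIntegral.integral_congr fun t ht => ?_
      rw [Set.uIcc_of_le hT] at ht
      refine abs_of_nonpos (mul_nonpos_of_nonpos_of_nonneg (neg_nonpos.2 ?_) (hf t))
      exact div_nonneg ht.1 (by positivity)
    rw [this, intervalIntegral.integral_neg, intervalIntegral.integral_eq_sub_of_hasDerivAt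
      (fun t _ => hasDerivAt_gaussianFilter σ t) (hi _ _), hp]
    linarith [hf T]
  rw [← intervalIntegral.integral_add_adjacent_intervals (hc.abs.intervalIntegrable (-T) 0)
    (hc.abs.intervalIntegrable 0 T)]
  linarith

lemma integral_gaussianFilter_le {σ T : ℝ} (hσ : 0 < σ) (hT : 0 ≤ T) :
    ∫ t in (-T)..T, gaussianFilter σ t ≤ 4 * √σ := by
  have hb : 0 < 1 / (4 * σ ^ 2) := by positivity
  have he : ∀ t : ℝ, gaussianFilter σ t =
      gaussianPeak σ * Real.exp (-(1 / (4 * σ ^ 2)) * t ^ 2) := fun t => by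
    rw [gaussianFilter_eq]; congr 2; ring
  have hi : Integrable (gaussianFilter σ) := by
    rw [show gaussianFilter σ = _ from funext he]
    exact (integrable_exp_neg_mul_sq hb).const_mul _
  rw [intervalIntegral.integral_of_le (by linarith)]
  refine (setIntegral_le_integral hi (.of_forall (gaussianFilter_nonneg hσ))).trans ?_
  simp only [he]
  rw [integral_const_mul, integral_gaussian]
  have h1 : √(Real.pi / (1 / (4 * σ ^ 2))) ≤ 4 * σ := by
    refine Real.sqrt_le_iff.2 ⟨by positivity, ?_⟩
    rw [div_div_eq_mul_div, div_one]
    nlinarith [Real.pi_le_four, sq_nonneg σ]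
  refine (mul_le_mul (gaussianPeak_le hσ) h1 (Real.sqrt_nonneg _) (by positivity)).trans
    (le_of_eq ?_)
  have h2 := Real.mul_self_sqrt hσ.le
  have h3 := (Real.sqrt_pos.2 hσ).ne'
  field_simp
  nlinarith

lemma le_integral_gaussianFilter {σ T c : ℝ} (hσ : 0 < σ) (hc : 0 < c) (hT : c * σ ≤ T) :
    2 * c * ((2 * Real.pi) ^ (1 / 4 : ℝ))⁻¹ * Real.exp (-c ^ 2 / 4) * √σ ≤
      ∫ t in (-T)..T, gaussianFilter σ t := by
  have hcσ : 0 < c * σ := by positivity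
  have hcont := continuous_gaussianFilter σ
  refine le_trans ?_ (intervalIntegral.integral_mono_interval (a := -(c * σ)) (b := c * σ)
    (by linarith) (by linarith) hT (.of_forall (gaussianFilter_nonneg hσ))
    (hcont.intervalIntegrable _ _))
  have hle : ∀ t ∈ Set.Icc (-(c * σ)) (c * σ),
      gaussianPeak σ * Real.exp (-c ^ 2 / 4) ≤ gaussianFilter σ t := fun t ht => by
    rw [gaussianFilter_eq]
    refine mul_le_mul_of_nonneg_left (Real.exp_le_exp.2 ?_) (gaussianPeak_pos hσ).le
    have ht2 : t ^ 2 ≤ (c * σ) ^ 2 := sq_le_sq' ht.1 ht.2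
    rw [div_le_div_iff₀ (by norm_num) (by positivity)]
    nlinarith
  have h := intervalIntegral.integral_mono_on (by linarith : -(c * σ) ≤ c * σ)
    (μ := volume) intervalIntegrable_const (hcont.intervalIntegrable _ _) hle
  refine le_trans (le_of_eq ?_) h
  rw [intervalIntegral.integral_const, gaussianPeak, ← Real.sqrt_eq_rpow, smul_eq_mul]
  have h2 := Real.mul_self_sqrt hσ.le
  have h3 := (Real.sqrt_pos.2 hσ).ne'
  have h4 : (2 * Real.pi) ^ (1 / 4 : ℝ) ≠ 0 := by positivity
  field_simp
  nlinarith

end Weights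

/-! ### The interaction picture -/

noncomputable section InteractionPicture

open scoped Matrix.Norms.L2Operator
open Matrix MeasureTheory

variable {d : Type*} [Fintype d] [DecidableEq d]

lemma continuous_matrix_exp : Continuous (NormedSpace.exp : Matrix d d ℂ → Matrix d d ℂ) :=
  continuous_iff_continuousAt.2 fun x => (NormedSpace.exp_analytic (𝕂 := ℂ) x).continuousAt

lemma map_matrix_exp {e : Type*} [Fintype e] [DecidableEq e]
    {f : Matrix d d ℂ →⋆ₐ[ℂ] Matrix e e ℂ} (hf : Continuous f) (x : Matrix d d ℂ) :
    f (NormedSpace.exp x) = NormedSpace.exp (f x) :=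
  NormedSpace.map_exp_of_mem_ball (𝕂 := ℂ) f hf x
    ((NormedSpace.expSeries_radius_eq_top ℂ (Matrix d d ℂ)).symm ▸ edist_lt_top _ _)

/-- System operators acting on system ⊗ bath, `M ↦ M ⊗ 1`. -/
def systemEmbed : Matrix d d ℂ →⋆ₐ[ℂ] Matrix (d × Fin 2) (d × Fin 2) ℂ where
  toFun M := M ⊗ₖ (1 : Matrix (Fin 2) (Fin 2) ℂ)
  map_one' := Matrix.one_kronecker_one
  map_mul' M M' := by rw [← Matrix.mul_kronecker_mul, Matrix.one_mul]
  map_zero' := Matrix.zero_kronecker _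
  map_add' M M' := Matrix.add_kronecker _ _ _
  commutes' r := by
    rw [Algebra.algebraMap_eq_smul_one, Matrix.smul_kronecker, Matrix.one_kronecker_one,
      Algebra.algebraMap_eq_smul_one]
  map_star' M := by
    rw [star_eq_conjTranspose, star_eq_conjTranspose, conjTranspose_kronecker, conjTranspose_one]

/-- Bath operators acting on system ⊗ bath, `B ↦ 1 ⊗ B`. -/
def bathEmbed : Matrix (Fin 2) (Fin 2) ℂ →⋆ₐ[ℂ] Matrix (d × Fin 2) (d × Fin 2) ℂ where
  toFun B := (1 : Matrix d d ℂ) ⊗ₖ B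
  map_one' := Matrix.one_kronecker_one
  map_mul' M M' := by rw [← Matrix.mul_kronecker_mul, Matrix.one_mul]
  map_zero' := Matrix.kronecker_zero _
  map_add' M M' := Matrix.kronecker_add _ _ _
  commutes' r := by
    rw [Algebra.algebraMap_eq_smul_one, Matrix.kronecker_smul, Matrix.one_kronecker_one,
      Algebra.algebraMap_eq_smul_one]
  map_star' M := by
    rw [star_eq_conjTranspose, star_eq_conjTranspose, conjTranspose_kronecker, conjTranspose_one]

lemma systemEmbed_apply (M : Matrix d d ℂ) :
    systemEmbed M = M ⊗ₖ (1 : Matrix (Fin 2) (Fin 2) ℂ) := rfl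

lemma bathEmbed_apply (B : Matrix (Fin 2) (Fin 2) ℂ) :
    bathEmbed (d := d) B = (1 : Matrix d d ℂ) ⊗ₖ B := rfl

lemma systemEmbed_mul_bathEmbed (M : Matrix d d ℂ) (B : Matrix (Fin 2) (Fin 2) ℂ) :
    systemEmbed M * bathEmbed B = M ⊗ₖ B := by
  rw [systemEmbed_apply, bathEmbed_apply, ← Matrix.mul_kronecker_mul, Matrix.mul_one,
    Matrix.one_mul]

lemma systemEmbed_commute_bathEmbed (M : Matrix d d ℂ) (B : Matrix (Fin 2) (Fin 2) ℂ) :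
    Commute (systemEmbed M) (bathEmbed B) := by
  change systemEmbed M * bathEmbed B = bathEmbed B * systemEmbed M
  rw [systemEmbed_mul_bathEmbed, systemEmbed_apply, bathEmbed_apply, ← Matrix.mul_kronecker_mul,
    Matrix.mul_one, Matrix.one_mul]

lemma continuous_systemEmbed : Continuous (systemEmbed (d := d)) :=
  (AddMonoidHomClass.continuous_of_bound systemEmbed 1 fun M => by
    rw [one_mul]; exact NonUnitalStarAlgHom.norm_apply_le systemEmbed M)

lemma continuous_bathEmbed : Continuous (bathEmbed (d := d)) :=
  (AddMonoidHomClass.continuous_of_bound bathEmbed 1 fun M => by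
    rw [one_mul]; exact NonUnitalStarAlgHom.norm_apply_le bathEmbed M)

lemma norm_kronecker_le (M : Matrix d d ℂ) (B : Matrix (Fin 2) (Fin 2) ℂ) :
    ‖M ⊗ₖ B‖ ≤ ‖M‖ * ‖B‖ := by
  rw [← systemEmbed_mul_bathEmbed]
  exact (norm_mul_le _ _).trans (mul_le_mul (NonUnitalStarAlgHom.norm_apply_le systemEmbed M)
    (NonUnitalStarAlgHom.norm_apply_le bathEmbed B) (norm_nonneg _) (norm_nonneg _))

lemma norm_bathCoupling_le : ‖bathCoupling‖ ≤ 1 := by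
  have h : bathCouplingᴴ * bathCoupling = diagonal ![1, 0] := by
    ext i j
    fin_cases i <;> fin_cases j <;> simp [bathCoupling, Matrix.mul_apply]
  have h1 := Matrix.l2_opNorm_conjTranspose_mul_self bathCoupling
  rw [h, l2_opNorm_diagonal] at h1
  have h2 : ‖(![1, 0] : Fin 2 → ℂ)‖ ≤ 1 :=
    (pi_norm_le_iff_of_nonneg zero_le_one).2 fun i => by fin_cases i <;> simp
  nlinarith [norm_nonneg bathCoupling]

/-- The free Hamiltonian `H ⊗ 1 + 1 ⊗ H_E`. -/
def freeHamiltonian (H : Matrix d d ℂ) (ω : ℝ) : Matrix (d × Fin 2) (d × Fin 2) ℂ :=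
  systemEmbed H + bathEmbed (bathHamiltonian ω)

/-- The free evolution `e^{z (H ⊗ 1 + 1 ⊗ H_E)}` at a complex time `z`. -/
def freeEvolution (H : Matrix d d ℂ) (ω : ℝ) (z : ℂ) : Matrix (d × Fin 2) (d × Fin 2) ℂ :=
  NormedSpace.exp (z • freeHamiltonian H ω)

lemma bathHamiltonian_eq (ω : ℝ) :
    bathHamiltonian ω = diagonal ![(-ω / 2 : ℂ), (ω / 2 : ℂ)] := by
  ext i j
  fin_cases i <;> fin_cases j <;> simp [bathHamiltonian, neg_div]

lemma exp_smul_bathHamiltonian (ω : ℝ) (z : ℂ) : NormedSpace.exp (z • bathHamiltonian ω) =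
    diagonal ![Complex.exp (-(z * ω / 2)), Complex.exp (z * ω / 2)] := by
  rw [bathHamiltonian_eq, ← diagonal_smul, Matrix.exp_diagonal]
  congr 1
  ext i
  rw [Pi.coe_exp, ← Complex.exp_eq_exp_ℂ]
  fin_cases i
  · simp; ring_nf
  · simp; ring_nf

lemma isHermitian_bathHamiltonian (ω : ℝ) : (bathHamiltonian ω).IsHermitian := by
  rw [bathHamiltonian_eq, Matrix.IsHermitian, diagonal_conjTranspose]
  congr 1
  ext i
  fin_cases i <;> simp

lemma isHermitian_freeHamiltonian {H : Matrix d d ℂ} (hH : H.IsHermitian) (ω : ℝ) :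
    (freeHamiltonian H ω).IsHermitian := by
  have h1 : star (systemEmbed H) = systemEmbed H := by rw [← map_star]; exact congrArg _ hH
  have h2 : star (bathEmbed (d := d) (bathHamiltonian ω)) = bathEmbed (bathHamiltonian ω) := by
    rw [← map_star]; exact congrArg _ (isHermitian_bathHamiltonian ω)
  rw [Matrix.IsHermitian, freeHamiltonian, conjTranspose_add]
  exact congrArg₂ _ h1 h2

lemma freeEvolution_eq_kronecker (H : Matrix d d ℂ) (ω : ℝ) (z : ℂ) : freeEvolution H ω z =
    NormedSpace.exp (z • H) ⊗ₖ NormedSpace.exp (z • bathHamiltonian ω) := by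
  rw [freeEvolution, freeHamiltonian, smul_add, ← map_smul, ← map_smul,
    Matrix.exp_add_of_commute _ _ (systemEmbed_commute_bathEmbed _ _),
    ← map_matrix_exp continuous_systemEmbed,
    ← map_matrix_exp continuous_bathEmbed, systemEmbed_mul_bathEmbed]

lemma freeEvolution_add (H : Matrix d d ℂ) (ω : ℝ) (z w : ℂ) :
    freeEvolution H ω (z + w) = freeEvolution H ω z * freeEvolution H ω w := by
  rw [freeEvolution, add_smul, Matrix.exp_add_of_commute]
  · rfl
  · exact ((Commute.refl _).smul_left _).smul_right _

lemma freeEvolution_zero (H : Matrix d d ℂ) (ω : ℝ) : freeEvolution H ω 0 = 1 := by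
  rw [freeEvolution, zero_smul, NormedSpace.exp_zero]

lemma freeEvolution_neg_mul (H : Matrix d d ℂ) (ω : ℝ) (z : ℂ) :
    freeEvolution H ω (-z) * freeEvolution H ω z = 1 := by
  rw [← freeEvolution_add, neg_add_cancel, freeEvolution_zero]

lemma freeEvolution_mul_neg (H : Matrix d d ℂ) (ω : ℝ) (z : ℂ) :
    freeEvolution H ω z * freeEvolution H ω (-z) = 1 := by
  rw [← freeEvolution_add, add_neg_cancel, freeEvolution_zero]

lemma freeHamiltonian_commute (H : Matrix d d ℂ) (ω : ℝ) (z : ℂ) :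
    freeEvolution H ω z * freeHamiltonian H ω = freeHamiltonian H ω * freeEvolution H ω z :=
  (((Commute.refl (freeHamiltonian H ω)).smul_right z).exp_right).symm.eq

lemma freeEvolution_conjTranspose {H : Matrix d d ℂ} (hH : H.IsHermitian) (ω : ℝ) (z : ℂ) :
    (freeEvolution H ω z)ᴴ = freeEvolution H ω (star z) := by
  rw [freeEvolution, ← Matrix.exp_conjTranspose, conjTranspose_smul,
    (isHermitian_freeHamiltonian hH ω).eq, freeEvolution]

lemma continuous_freeEvolution (H : Matrix d d ℂ) :
    Continuous fun p : ℝ × ℂ => freeEvolution H p.1 p.2 := by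
  have h1 : Continuous fun ω : ℝ => bathHamiltonian ω := by unfold bathHamiltonian; fun_prop
  have h2 : Continuous fun ω : ℝ => freeHamiltonian H ω :=
    continuous_const.add (continuous_bathEmbed.comp h1)
  exact continuous_matrix_exp.comp (continuous_snd.smul (h2.comp continuous_fst))

lemma hasDerivAt_freeEvolution (H : Matrix d d ℂ) (ω : ℝ) (c : ℂ) (t : ℝ) :
    HasDerivAt (fun t : ℝ => freeEvolution H ω (t * c))
      (c • (freeHamiltonian H ω * freeEvolution H ω (t * c))) t := by
  have h1 := hasDerivAt_exp_smul_const' (𝕂 := ℂ) (freeHamiltonian H ω) ((t : ℂ) * c)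
  have h2 : HasDerivAt (fun t : ℝ => (t : ℂ) * c) c t := by
    simpa using (Complex.ofRealCLM.hasDerivAt (x := t)).mul_const c
  exact h1.scomp t h2

/-- A system operator in the Heisenberg picture, `e^{iHt} A e^{-iHt}`. -/
def heisenberg (H A : Matrix d d ℂ) (t : ℝ) : Matrix d d ℂ :=
  NormedSpace.exp ((t * Complex.I : ℂ) • H) * A * NormedSpace.exp (-(t * Complex.I : ℂ) • H)

lemma exp_mul_I_conjTranspose {H : Matrix d d ℂ} (hH : H.IsHermitian) (t : ℝ) :
    (NormedSpace.exp ((t * Complex.I : ℂ) • H))ᴴ =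
      NormedSpace.exp (-(t * Complex.I : ℂ) • H) := by
  rw [← Matrix.exp_conjTranspose, conjTranspose_smul, hH.eq]
  congr 2
  simp

lemma exp_neg_smul_mul (H : Matrix d d ℂ) (z : ℂ) :
    NormedSpace.exp (-z • H) * NormedSpace.exp (z • H) = 1 := by
  rw [← Matrix.exp_add_of_commute _ _ (((Commute.refl _).smul_left _).smul_right _), ← add_smul,
    neg_add_cancel, zero_smul, NormedSpace.exp_zero]

lemma exp_smul_mul_neg (H : Matrix d d ℂ) (z : ℂ) :
    NormedSpace.exp (z • H) * NormedSpace.exp (-z • H) = 1 := by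
  rw [← Matrix.exp_add_of_commute _ _ (((Commute.refl _).smul_left _).smul_right _), ← add_smul,
    add_neg_cancel, zero_smul, NormedSpace.exp_zero]

lemma norm_heisenberg_le {H : Matrix d d ℂ} (hH : H.IsHermitian) (A : Matrix d d ℂ) (t : ℝ) :
    ‖heisenberg H A t‖ ≤ ‖A‖ := by
  have h1 : ‖NormedSpace.exp ((t * Complex.I : ℂ) • H)‖ ≤ 1 := by
    refine norm_le_one_of_conjTranspose_mul_self ?_
    rw [exp_mul_I_conjTranspose hH, exp_neg_smul_mul]
  have h2 : ‖NormedSpace.exp (-(t * Complex.I : ℂ) • H)‖ ≤ 1 := by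
    rw [← exp_mul_I_conjTranspose hH, l2_opNorm_conjTranspose]
    exact h1
  refine (norm_mul_le _ _).trans ((mul_le_of_le_one_right (norm_nonneg _) h2).trans ?_)
  exact (norm_mul_le _ _).trans (mul_le_of_le_one_left (norm_nonneg _) h1)

lemma continuous_heisenberg (H A : Matrix d d ℂ) : Continuous (heisenberg H A) := by
  have h : ∀ z : ℝ → ℂ, Continuous z → Continuous fun t => NormedSpace.exp (z t • H) :=
    fun z hz => continuous_matrix_exp.comp (hz.smul continuous_const)
  exact ((h _ (by fun_prop)).mul continuous_const).mul (h _ (by fun_prop))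

lemma heisenberg_conjTranspose {H : Matrix d d ℂ} (hH : H.IsHermitian) (A : Matrix d d ℂ)
    (t : ℝ) : (heisenberg H A t)ᴴ = heisenberg H Aᴴ t := by
  rw [heisenberg, heisenberg, conjTranspose_mul, conjTranspose_mul, ← exp_mul_I_conjTranspose hH,
    conjTranspose_conjTranspose, Matrix.mul_assoc]

/-- The component of the interaction rotating as `e^{iωt}`. -/
def couplingPlus (H A : Matrix d d ℂ) (t : ℝ) : Matrix (d × Fin 2) (d × Fin 2) ℂ :=
  heisenberg H A t ⊗ₖ bathCoupling

/-- The component of the interaction rotating as `e^{-iωt}`. -/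
def couplingMinus (H A : Matrix d d ℂ) (t : ℝ) : Matrix (d × Fin 2) (d × Fin 2) ℂ :=
  heisenberg H Aᴴ t ⊗ₖ bathCouplingᴴ

lemma couplingPlus_conjTranspose {H : Matrix d d ℂ} (hH : H.IsHermitian) (A : Matrix d d ℂ)
    (t : ℝ) : (couplingPlus H A t)ᴴ = couplingMinus H A t := by
  rw [couplingPlus, conjTranspose_kronecker, heisenberg_conjTranspose hH, couplingMinus]

lemma isUnitCoupling {H A : Matrix d d ℂ} (hH : H.IsHermitian) (hA : ‖A‖ ≤ 1) :
    IsUnitCoupling (couplingPlus H A) (couplingMinus H A) where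
  continuous_plus := by
    have h : couplingPlus H A = fun t => systemEmbed (heisenberg H A t) * bathEmbed bathCoupling :=
      funext fun t => (systemEmbed_mul_bathEmbed _ _).symm
    rw [h]
    exact (continuous_systemEmbed.comp (continuous_heisenberg H A)).mul continuous_const
  continuous_minus := by
    have h : couplingMinus H A =
        fun t => systemEmbed (heisenberg H Aᴴ t) * bathEmbed bathCouplingᴴ :=
      funext fun t => (systemEmbed_mul_bathEmbed _ _).symm
    rw [h]
    exact (continuous_systemEmbed.comp (continuous_heisenberg H Aᴴ)).mul continuous_const
  norm_plus_le t := (norm_kronecker_le _ _).trans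
    (mul_le_one₀ ((norm_heisenberg_le hH A t).trans hA)
    (norm_nonneg _) norm_bathCoupling_le)
  norm_minus_le t := by
    rw [← couplingPlus_conjTranspose hH, l2_opNorm_conjTranspose]
    exact (norm_kronecker_le _ _).trans (mul_le_one₀ ((norm_heisenberg_le hH A t).trans hA)
      (norm_nonneg _) norm_bathCoupling_le)

/-- The time-independent part `A ⊗ B_E + A† ⊗ B_E†` of the interaction. -/
def bareCoupling (A : Matrix d d ℂ) : Matrix (d × Fin 2) (d × Fin 2) ℂ :=
  A ⊗ₖ bathCoupling + Aᴴ ⊗ₖ bathCouplingᴴ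

lemma totalHamiltonian_eq (H A : Matrix d d ℂ) (α σ ω t : ℝ) : totalHamiltonian H A α σ ω t =
    freeHamiltonian H ω + ((α * gaussianFilter σ t : ℝ) : ℂ) • bareCoupling A := rfl

lemma isHermitian_totalHamiltonian {H : Matrix d d ℂ} (hH : H.IsHermitian) (A : Matrix d d ℂ)
    (α σ ω t : ℝ) : (totalHamiltonian H A α σ ω t).IsHermitian := by
  rw [totalHamiltonian_eq, Matrix.IsHermitian, conjTranspose_add, conjTranspose_smul,
    (isHermitian_freeHamiltonian hH ω).eq, bareCoupling, conjTranspose_add,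
    conjTranspose_kronecker, conjTranspose_kronecker, conjTranspose_conjTranspose,
    conjTranspose_conjTranspose, add_comm (Aᴴ ⊗ₖ bathCouplingᴴ)]
  simp

lemma continuous_totalHamiltonian (H A : Matrix d d ℂ) (α σ : ℝ) :
    Continuous (Function.uncurry (totalHamiltonian H A α σ)) := by
  have h1 : Continuous fun ω : ℝ => bathHamiltonian ω := by unfold bathHamiltonian; fun_prop
  have h2 : Continuous fun ω : ℝ => freeHamiltonian H ω :=
    continuous_const.add (continuous_bathEmbed.comp h1)
  have h3 := continuous_gaussianFilter σ
  have h4 : Continuous fun p : ℝ × ℝ => ((α * gaussianFilter σ p.2 : ℝ) : ℂ) := by fun_prop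
  exact (h2.comp continuous_fst).add (h4.smul continuous_const)

/-- Conjugation by the free evolution makes the two components of the coupling rotate. -/
lemma freeEvolution_mul_bareCoupling (H A : Matrix d d ℂ) (ω t : ℝ) :
    freeEvolution H ω (t * Complex.I) * bareCoupling A * freeEvolution H ω (-(t * Complex.I)) =
      rotatingCoupling (couplingPlus H A) (couplingMinus H A) t ω := by
  have hb : NormedSpace.exp ((t * Complex.I : ℂ) • bathHamiltonian ω) * bathCoupling *
      NormedSpace.exp (-(t * Complex.I : ℂ) • bathHamiltonian ω) =
        phase (t * ω) • bathCoupling := by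
    rw [exp_smul_bathHamiltonian, exp_smul_bathHamiltonian]
    ext i j
    fin_cases i <;> fin_cases j <;>
      simp [bathCoupling, phase, ← Complex.exp_add]
    ring_nf
  have hb' : NormedSpace.exp ((t * Complex.I : ℂ) • bathHamiltonian ω) * bathCouplingᴴ *
      NormedSpace.exp (-(t * Complex.I : ℂ) • bathHamiltonian ω) =
        phase (-t * ω) • bathCouplingᴴ := by
    rw [exp_smul_bathHamiltonian, exp_smul_bathHamiltonian]
    ext i j
    fin_cases i <;> fin_cases j <;>
      simp [bathCoupling, phase, ← Complex.exp_add]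
    ring_nf
  rw [freeEvolution_eq_kronecker, freeEvolution_eq_kronecker, bareCoupling, Matrix.mul_add,
    Matrix.add_mul, ← Matrix.mul_kronecker_mul, ← Matrix.mul_kronecker_mul,
    ← Matrix.mul_kronecker_mul, ← Matrix.mul_kronecker_mul, hb, hb', Matrix.kronecker_smul,
    Matrix.kronecker_smul]
  rfl

/-- The evolution operator from time `-T` to time `t`. -/
def evolution (H A : Matrix d d ℂ) (α σ T t ω : ℝ) : Matrix (d × Fin 2) (d × Fin 2) ℂ :=
  timeOrderedExp (totalHamiltonian H A α σ ω) (-T) t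

/-- The evolution operator from time `-T` to time `t` in the interaction picture. -/
def scattering (H A : Matrix d d ℂ) (α σ T t ω : ℝ) : Matrix (d × Fin 2) (d × Fin 2) ℂ :=
  freeEvolution H ω (t * Complex.I) * evolution H A α σ T t ω * freeEvolution H ω (T * Complex.I)

variable {H A : Matrix d d ℂ} {α σ T : ℝ}

lemma continuous_evolution (H A : Matrix d d ℂ) (α σ T : ℝ) :
    Continuous fun p : ℝ × ℝ => evolution H A α σ T p.1 p.2 := by
  have h := continuous_timeOrderedExp (K := totalHamiltonian H A α σ)
    (continuous_totalHamiltonian H A α σ) (-T)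
  exact h.comp (f := fun p : ℝ × ℝ => (p.2, p.1)) (by fun_prop)

lemma conjTranspose_mul_evolution (hH : H.IsHermitian) (t ω : ℝ) :
    (evolution H A α σ T t ω)ᴴ * evolution H A α σ T t ω = 1 :=
  conjTranspose_mul_timeOrderedExp (continuous_totalHamiltonian H A α σ)
    (fun ω t => isHermitian_totalHamiltonian hH A α σ ω t) (-T) ω t

lemma freeEvolution_real_conjTranspose (hH : H.IsHermitian) (ω t : ℝ) :
    (freeEvolution H ω (t * Complex.I))ᴴ = freeEvolution H ω (-(t * Complex.I)) := by
  rw [freeEvolution_conjTranspose hH]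
  simp

lemma conjTranspose_mul_scattering (hH : H.IsHermitian) (t ω : ℝ) :
    (scattering H A α σ T t ω)ᴴ * scattering H A α σ T t ω = 1 := by
  have h1 := freeEvolution_neg_mul H ω (t * Complex.I)
  have h2 := freeEvolution_neg_mul H ω (T * Complex.I)
  have h3 := conjTranspose_mul_evolution (A := A) (α := α) (σ := σ) (T := T) hH t ω
  rw [scattering, conjTranspose_mul, conjTranspose_mul, freeEvolution_real_conjTranspose hH,
    freeEvolution_real_conjTranspose hH]
  calc _ = freeEvolution H ω (-(T * Complex.I)) * ((evolution H A α σ T t ω)ᴴ *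
        (freeEvolution H ω (-(t * Complex.I)) * freeEvolution H ω (t * Complex.I)) *
          evolution H A α σ T t ω) * freeEvolution H ω (T * Complex.I) := by
        simp only [Matrix.mul_assoc]
    _ = 1 := by rw [h1, Matrix.mul_one, h3, Matrix.mul_one, h2]

lemma scattering_mul_conjTranspose (hH : H.IsHermitian) (t ω : ℝ) :
    scattering H A α σ T t ω * (scattering H A α σ T t ω)ᴴ = 1 :=
  mul_eq_one_comm.1 (conjTranspose_mul_scattering hH t ω)

lemma scattering_start (H A : Matrix d d ℂ) (α σ T ω : ℝ) : scattering H A α σ T (-T) ω = 1 := by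
  have h : evolution H A α σ T (-T) ω = 1 :=
    timeOrderedExp_self (continuous_totalHamiltonian H A α σ) (-T) ω
  rw [scattering, h, Matrix.mul_one, Complex.ofReal_neg, neg_mul, freeEvolution_neg_mul]

lemma hasDerivAt_scattering (H A : Matrix d d ℂ) (α σ T t ω : ℝ) :
    HasDerivAt (fun t => scattering H A α σ T t ω)
      ((-(Complex.I * ((α * gaussianFilter σ t : ℝ) : ℂ))) •
        (rotatingCoupling (couplingPlus H A) (couplingMinus H A) t ω *
          scattering H A α σ T t ω)) t := by
  have h1 := hasDerivAt_freeEvolution H ω Complex.I t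
  have h2 : HasDerivAt (fun t => evolution H A α σ T t ω) _ t :=
    hasDerivAt_timeOrderedExp (continuous_totalHamiltonian H A α σ) (-T) ω t
  have h3 := (h1.mul h2).mul_const (freeEvolution H ω (T * Complex.I))
  refine h3.congr_deriv ?_
  change (Complex.I • (freeHamiltonian H ω * freeEvolution H ω (t * Complex.I)) *
    evolution H A α σ T t ω + freeEvolution H ω (t * Complex.I) *
      ((-Complex.I) • (totalHamiltonian H A α σ ω t * evolution H A α σ T t ω))) *
      freeEvolution H ω (T * Complex.I) = _
  rw [← freeEvolution_mul_bareCoupling, scattering, ← freeHamiltonian_commute,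
    totalHamiltonian_eq]
  have h4 : freeEvolution H ω (t * Complex.I) * bareCoupling A *
      freeEvolution H ω (-(t * Complex.I)) * (freeEvolution H ω (t * Complex.I) *
        evolution H A α σ T t ω * freeEvolution H ω (T * Complex.I)) =
      freeEvolution H ω (t * Complex.I) * bareCoupling A *
        (freeEvolution H ω (-(t * Complex.I)) * freeEvolution H ω (t * Complex.I)) *
        evolution H A α σ T t ω * freeEvolution H ω (T * Complex.I) := by
    simp only [Matrix.mul_assoc]
  rw [h4, freeEvolution_neg_mul, Matrix.mul_one]
  simp only [Matrix.add_mul, Matrix.mul_add, Matrix.smul_mul, Matrix.mul_smul, smul_add, smul_smul,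
    Matrix.mul_assoc, neg_smul, neg_mul, Matrix.mul_neg]
  abel

lemma rotatingCoupling_conjTranspose (hH : H.IsHermitian) (t ω : ℝ) :
    (rotatingCoupling (couplingPlus H A) (couplingMinus H A) t ω)ᴴ =
      rotatingCoupling (couplingPlus H A) (couplingMinus H A) t ω := by
  have hp : ∀ x : ℝ, star (phase x) = phase (-x) := fun x => by
    rw [phase, phase, Complex.star_def, ← Complex.exp_conj]
    simp
  rw [rotatingCoupling, conjTranspose_add, conjTranspose_smul, conjTranspose_smul, hp, hp,
    couplingPlus_conjTranspose hH, ← couplingPlus_conjTranspose hH, conjTranspose_conjTranspose,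
    add_comm]
  simp only [neg_mul, neg_neg]

lemma isPropagatorPair_scattering (hH : H.IsHermitian) :
    IsPropagatorPair (fun t => α * gaussianFilter σ t) (couplingPlus H A) (couplingMinus H A)
      (scattering H A α σ T) (fun t ω => (scattering H A α σ T t ω)ᴴ) := by
  have hE := continuous_freeEvolution H
  have hc : Continuous (Function.uncurry (scattering H A α σ T)) :=
    ((hE.comp (by fun_prop : Continuous fun p : ℝ × ℝ => (p.2, (p.1 : ℂ) * Complex.I))).mul
      (continuous_evolution H A α σ T)).mul
      (hE.comp (by fun_prop : Continuous fun p : ℝ × ℝ => (p.2, (T : ℂ) * Complex.I)))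
  have hn : ∀ t ω, ‖scattering H A α σ T t ω‖ ≤ 1 := fun t ω =>
    norm_le_one_of_conjTranspose_mul_self (conjTranspose_mul_scattering hH t ω)
  exact
    { continuous_left := hc
      continuous_right := hc.star
      norm_left_le := hn
      norm_right_le := fun t ω => by rw [l2_opNorm_conjTranspose]; exact hn t ω
      hasDerivAt_left := fun t ω => hasDerivAt_scattering H A α σ T t ω
      hasDerivAt_right := fun t ω => by
        refine ((hasDerivAt_scattering H A α σ T t ω).matrix_conjTranspose).congr_deriv ?_
        rw [conjTranspose_smul, conjTranspose_mul, rotatingCoupling_conjTranspose hH]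
        simp }

end InteractionPicture

/-! ### The commutator of the free Hamiltonian with the scattering operator -/

noncomputable section Commutator

/-- If the conjugated energy `R (K + u W) P` only varies by `v R W P`, then integrating from `a` to
`T` expresses the commutator `[K, P]` by insertions of the coupling. -/
lemma commutator_eq_insertedCommutator {𝔐 : Type*} [NormedRing 𝔐] [NormedAlgebra ℂ 𝔐]
    [CompleteSpace 𝔐] {u v : ℝ → ℝ} {Wp Wm : ℝ → 𝔐} {P R : ℝ → ℝ → 𝔐} {a T ω : ℝ} {K : 𝔐}
    (h : IsPropagatorPair u Wp Wm P R) (hW : Continuous fun r => rotatingCoupling Wp Wm r ω)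
    (hv : Continuous v)
    (hd : ∀ r, HasDerivAt
      (fun r => R r ω * (K + (u r : ℂ) • rotatingCoupling Wp Wm r ω) * P r ω)
      ((v r : ℂ) • (R r ω * rotatingCoupling Wp Wm r ω * P r ω)) r)
    (hPa : P a ω = 1) (hRa : R a ω = 1) (hPR : P T ω * R T ω = 1) :
    K * P T ω - P T ω * K = insertedCommutator v (u a) (u T) Wp Wm P R a T ω := by
  have hPc : Continuous fun r => P r ω :=
    h.continuous_left.comp (by fun_prop : Continuous fun r : ℝ => (r, ω))
  have hRc : Continuous fun r => R r ω :=
    h.continuous_right.comp (by fun_prop : Continuous fun r : ℝ => (r, ω))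
  have hc : Continuous fun r => (v r : ℂ) • (R r ω * rotatingCoupling Wp Wm r ω * P r ω) := by
    fun_prop
  have hftc := intervalIntegral.integral_eq_sub_of_hasDerivAt (fun r _ => hd r)
    (hc.intervalIntegrable (μ := MeasureTheory.volume) a T)
  have hint : ∫ r in a..T, (v r : ℂ) • (P T ω * R r ω * rotatingCoupling Wp Wm r ω * P r ω) =
      P T ω * ∫ r in a..T, (v r : ℂ) • (R r ω * rotatingCoupling Wp Wm r ω * P r ω) := by
    have h1 := (ContinuousLinearMap.mul ℂ 𝔐 (P T ω)).intervalIntegral_comp_comm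
      (hc.intervalIntegrable (μ := MeasureTheory.volume) a T)
    rw [ContinuousLinearMap.mul_apply'] at h1
    rw [← h1]
    congr 1
    ext1 r
    rw [ContinuousLinearMap.mul_apply', mul_smul_comm]
    simp only [mul_assoc]
  rw [insertedCommutator, hint, hftc, hPa, hRa, one_mul, mul_one, mul_sub, ← mul_assoc,
    ← mul_assoc, hPR, one_mul]
  simp only [mul_add, add_mul, mul_smul_comm, smul_mul_assoc]
  abel

open scoped Matrix.Norms.L2Operator
open Matrix MeasureTheory

variable {d : Type*} [Fintype d] [DecidableEq d] {H A : Matrix d d ℂ} {α σ T : ℝ}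

lemma hasDerivAt_rotatingCoupling (H A : Matrix d d ℂ) (t ω : ℝ) :
    HasDerivAt (fun t => rotatingCoupling (couplingPlus H A) (couplingMinus H A) t ω)
      (Complex.I • (freeHamiltonian H ω *
          rotatingCoupling (couplingPlus H A) (couplingMinus H A) t ω -
        rotatingCoupling (couplingPlus H A) (couplingMinus H A) t ω * freeHamiltonian H ω)) t := by
  have h1 := hasDerivAt_freeEvolution H ω Complex.I t
  have h2 := hasDerivAt_freeEvolution H ω (-Complex.I) t
  have h3 := (h1.mul_const (bareCoupling A)).mul h2
  simp only [← freeEvolution_mul_bareCoupling]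
  refine (h3.congr_deriv ?_).congr_of_eventuallyEq (Filter.Eventually.of_forall fun t => ?_)
  · simp only [mul_neg, neg_smul, smul_sub, Matrix.smul_mul, Matrix.mul_smul, Matrix.mul_assoc,
      freeHamiltonian_commute]
    abel
  · simp only [mul_neg, Pi.mul_apply]

/-- The energy `H ⊗ 1 + 1 ⊗ H_E` is conserved up to the variation of the envelope: conjugating
`H₀ + u W` back along the propagators leaves only the derivative `u' W`. -/
lemma hasDerivAt_conj_hamiltonian (hH : H.IsHermitian) (r ω : ℝ) :
    HasDerivAt (fun r => (scattering H A α σ T r ω)ᴴ *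
        (freeHamiltonian H ω + ((α * gaussianFilter σ r : ℝ) : ℂ) •
          rotatingCoupling (couplingPlus H A) (couplingMinus H A) r ω) * scattering H A α σ T r ω)
      (((α * gaussianFilterDeriv σ r : ℝ) : ℂ) • ((scattering H A α σ T r ω)ᴴ *
        rotatingCoupling (couplingPlus H A) (couplingMinus H A) r ω * scattering H A α σ T r ω))
      r := by
  have hpair := isPropagatorPair_scattering (A := A) (α := α) (σ := σ) (T := T) hH
  have h1 := hpair.hasDerivAt_left r ω
  have h2 := hpair.hasDerivAt_right r ω
  have h3 : HasDerivAt (fun r => ((α * gaussianFilter σ r : ℝ) : ℂ))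
      ((α * gaussianFilterDeriv σ r : ℝ) : ℂ) r :=
    ((hasDerivAt_gaussianFilter σ r).const_mul α).ofReal_comp
  have h4 := (h3.smul (hasDerivAt_rotatingCoupling H A r ω)).const_add (freeHamiltonian H ω)
  refine ((h2.mul h4).mul h1).congr_deriv ?_
  simp only [Pi.smul_apply', Pi.mul_apply, Matrix.mul_add, Matrix.add_mul, Matrix.mul_sub,
    Matrix.sub_mul, smul_add, smul_sub, Matrix.smul_mul, Matrix.mul_smul, smul_smul, Matrix.mul_assoc,
    neg_smul, Matrix.mul_neg]
  module

/-- The energy balance: the uncoupled energy fails to be conserved only through the variation of the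
envelope of the coupling, including its truncation at the times `±T`. -/
lemma freeHamiltonian_commutator_eq (hH : H.IsHermitian) (ω : ℝ) :
    freeHamiltonian H ω * scattering H A α σ T T ω -
        scattering H A α σ T T ω * freeHamiltonian H ω =
      insertedCommutator (fun r => α * gaussianFilterDeriv σ r) (α * gaussianFilter σ (-T))
        (α * gaussianFilter σ T) (couplingPlus H A) (couplingMinus H A) (scattering H A α σ T)
        (fun t ω => (scattering H A α σ T t ω)ᴴ) (-T) T ω := by
  have hpair := isPropagatorPair_scattering (A := A) (α := α) (σ := σ) (T := T) hH
  have hW : ∀ ω, Continuous fun r => rotatingCoupling (couplingPlus H A) (couplingMinus H A) r ω :=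
    fun ω => continuous_iff_continuousAt.2 fun r =>
      (hasDerivAt_rotatingCoupling H A r ω).continuousAt
  have hv : Continuous fun r => α * gaussianFilterDeriv σ r :=
    continuous_const.mul (continuous_gaussianFilterDeriv σ)
  have hRa : (scattering H A α σ T (-T) ω)ᴴ = 1 := by rw [scattering_start, conjTranspose_one]
  have hd := fun r => hasDerivAt_conj_hamiltonian (A := A) (α := α) (σ := σ) (T := T) hH r ω
  exact commutator_eq_insertedCommutator (u := fun t => α * gaussianFilter σ t)
    (v := fun r => α * gaussianFilterDeriv σ r) (P := scattering H A α σ T)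
    (R := fun t ω => (scattering H A α σ T t ω)ᴴ) hpair (hW ω) hv hd (scattering_start H A α σ T ω)
    hRa (scattering_mul_conjTranspose hH T ω)

end Commutator

/-! ### Duhamel's formula for the thermal state -/

noncomputable section Duhamel

open scoped Matrix.Norms.L2Operator
open Matrix MeasureTheory

variable {d : Type*} [Fintype d] [DecidableEq d]

/-- The projection onto a basis state of the bath. -/
def bathProjection (a : Fin 2) : Matrix (Fin 2) (Fin 2) ℂ := diagonal (Pi.single a 1)

lemma norm_bathEmbed_bathProjection_le (a : Fin 2) :
    ‖bathEmbed (d := d) (bathProjection a)‖ ≤ 1 := by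
  refine (NonUnitalStarAlgHom.norm_apply_le (bathEmbed (d := d)) _).trans ?_
  rw [bathProjection, l2_opNorm_diagonal]
  exact (pi_norm_le_iff_of_nonneg zero_le_one).2 fun i => by
    fin_cases a <;> fin_cases i <;> simp

/-- The bilinear pairing of two operators through a Gibbs state of the system cut at the inverse
temperature `s`, with the bath projected onto `a` and `b`. It is normalised by the trace of
`e^{-βH} ⊗ 1`, which is twice the partition function of the system. -/
def gibbsForm (H O : Matrix d d ℂ) (β s : ℝ) (a b : Fin 2)
    (B₁ B₂ : Matrix (d × Fin 2) (d × Fin 2) ℂ) : ℂ :=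
  (partitionFn (systemEmbed H) β : ℂ)⁻¹ *
    ((systemEmbed O * bathEmbed (bathProjection a)) *
      NormedSpace.exp ((-s : ℂ) • systemEmbed H) * (B₁ * bathEmbed (bathProjection b)) *
      NormedSpace.exp (((-(β - s) : ℝ) : ℂ) • systemEmbed H) * B₂).trace

lemma isHermitian_systemEmbed {H : Matrix d d ℂ} (hH : H.IsHermitian) :
    (systemEmbed H).IsHermitian := by
  have h1 : star (systemEmbed H) = systemEmbed H := by rw [← map_star]; exact congrArg _ hH
  exact h1

lemma norm_gibbsForm_le [Nonempty d] {H O : Matrix d d ℂ} (hH : H.IsHermitian) (hO : ‖O‖ ≤ 1)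
    {β s : ℝ} (hs : 0 ≤ s) (hsβ : s ≤ β) (a b : Fin 2)
    (B₁ B₂ : Matrix (d × Fin 2) (d × Fin 2) ℂ) :
    ‖gibbsForm H O β s a b B₁ B₂‖ ≤ ‖B₁‖ * ‖B₂‖ := by
  have hZ := partitionFn_pos (isHermitian_systemEmbed hH) β
  have h := norm_trace_gibbs_split_le (isHermitian_systemEmbed hH) hs hsβ
    (systemEmbed O * bathEmbed (bathProjection a)) (B₁ * bathEmbed (bathProjection b)) B₂
  have h1 : ‖systemEmbed O * bathEmbed (bathProjection a)‖ ≤ 1 :=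
    (norm_mul_le _ _).trans
      (mul_le_one₀ ((NonUnitalStarAlgHom.norm_apply_le systemEmbed O).trans hO)
      (norm_nonneg _) (norm_bathEmbed_bathProjection_le a))
  have h2 : ‖B₁ * bathEmbed (bathProjection b)‖ ≤ ‖B₁‖ :=
    (norm_mul_le _ _).trans (mul_le_of_le_one_right (norm_nonneg _)
      (norm_bathEmbed_bathProjection_le b))
  rw [gibbsForm, norm_mul, norm_inv, Complex.norm_real, Real.norm_of_nonneg hZ.le,
    inv_mul_le_iff₀ hZ]
  refine h.trans ?_
  rw [mul_comm]
  refine mul_le_mul_of_nonneg_left ?_ hZ.le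
  refine mul_le_mul_of_nonneg_right ?_ (norm_nonneg _)
  exact (mul_le_of_le_one_left (norm_nonneg _) h1).trans h2

/-- `gibbsForm` as a continuous bilinear form of norm at most `1`, to which the insertion estimates
apply; the bound is the interpolated Hölder inequality. -/
lemma exists_gibbsForm_clm [Nonempty d] {H O : Matrix d d ℂ} (hH : H.IsHermitian) (hO : ‖O‖ ≤ 1)
    {β s : ℝ} (hs : 0 ≤ s) (hsβ : s ≤ β) (a b : Fin 2) :
    ∃ F : Matrix (d × Fin 2) (d × Fin 2) ℂ →L[ℂ] Matrix (d × Fin 2) (d × Fin 2) ℂ →L[ℂ] ℂ,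
      ‖F‖ ≤ 1 ∧ ∀ B₁ B₂, F B₁ B₂ = gibbsForm H O β s a b B₁ B₂ := by
  let F₀ : Matrix (d × Fin 2) (d × Fin 2) ℂ →ₗ[ℂ] Matrix (d × Fin 2) (d × Fin 2) ℂ →ₗ[ℂ] ℂ :=
    LinearMap.mk₂ ℂ (gibbsForm H O β s a b)
      (fun B B' C => by simp only [gibbsForm, Matrix.add_mul, trace_add, mul_add])
      (fun c B C => by
        simp only [gibbsForm, Matrix.smul_mul, Matrix.mul_smul, trace_smul, smul_eq_mul]; ring)
      (fun B C C' => by simp only [gibbsForm, trace_add, mul_add])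
      (fun c B C => by
        simp only [gibbsForm, Matrix.mul_smul, trace_smul, smul_eq_mul]; ring)
  refine ⟨F₀.mkContinuous₂ 1 fun B C => ?_, LinearMap.mkContinuous₂_norm_le _ zero_le_one _,
    fun B C => rfl⟩
  rw [one_mul]
  exact norm_gibbsForm_le hH hO hs hsβ a b B C

lemma exp_smul_systemEmbed (H : Matrix d d ℂ) (z : ℂ) :
    NormedSpace.exp (z • systemEmbed H) = systemEmbed (NormedSpace.exp (z • H)) := by
  rw [← map_smul, map_matrix_exp continuous_systemEmbed]

/-- The coupling flips the bath, so that it has no diagonal blocks. -/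
lemma gibbsForm_kronecker_one (H O M : Matrix d d ℂ) (β s : ℝ) (a b : Fin 2)
    {B : Matrix (Fin 2) (Fin 2) ℂ} (hB : ∀ k, B k k = 0) :
    gibbsForm H O β s a b (M ⊗ₖ B) 1 = 0 := by
  have h : (bathProjection a * (B * bathProjection b)).trace = 0 := by
    rw [bathProjection, bathProjection, Matrix.trace]
    refine Finset.sum_eq_zero fun k _ => ?_
    rw [diag_apply, diagonal_mul, mul_diagonal, hB, zero_mul, mul_zero]
  rw [gibbsForm, exp_smul_systemEmbed, exp_smul_systemEmbed, systemEmbed_mul_bathEmbed,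
    Matrix.mul_one, systemEmbed_apply (NormedSpace.exp _), systemEmbed_apply (NormedSpace.exp _),
    bathEmbed_apply,
    ← Matrix.mul_kronecker_mul, ← Matrix.mul_kronecker_mul, ← Matrix.mul_kronecker_mul,
    ← Matrix.mul_kronecker_mul, Matrix.mul_one, Matrix.mul_one, trace_kronecker, Matrix.mul_one, h,
    mul_zero, mul_zero]

lemma gibbsForm_couplingPlus_one (H O A : Matrix d d ℂ) (β s : ℝ) (a b : Fin 2) (t : ℝ) :
    gibbsForm H O β s a b (couplingPlus H A t) 1 = 0 :=
  gibbsForm_kronecker_one H O _ β s a b fun k => by fin_cases k <;> simp [bathCoupling]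

lemma gibbsForm_couplingMinus_one (H O A : Matrix d d ℂ) (β s : ℝ) (a b : Fin 2) (t : ℝ) :
    gibbsForm H O β s a b (couplingMinus H A t) 1 = 0 :=
  gibbsForm_kronecker_one H O _ β s a b fun k => by fin_cases k <;> simp [bathCoupling]

end Duhamel

noncomputable section DuhamelAverage

open scoped Matrix.Norms.L2Operator
open Matrix MeasureTheory

variable {d : Type*} [Fintype d] [DecidableEq d]

/-- The expectation of `X` and `R` in the Gibbs state of the uncoupled system and bath, cut at the
inverse temperature `s`: `Tr (O e^{-sH₀} X e^{-(β-s)H₀} R) / Tr e^{-βH₀}`. -/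
def cutExpectation (H O : Matrix d d ℂ) (β ω s : ℝ) (X R : Matrix (d × Fin 2) (d × Fin 2) ℂ) : ℂ :=
  (freeEvolution H ω ((-β : ℝ) : ℂ)).trace⁻¹ * (systemEmbed O *
    freeEvolution H ω ((-s : ℝ) : ℂ) * X *
    freeEvolution H ω ((-(β - s) : ℝ) : ℂ) * R).trace

lemma trace_freeEvolution {H : Matrix d d ℂ} (hH : H.IsHermitian) (β ω : ℝ) :
    (freeEvolution H ω ((-β : ℝ) : ℂ)).trace =
      ((partitionFn H β * (Real.exp (β / 2 * ω) + Real.exp (-(β / 2 * ω))) : ℝ) : ℂ) := by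
  rw [freeEvolution_eq_kronecker, trace_kronecker, exp_smul_bathHamiltonian, trace_diagonal,
    Complex.ofReal_neg, trace_exp_eq_partitionFn hH, Fin.sum_univ_two]
  push_cast
  congr 3 <;> simp <;> ring_nf

lemma partitionFn_systemEmbed {H : Matrix d d ℂ} (hH : H.IsHermitian) (β : ℝ) :
    partitionFn (systemEmbed H) β = 2 * partitionFn H β := by
  rw [partitionFn, exp_smul_systemEmbed, systemEmbed_apply, trace_kronecker,
    trace_exp_eq_partitionFn hH]
  simp [mul_comm]

/-- The sign of the energy of a basis state of the bath, as it enters a Gibbs weight. -/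
def bathSign (a : Fin 2) : ℝ := ![1, -1] a

lemma abs_bathSign (a : Fin 2) : |bathSign a| = 1 := by
  fin_cases a <;> simp [bathSign]

lemma freeEvolution_eq_sum (H : Matrix d d ℂ) (ω s : ℝ) :
    freeEvolution H ω ((-s : ℝ) : ℂ) = ∑ a, (Real.exp (s * bathSign a / 2 * ω) : ℂ) •
      (bathEmbed (bathProjection a) * NormedSpace.exp ((-s : ℂ) • systemEmbed H)) := by
  have h : NormedSpace.exp (((-s : ℝ) : ℂ) • bathHamiltonian ω) =
      ∑ a, (Real.exp (s * bathSign a / 2 * ω) : ℂ) • bathProjection a := by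
    rw [exp_smul_bathHamiltonian, Fin.sum_univ_two]
    ext i j
    fin_cases i <;> fin_cases j <;> simp [bathProjection, bathSign] <;> ring_nf
  rw [freeEvolution_eq_kronecker, ← systemEmbed_mul_bathEmbed,
    (systemEmbed_commute_bathEmbed _ _).eq, h, map_sum, Finset.sum_mul]
  refine Finset.sum_congr rfl fun a _ => ?_
  rw [map_smul, Matrix.smul_mul, exp_smul_systemEmbed, Complex.ofReal_neg]

/-- Splitting the bath into its basis states separates the dependence on the frequency into thermal
weights. -/
lemma cutExpectation_eq_sum [Nonempty d] {H : Matrix d d ℂ} (hH : H.IsHermitian) (O : Matrix d d ℂ)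
    (β ω s : ℝ) (X R : Matrix (d × Fin 2) (d × Fin 2) ℂ) :
    cutExpectation H O β ω s X R = ∑ a, ∑ b,
      2 * ((thermalRatio ((s * bathSign a + (β - s) * bathSign b) / 2) (β / 2) ω : ℝ) : ℂ) *
        gibbsForm H O β s a b X R := by
  have hZ : (partitionFn H β : ℂ) ≠ 0 := by exact_mod_cast (partitionFn_pos hH β).ne'
  have hE : ((Real.exp (β / 2 * ω) + Real.exp (-(β / 2 * ω)) : ℝ) : ℂ) ≠ 0 := by
    exact_mod_cast (by positivity : Real.exp (β / 2 * ω) + Real.exp (-(β / 2 * ω)) ≠ 0)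
  rw [cutExpectation, trace_freeEvolution hH, freeEvolution_eq_sum, freeEvolution_eq_sum]
  simp only [Finset.mul_sum, Finset.sum_mul, trace_sum]
  rw [Finset.sum_comm]
  refine Finset.sum_congr rfl fun a _ => Finset.sum_congr rfl fun b _ => ?_
  have he : Real.exp ((s * bathSign a + (β - s) * bathSign b) / 2 * ω) =
      Real.exp (s * bathSign a / 2 * ω) * Real.exp ((β - s) * bathSign b / 2 * ω) := by
    rw [← Real.exp_add]; ring_nf
  have hneg : (-((β - s : ℝ) : ℂ)) = ((-(β - s) : ℝ) : ℂ) := by push_cast; ring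
  rw [gibbsForm, thermalRatio, he, partitionFn_systemEmbed hH]
  simp only [Matrix.mul_smul, Matrix.smul_mul, trace_smul, smul_eq_mul, Matrix.mul_assoc, hneg]
  simp only [Complex.ofReal_mul, Complex.ofReal_div, Complex.ofReal_ofNat]
  field_simp

lemma abs_bathSign_combination_le {β s : ℝ} (hs : 0 ≤ s) (hsβ : s ≤ β) (a b : Fin 2) :
    |(s * bathSign a + (β - s) * bathSign b) / 2| ≤ β / 2 := by
  rw [abs_div, abs_two]
  refine div_le_div_of_nonneg_right ((abs_add_le _ _).trans ?_) zero_le_two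
  rw [abs_mul, abs_mul, abs_bathSign, abs_bathSign, abs_of_nonneg hs,
    abs_of_nonneg (sub_nonneg.2 hsβ)]
  linarith

lemma norm_cutExpectation_le [Nonempty d] {H O : Matrix d d ℂ} (hH : H.IsHermitian) (hO : ‖O‖ ≤ 1)
    {β s : ℝ} (hs : 0 ≤ s) (hsβ : s ≤ β) (ω : ℝ) (X R : Matrix (d × Fin 2) (d × Fin 2) ℂ) :
    ‖cutExpectation H O β ω s X R‖ ≤ 8 * (‖X‖ * ‖R‖) := by
  rw [cutExpectation_eq_sum hH]
  have h : ∀ a b, ‖2 * ((thermalRatio ((s * bathSign a + (β - s) * bathSign b) / 2) (β / 2) ω : ℝ)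
      : ℂ) * gibbsForm H O β s a b X R‖ ≤ 2 * (‖X‖ * ‖R‖) := fun a b => by
    rw [norm_mul, norm_mul, Complex.norm_real, Real.norm_of_nonneg (thermalRatio_nonneg _ _ _)]
    refine mul_le_mul ?_ (norm_gibbsForm_le hH hO hs hsβ a b X R) (norm_nonneg _) zero_le_two
    rw [Complex.norm_ofNat]
    have := thermalRatio_le_one (abs_bathSign_combination_le hs hsβ a b) ω
    linarith
  refine (norm_sum_le _ _).trans ((Finset.sum_le_sum fun a _ => (norm_sum_le _ _).trans
    (Finset.sum_le_sum fun b _ => h a b)).trans (le_of_eq ?_))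
  simp only [Finset.sum_const, Finset.card_univ, Fintype.card_fin, nsmul_eq_mul]
  push_cast
  ring

lemma continuous_cutExpectation [Nonempty d] {H O : Matrix d d ℂ} (hH : H.IsHermitian) (β : ℝ)
    {X R : ℝ → Matrix (d × Fin 2) (d × Fin 2) ℂ} (hX : Continuous X) (hR : Continuous R) :
    Continuous fun p : ℝ × ℝ => cutExpectation H O β p.2 p.1 (X p.2) (R p.2) := by
  have hE := continuous_freeEvolution H
  have h1 : Continuous fun p : ℝ × ℝ => freeEvolution H p.2 ((-p.1 : ℝ) : ℂ) :=
    hE.comp (by fun_prop : Continuous fun p : ℝ × ℝ => (p.2, ((-p.1 : ℝ) : ℂ)))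
  have h2 : Continuous fun p : ℝ × ℝ => freeEvolution H p.2 ((-(β - p.1) : ℝ) : ℂ) :=
    hE.comp (by fun_prop : Continuous fun p : ℝ × ℝ => (p.2, ((-(β - p.1) : ℝ) : ℂ)))
  have h3 : Continuous fun p : ℝ × ℝ => freeEvolution H p.2 ((-β : ℝ) : ℂ) :=
    hE.comp (by fun_prop : Continuous fun p : ℝ × ℝ => (p.2, ((-β : ℝ) : ℂ)))
  refine (h3.matrix_trace.inv₀ fun p => ?_).mul (Continuous.matrix_trace (by fun_prop))
  rw [trace_freeEvolution hH, Complex.ofReal_ne_zero]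
  have := partitionFn_pos hH β
  positivity

lemma hasDerivAt_freeEvolution_cut (H O : Matrix d d ℂ) (β ω s : ℝ)
    (P R : Matrix (d × Fin 2) (d × Fin 2) ℂ) :
    HasDerivAt (fun s : ℝ => systemEmbed O * freeEvolution H ω ((-s : ℝ) : ℂ) * P *
        freeEvolution H ω ((-(β - s) : ℝ) : ℂ) * R)
      (-(systemEmbed O * freeEvolution H ω ((-s : ℝ) : ℂ) *
        (freeHamiltonian H ω * P - P * freeHamiltonian H ω) *
        freeEvolution H ω ((-(β - s) : ℝ) : ℂ) * R)) s := by
  have e1 : ∀ s : ℝ, freeEvolution H ω ((-s : ℝ) : ℂ) = freeEvolution H ω (s * (-1 : ℂ)) :=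
    fun s => by push_cast; ring_nf
  have e2 : ∀ s : ℝ, freeEvolution H ω ((-(β - s) : ℝ) : ℂ) =
      freeEvolution H ω ((-β : ℝ) : ℂ) * freeEvolution H ω (s * (1 : ℂ)) := fun s => by
    rw [← freeEvolution_add]; push_cast; ring_nf
  have h1 : HasDerivAt (fun s : ℝ => freeEvolution H ω ((-s : ℝ) : ℂ))
      (-(freeEvolution H ω ((-s : ℝ) : ℂ) * freeHamiltonian H ω)) s := by
    simp only [e1]
    refine (hasDerivAt_freeEvolution H ω (-1) s).congr_deriv ?_
    rw [neg_one_smul, freeHamiltonian_commute]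
  have h2 : HasDerivAt (fun s : ℝ => freeEvolution H ω ((-(β - s) : ℝ) : ℂ))
      (freeHamiltonian H ω * freeEvolution H ω ((-(β - s) : ℝ) : ℂ)) s := by
    rw [← freeHamiltonian_commute]
    simp only [e2]
    refine ((hasDerivAt_freeEvolution H ω 1 s).const_mul _).congr_deriv ?_
    rw [one_smul, ← freeHamiltonian_commute, Matrix.mul_assoc]
  refine ((((h1.const_mul (systemEmbed O)).mul_const P).mul h2).mul_const R).congr_deriv ?_
  generalize freeEvolution H ω ((-s : ℝ) : ℂ) = E
  generalize freeEvolution H ω ((-(β - s) : ℝ) : ℂ) = E'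
  noncomm_ring

lemma HasDerivAt.matrix_trace {F : ℝ → Matrix d d ℂ} {F' : Matrix d d ℂ} {t : ℝ}
    (h : HasDerivAt F F' t) : HasDerivAt (fun t => (F t).trace) F'.trace t :=
  (((Matrix.traceLinearMap d ℂ ℂ).toContinuousLinearMap).restrictScalars
    ℝ).hasFDerivAt.comp_hasDerivAt t h

/-- Duhamel's formula: moving `P` through the Gibbs state produces its commutator with `H₀`. -/
lemma integral_cutExpectation_commutator [Nonempty d] {H O : Matrix d d ℂ} (hH : H.IsHermitian)
    (β ω : ℝ) (P R : Matrix (d × Fin 2) (d × Fin 2) ℂ) :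
    ∫ s in (0 : ℝ)..β, cutExpectation H O β ω s
        (freeHamiltonian H ω * P - P * freeHamiltonian H ω) R =
      cutExpectation H O β ω 0 P R - cutExpectation H O β ω β P R := by
  have hd : ∀ s, HasDerivAt (fun s => cutExpectation H O β ω s P R)
      (-cutExpectation H O β ω s (freeHamiltonian H ω * P - P * freeHamiltonian H ω) R) s :=
    fun s => by
      have h := ((hasDerivAt_freeEvolution_cut H O β ω s P R).matrix_trace).const_mul
        (freeEvolution H ω ((-β : ℝ) : ℂ)).trace⁻¹
      rw [trace_neg, mul_neg] at h
      unfold cutExpectation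
      exact h
  have hs : Continuous fun s : ℝ => (s, ω) := by fun_prop
  have hc := (continuous_cutExpectation hH β (O := O)
    (X := fun _ => freeHamiltonian H ω * P - P * freeHamiltonian H ω) (R := fun _ => R)
    continuous_const continuous_const).comp hs
  have h := intervalIntegral.integral_eq_sub_of_hasDerivAt (fun s _ => hd s)
    (hc.neg.intervalIntegrable 0 β)
  rw [intervalIntegral.integral_neg] at h
  rw [← neg_inj, h]
  ring

/-- The average over the frequency of a Duhamel difference is controlled by averages of the
commutator against thermal weights, in forms vanishing on the coupling. -/
lemma norm_integral_cutExpectation_sub_le [Nonempty d] {H O : Matrix d d ℂ} (hH : H.IsHermitian)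
    (hO : ‖O‖ ≤ 1) {β : ℝ} (hβ : 0 ≤ β) {G : ℝ → ℝ} {M : ℝ} (hG : IsSymmetrisedDensity G M)
    {P X R : ℝ → Matrix (d × Fin 2) (d × Fin 2) ℂ} (hX : Continuous X) (hR : Continuous R)
    (hPX : ∀ ω, freeHamiltonian H ω * P ω - P ω * freeHamiltonian H ω = X ω) {B D : ℝ}
    (hXB : ∀ ω, ‖X ω‖ ≤ B) (hR1 : ∀ ω, ‖R ω‖ ≤ 1)
    (hD : ∀ q, |q| ≤ β / 2 →
      ∀ F : Matrix (d × Fin 2) (d × Fin 2) ℂ →L[ℂ] Matrix (d × Fin 2) (d × Fin 2) ℂ →L[ℂ] ℂ,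
        ‖F‖ ≤ 1 → (∀ A t, F (couplingPlus H A t) 1 = 0) → (∀ A t, F (couplingMinus H A t) 1 = 0) →
        ‖∫ ω, thermalWeight G q (β / 2) ω * F (X ω) (R ω)‖ ≤ D) :
    ‖∫ ω, (G ω : ℂ) * (cutExpectation H O β ω 0 (P ω) (R ω) -
      cutExpectation H O β ω β (P ω) (R ω))‖ ≤ β * (8 * D) := by
  have hGi : Integrable fun ω => (G ω : ℂ) := hG.integrable.ofReal
  have hB0 : 0 ≤ B := (norm_nonneg _).trans (hXB 0)
  have hXR : ∀ ω, ‖X ω‖ * ‖R ω‖ ≤ B := fun ω =>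
    (mul_le_of_le_one_right (norm_nonneg _) (hR1 ω)).trans (hXB ω)
  simp only [← integral_cutExpectation_commutator hH, hPX]
  have hcont := continuous_cutExpectation hH (O := O) β hX hR
  rw [integral_weight_intervalIntegral_swap hGi
    (F := fun s ω => cutExpectation H O β ω s (X ω) (R ω)) (B := 8 * B) hcont hβ
    (fun s hs ω => (norm_cutExpectation_le hH hO hs.1 hs.2 ω _ _).trans
      (mul_le_mul_of_nonneg_left (hXR ω) (by norm_num)))]
  have hs : ∀ s ∈ Set.uIoc 0 β,
      ‖∫ ω, (G ω : ℂ) * cutExpectation H O β ω s (X ω) (R ω)‖ ≤ 8 * D := by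
    intro s hs
    rw [Set.uIoc_of_le hβ] at hs
    set q : Fin 2 → Fin 2 → ℝ := fun a b => (s * bathSign a + (β - s) * bathSign b) / 2 with hq
    have hqle : ∀ a b, |q a b| ≤ β / 2 := fun a b => abs_bathSign_combination_le hs.1.le hs.2 a b
    choose F hF1 hF using fun a b => exists_gibbsForm_clm (H := H) (O := O) hH hO hs.1.le hs.2 a b
    have he : ∀ ω, (G ω : ℂ) * cutExpectation H O β ω s (X ω) (R ω) =
        ∑ a, ∑ b, 2 * (thermalWeight G (q a b) (β / 2) ω * F a b (X ω) (R ω)) := fun ω => by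
      rw [cutExpectation_eq_sum hH, Finset.mul_sum]
      refine Finset.sum_congr rfl fun a _ => ?_
      rw [Finset.mul_sum]
      refine Finset.sum_congr rfl fun b _ => ?_
      rw [hF, thermalWeight, hq]
      push_cast
      ring
    have hi : ∀ a b, Integrable fun ω =>
        2 * (thermalWeight G (q a b) (β / 2) ω * F a b (X ω) (R ω)) := fun a b => by
      refine (integrable_weight_mul (integrable_thermalWeight hG (hqle a b)) (B := B) (by fun_prop)
        fun ω => ?_).const_mul 2
      exact (norm_form_apply_le (hF1 a b) _ _).trans (hXR ω)
    simp only [he]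
    rw [integral_finsetSum _ fun a _ => integrable_finsetSum _ fun b _ => hi a b]
    have hab : ∀ a b, ‖∫ ω, 2 * (thermalWeight G (q a b) (β / 2) ω * F a b (X ω) (R ω))‖ ≤ 2 * D :=
      fun a b => by
        rw [MeasureTheory.integral_const_mul, norm_mul, Complex.norm_ofNat]
        refine mul_le_mul_of_nonneg_left (hD _ (hqle a b) _ (hF1 a b) (fun A t => ?_)
          fun A t => ?_) zero_le_two
        · rw [hF, gibbsForm_couplingPlus_one]
        · rw [hF, gibbsForm_couplingMinus_one]
    refine (norm_sum_le _ _).trans ((Finset.sum_le_sum fun a _ => ?_).trans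
      (le_of_eq (?_ : ∑ _a : Fin 2, 4 * D = 8 * D)))
    · rw [integral_finsetSum _ fun b _ => hi a b]
      refine (norm_sum_le _ _).trans ((Finset.sum_le_sum fun b _ => hab a b).trans (le_of_eq ?_))
      simp only [Finset.sum_const, Finset.card_univ, Fintype.card_fin, nsmul_eq_mul]
      push_cast
      ring
    · simp only [Finset.sum_const, Finset.card_univ, Fintype.card_fin, nsmul_eq_mul]
      push_cast
      ring
  refine (intervalIntegral.norm_integral_le_of_norm_le_const hs).trans (le_of_eq ?_)
  rw [sub_zero, abs_of_nonneg hβ]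
  ring

end DuhamelAverage

/-! ### One interaction with the bath -/

noncomputable section InteractionStep

open scoped Matrix.Norms.L2Operator
open Matrix MeasureTheory

variable {d : Type*} [Fintype d] [DecidableEq d] {H A : Matrix d d ℂ} {α σ T : ℝ}

lemma trace_mul_traceBath (O : Matrix d d ℂ) (M : Matrix (d × Fin 2) (d × Fin 2) ℂ) :
    (O * traceBath M).trace = (systemEmbed O * M).trace := by
  simp only [Matrix.trace, diag_apply, Matrix.mul_apply, traceBath, of_apply, systemEmbed_apply,
    kroneckerMap_apply, Fintype.sum_prod_type, Matrix.one_apply, Finset.mul_sum]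
  refine Finset.sum_congr rfl fun i _ => ?_
  rw [Finset.sum_comm]
  refine Finset.sum_congr rfl fun k _ => Finset.sum_congr rfl fun j _ => ?_
  simp

lemma interactionStep_eq (β ω : ℝ) (ρ : Matrix d d ℂ) : interactionStep H A α β σ T ω ρ =
    traceBath (evolution H A α σ T T ω * (ρ ⊗ₖ gibbsState β (bathHamiltonian ω)) *
      (evolution H A α σ T T ω)ᴴ) := rfl

/-- The populations of the thermal state of the bath. -/
def bathPopulation (β ω : ℝ) (k : Fin 2) : ℝ := thermalRatio (bathSign k * (β / 2)) (β / 2) ω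

lemma bathPopulation_nonneg (β ω : ℝ) (k : Fin 2) : 0 ≤ bathPopulation β ω k :=
  thermalRatio_nonneg _ _ _

lemma sum_bathPopulation (β ω : ℝ) : ∑ k, bathPopulation β ω k = 1 := by
  have : Real.exp (β / 2 * ω) + Real.exp (-(β / 2 * ω)) ≠ 0 := by positivity
  simp only [Fin.sum_univ_two, bathPopulation, bathSign, thermalRatio]
  simp only [cons_val_zero, cons_val_one, one_mul, neg_mul]
  field_simp

lemma gibbsState_bathHamiltonian (β ω : ℝ) : gibbsState β (bathHamiltonian ω) =
    diagonal fun k => (bathPopulation β ω k : ℂ) := by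
  rw [gibbsState, exp_smul_bathHamiltonian, trace_diagonal, ← diagonal_smul, Fin.sum_univ_two]
  congr 1
  ext k
  fin_cases k <;> simp [bathPopulation, bathSign, thermalRatio] <;> ring_nf

lemma trace_gibbsState_bathHamiltonian (β ω : ℝ) :
    (gibbsState β (bathHamiltonian ω)).trace = 1 := by
  rw [gibbsState_bathHamiltonian, trace_diagonal, ← Complex.ofReal_sum, sum_bathPopulation,
    Complex.ofReal_one]

lemma gibbsState_kronecker_gibbsState (H : Matrix d d ℂ) (β ω : ℝ) :
    gibbsState β H ⊗ₖ gibbsState β (bathHamiltonian ω) =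
      (freeEvolution H ω ((-β : ℝ) : ℂ)).trace⁻¹ • freeEvolution H ω ((-β : ℝ) : ℂ) := by
  rw [freeEvolution_eq_kronecker, trace_kronecker, gibbsState, gibbsState, smul_kronecker,
    kronecker_smul, smul_smul, mul_inv, Complex.ofReal_neg]

lemma trace_systemEmbed_mul_kronecker (O ρ : Matrix d d ℂ) (B : Matrix (Fin 2) (Fin 2) ℂ) :
    (systemEmbed O * (ρ ⊗ₖ B)).trace = (O * ρ).trace * B.trace := by
  rw [systemEmbed_apply, ← Matrix.mul_kronecker_mul, trace_kronecker, Matrix.one_mul]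

lemma systemEmbed_heisenberg (H O : Matrix d d ℂ) (t ω : ℝ) : systemEmbed (heisenberg H O t) =
    freeEvolution H ω (t * Complex.I) * systemEmbed O * freeEvolution H ω (-(t * Complex.I)) := by
  rw [freeEvolution_eq_kronecker, freeEvolution_eq_kronecker, systemEmbed_apply, systemEmbed_apply,
    ← Matrix.mul_kronecker_mul, ← Matrix.mul_kronecker_mul, heisenberg, Matrix.mul_one,
    exp_smul_mul_neg]

/-- The two ends of the Duhamel integral: the state after the interaction. -/
lemma trace_mul_interactionStep_gibbsState (hH : H.IsHermitian) (O : Matrix d d ℂ) (β ω : ℝ) :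
    (O * interactionStep H A α β σ T ω (gibbsState β H)).trace =
      cutExpectation H (heisenberg H O T) β ω 0 (scattering H A α σ T T ω)
        (scattering H A α σ T T ω)ᴴ := by
  rw [interactionStep_eq, trace_mul_traceBath, gibbsState_kronecker_gibbsState, cutExpectation,
    systemEmbed_heisenberg H O T ω, scattering, Matrix.mul_smul, Matrix.smul_mul, Matrix.mul_smul,
    trace_smul, smul_eq_mul, conjTranspose_mul, conjTranspose_mul,
    freeEvolution_real_conjTranspose hH, neg_zero, Complex.ofReal_zero, freeEvolution_zero,
    Matrix.mul_one, sub_zero]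
  congr 1
  generalize evolution H A α σ T T ω = U
  have hz : freeEvolution H ω (T * Complex.I) * freeEvolution H ω ((-β : ℝ) : ℂ) *
      freeEvolution H ω (-(T * Complex.I)) = freeEvolution H ω ((-β : ℝ) : ℂ) := by
    rw [← freeEvolution_add, ← freeEvolution_add]; ring_nf
  have h1 := freeEvolution_neg_mul H ω (T * Complex.I)
  have h2 := freeEvolution_mul_neg H ω (T * Complex.I)
  generalize freeEvolution H ω (T * Complex.I) = E at *
  generalize freeEvolution H ω (-(T * Complex.I)) = E' at *
  generalize freeEvolution H ω ((-β : ℝ) : ℂ) = F at *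
  calc (systemEmbed O * (U * F * Uᴴ)).trace = (systemEmbed O * (E' * E) * U * (E * F * E') * Uᴴ *
        (E' * E)).trace := by rw [h1, hz]; simp only [Matrix.mul_one, Matrix.mul_assoc]
    _ = (E * (systemEmbed O * (E' * E) * U * (E * F * E') * Uᴴ * E')).trace := by
        rw [trace_mul_comm E]; simp only [Matrix.mul_assoc]
    _ = _ := by simp only [Matrix.mul_assoc]

/-- The two ends of the Duhamel integral: the thermal state. -/
lemma cutExpectation_end (hH : H.IsHermitian) (O : Matrix d d ℂ) (β ω : ℝ) :
    cutExpectation H (heisenberg H O T) β ω β (scattering H A α σ T T ω)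
      (scattering H A α σ T T ω)ᴴ = (O * gibbsState β H).trace := by
  have h1 : systemEmbed (heisenberg H O T) * freeEvolution H ω ((-β : ℝ) : ℂ) *
      scattering H A α σ T T ω * freeEvolution H ω ((-(β - β) : ℝ) : ℂ) *
        (scattering H A α σ T T ω)ᴴ = freeEvolution H ω (T * Complex.I) * (systemEmbed O *
          (freeEvolution H ω ((-β : ℝ) : ℂ) * freeEvolution H ω (-(T * Complex.I)))) := by
    rw [sub_self, neg_zero, Complex.ofReal_zero, freeEvolution_zero, Matrix.mul_one,
      Matrix.mul_assoc, scattering_mul_conjTranspose hH, Matrix.mul_one,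
      systemEmbed_heisenberg H O T ω, Matrix.mul_assoc, ← freeEvolution_add, add_comm,
      freeEvolution_add, Matrix.mul_assoc]
  rw [cutExpectation, h1, trace_mul_comm, Matrix.mul_assoc, Matrix.mul_assoc,
    freeEvolution_neg_mul, Matrix.mul_one, ← smul_eq_mul, ← trace_smul, ← Matrix.mul_smul,
    ← gibbsState_kronecker_gibbsState, trace_systemEmbed_mul_kronecker,
    trace_gibbsState_bathHamiltonian, mul_one]

/-- The flip of the bath qubit. -/
def bathFlip : Matrix (Fin 2) (Fin 2) ℂ := !![0, 1; 1, 0]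

lemma bathFlip_mul_bathFlip : bathFlip * bathFlip = 1 := by
  ext i j
  fin_cases i <;> fin_cases j <;> simp [bathFlip]

lemma bathFlip_mul_diagonal (v : Fin 2 → ℂ) :
    bathFlip * diagonal v * bathFlip = diagonal ![v 1, v 0] := by
  have h : diagonal v = !![v 0, 0; 0, v 1] := by
    ext i j
    fin_cases i <;> fin_cases j <;> simp
  rw [h]
  ext i j
  fin_cases i <;> fin_cases j <;> simp [bathFlip]

lemma bathEmbed_bathFlip_mul_self :
    bathEmbed (d := d) bathFlip * bathEmbed bathFlip = 1 := by
  rw [← map_mul, bathFlip_mul_bathFlip, map_one]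

lemma bathFlip_conj_kronecker (M : Matrix d d ℂ) (B : Matrix (Fin 2) (Fin 2) ℂ) :
    bathEmbed bathFlip * (M ⊗ₖ B) * bathEmbed bathFlip = M ⊗ₖ (bathFlip * B * bathFlip) := by
  rw [bathEmbed_apply, ← Matrix.mul_kronecker_mul, ← Matrix.mul_kronecker_mul, Matrix.one_mul,
    Matrix.mul_one]

lemma totalHamiltonian_flip (H A : Matrix d d ℂ) (α σ ω t : ℝ) :
    totalHamiltonian H Aᴴ α σ (-ω) t =
      bathEmbed bathFlip * totalHamiltonian H A α σ ω t * bathEmbed bathFlip := by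
  have h1 : bathFlip * bathHamiltonian ω * bathFlip = bathHamiltonian (-ω) := by
    ext i j
    fin_cases i <;> fin_cases j <;> simp [bathFlip, bathHamiltonian, neg_div]
  have h2 : bathFlip * bathCoupling * bathFlip = bathCouplingᴴ := by
    ext i j
    fin_cases i <;> fin_cases j <;> simp [bathFlip, bathCoupling]
  have h3 : bathFlip * bathCouplingᴴ * bathFlip = bathCoupling := by
    rw [← h2, ← Matrix.mul_assoc, ← Matrix.mul_assoc, bathFlip_mul_bathFlip, Matrix.one_mul,
      Matrix.mul_assoc, bathFlip_mul_bathFlip, Matrix.mul_one]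
  simp only [totalHamiltonian, Matrix.mul_add, Matrix.add_mul, Matrix.mul_smul, Matrix.smul_mul,
    bathFlip_conj_kronecker, h1, h2, h3, Matrix.mul_one, bathFlip_mul_bathFlip,
    conjTranspose_conjTranspose]
  rw [add_comm (Aᴴ ⊗ₖ bathCoupling)]

/-- A time-ordered exponential is covariant under conjugation of its generator by an involution. -/
lemma timeOrderedExp_conj {K K' : ℝ → ℝ → Matrix d d ℂ} (hK : Continuous (Function.uncurry K))
    (hK' : Continuous (Function.uncurry K')) (hKh : ∀ ω t, (K' ω t).IsHermitian)
    {X : Matrix d d ℂ} (hX : X * X = 1) {ω ω' : ℝ} (h : ∀ t, K' ω' t = X * K ω t * X) (t₀ t : ℝ) :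
    timeOrderedExp (K' ω') t₀ t = X * timeOrderedExp (K ω) t₀ t * X := by
  have hd : ∀ t, HasDerivAt (fun t => (timeOrderedExp (K' ω') t₀ t)ᴴ *
      (X * timeOrderedExp (K ω) t₀ t * X)) 0 t := fun t => by
    have h1 := (hasDerivAt_timeOrderedExp hK' t₀ ω' t).matrix_conjTranspose
    have h2 := ((hasDerivAt_timeOrderedExp hK t₀ ω t).const_mul X).mul_const X
    refine (h1.mul h2).congr_deriv ?_
    have h3 : K' ω' t * X = X * K ω t := by rw [h, Matrix.mul_assoc, hX, Matrix.mul_one]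
    rw [conjTranspose_smul, conjTranspose_mul, (hKh ω' t).eq]
    simp only [Matrix.smul_mul, Matrix.mul_smul, star_neg, Complex.star_def, Complex.conj_I,
      neg_neg]
    rw [Matrix.mul_assoc _ (K' ω' t), ← Matrix.mul_assoc (K' ω' t),
      ← Matrix.mul_assoc (K' ω' t), h3]
    simp only [Matrix.mul_assoc]
    rw [← add_smul, add_neg_cancel, zero_smul]
  have hconst := is_const_of_deriv_eq_zero (fun t => (hd t).differentiableAt)
    (fun t => (hd t).deriv) t t₀
  rw [timeOrderedExp_self hK', timeOrderedExp_self hK, Matrix.mul_one, hX, Matrix.mul_one,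
    conjTranspose_one] at hconst
  have hU := mul_eq_one_comm.1 (conjTranspose_mul_timeOrderedExp hK' hKh t₀ ω' t)
  calc timeOrderedExp (K' ω') t₀ t = timeOrderedExp (K' ω') t₀ t *
        ((timeOrderedExp (K' ω') t₀ t)ᴴ * (X * timeOrderedExp (K ω) t₀ t * X)) := by
        rw [hconst, Matrix.mul_one]
    _ = _ := by rw [← Matrix.mul_assoc, hU, Matrix.one_mul]

lemma traceBath_flip (M : Matrix (d × Fin 2) (d × Fin 2) ℂ) :
    traceBath (bathEmbed bathFlip * M * bathEmbed bathFlip) = traceBath M := by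
  ext i j
  simp [traceBath, Matrix.mul_apply, bathEmbed_apply, bathFlip, Fintype.sum_prod_type,
    Matrix.one_apply, add_comm]

/-- Exchanging the two bath levels reverses the frequency and exchanges `A` with its adjoint. -/
lemma interactionStep_conjTranspose_neg (hH : H.IsHermitian) (β ω : ℝ) (ρ : Matrix d d ℂ) :
    interactionStep H Aᴴ α β σ T (-ω) ρ = interactionStep H A α β σ T ω ρ := by
  have hU : evolution H Aᴴ α σ T T (-ω) =
      bathEmbed bathFlip * evolution H A α σ T T ω * bathEmbed bathFlip :=
    timeOrderedExp_conj (continuous_totalHamiltonian H A α σ)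
      (continuous_totalHamiltonian H Aᴴ α σ) (fun ω t => isHermitian_totalHamiltonian hH Aᴴ α σ ω t)
      bathEmbed_bathFlip_mul_self (fun t => totalHamiltonian_flip H A α σ ω t) (-T) T
  have hX : (bathEmbed (d := d) bathFlip)ᴴ = bathEmbed bathFlip := by
    have h : bathFlipᴴ = bathFlip := by
      ext i j
      fin_cases i <;> fin_cases j <;> simp [bathFlip]
    exact (map_star bathEmbed bathFlip).symm.trans (congrArg _ h)
  have hg : gibbsState β (bathHamiltonian (-ω)) =
      bathFlip * gibbsState β (bathHamiltonian ω) * bathFlip := by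
    rw [gibbsState_bathHamiltonian, gibbsState_bathHamiltonian, bathFlip_mul_diagonal]
    congr 1
    ext k
    fin_cases k <;> simp [bathPopulation, bathSign, thermalRatio, add_comm]
  rw [interactionStep_eq, interactionStep_eq, hU, hg, ← bathFlip_conj_kronecker,
    ← traceBath_flip (evolution H A α σ T T ω * _ * _), conjTranspose_mul, conjTranspose_mul, hX]
  congr 1
  have hXX := bathEmbed_bathFlip_mul_self (d := d)
  generalize bathEmbed (d := d) bathFlip = X at *
  generalize evolution H A α σ T T ω = U
  generalize ρ ⊗ₖ gibbsState β (bathHamiltonian ω) = R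
  calc _ = X * U * (X * X) * R * (X * X) * Uᴴ * X := by simp only [Matrix.mul_assoc]
    _ = _ := by rw [hXX]; simp only [Matrix.mul_one, Matrix.mul_assoc]

end InteractionStep

/-! ### The channel and its contractivity -/

noncomputable section Channel

open scoped Matrix.Norms.L2Operator
open Matrix MeasureTheory

variable {d : Type*} [Fintype d] [DecidableEq d] {H A : Matrix d d ℂ} {α σ T : ℝ}

lemma norm_submatrix_block_le (B : Matrix (d × Fin 2) (d × Fin 2) ℂ) (k : Fin 2) :
    ‖B.submatrix (fun i => (i, k)) (fun i => (i, k))‖ ≤ ‖B‖ := by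
  set V : Matrix (d × Fin 2) d ℂ :=
    (1 : Matrix (d × Fin 2) (d × Fin 2) ℂ).submatrix id (fun i => (i, k)) with hV
  have hVV : Vᴴ * V = 1 := by
    ext i j
    simp [hV, Matrix.mul_apply, Matrix.one_apply, eq_comm]
  have hVn : ‖V‖ ≤ 1 := by
    have h1 := Matrix.l2_opNorm_conjTranspose_mul_self V
    rw [hVV] at h1
    have h2 : ‖(1 : Matrix d d ℂ)‖ ≤ 1 := norm_one_matrix_le
    nlinarith [norm_nonneg V]
  have hB : B.submatrix (fun i => (i, k)) (fun i => (i, k)) = Vᴴ * B * V := by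
    ext i j
    simp [hV, Matrix.mul_apply, Matrix.one_apply, eq_comm]
  rw [hB]
  refine (l2_opNorm_mul _ _).trans ((mul_le_of_le_one_right (norm_nonneg _) hVn).trans ?_)
  refine (l2_opNorm_mul _ _).trans (mul_le_of_le_one_left (norm_nonneg _) ?_)
  rwa [l2_opNorm_conjTranspose]

/-- Appending a bath in a mixture of its basis states does not increase the trace norm. -/
lemma norm_trace_mul_kronecker_diagonal_le (B : Matrix (d × Fin 2) (d × Fin 2) ℂ)
    (ρ : Matrix d d ℂ) {p : Fin 2 → ℝ} (hp : ∀ k, 0 ≤ p k) (hp1 : ∑ k, p k = 1) :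
    ‖(B * (ρ ⊗ₖ diagonal fun k => (p k : ℂ))).trace‖ ≤ ‖B‖ * traceNorm ρ := by
  have h : (B * (ρ ⊗ₖ diagonal fun k => (p k : ℂ))).trace =
      ((∑ k, (p k : ℂ) • B.submatrix (fun i => (i, k)) (fun i => (i, k))) * ρ).trace := by
    rw [Finset.sum_mul, trace_sum]
    simp only [Matrix.trace, diag_apply, Matrix.mul_apply, Fintype.sum_prod_type,
      kroneckerMap_apply, diagonal_apply, Matrix.smul_apply, submatrix_apply, smul_eq_mul]
    rw [Finset.sum_comm]
    refine Finset.sum_congr rfl fun k _ => Finset.sum_congr rfl fun i _ =>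
      Finset.sum_congr rfl fun j _ => ?_
    simp only [mul_ite, mul_zero, Finset.sum_ite_eq', Finset.mem_univ, if_true]
    ring
  rw [h]
  refine (norm_trace_mul_le _ _).trans (mul_le_mul_of_nonneg_right ?_ (traceNorm_nonneg ρ))
  calc _ ≤ ∑ k, p k * ‖B‖ := (norm_sum_le _ _).trans (Finset.sum_le_sum fun k _ => by
        rw [norm_smul, Complex.norm_real, Real.norm_of_nonneg (hp k)]
        exact mul_le_mul_of_nonneg_left (norm_submatrix_block_le B k) (hp k))
    _ = ‖B‖ := by rw [← Finset.sum_mul, hp1, one_mul]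

lemma norm_trace_mul_interactionStep_le (hH : H.IsHermitian) (O : Matrix d d ℂ) (β ω : ℝ)
    (ρ : Matrix d d ℂ) :
    ‖(O * interactionStep H A α β σ T ω ρ).trace‖ ≤ ‖O‖ * traceNorm ρ := by
  have hU : ‖evolution H A α σ T T ω‖ ≤ 1 :=
    norm_le_one_of_conjTranspose_mul_self (conjTranspose_mul_evolution hH T ω)
  rw [interactionStep_eq, trace_mul_traceBath, gibbsState_bathHamiltonian, ← Matrix.mul_assoc,
    trace_mul_comm, ← Matrix.mul_assoc, ← Matrix.mul_assoc]
  refine (norm_trace_mul_kronecker_diagonal_le _ _ (bathPopulation_nonneg β ω)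
    (sum_bathPopulation β ω)).trans (mul_le_mul_of_nonneg_right ?_ (traceNorm_nonneg ρ))
  refine (norm_mul_le _ _).trans ((mul_le_of_le_one_right (norm_nonneg _) hU).trans ?_)
  refine (norm_mul_le _ _).trans ((mul_le_of_le_one_left (norm_nonneg _) ?_).trans
    (NonUnitalStarAlgHom.norm_apply_le systemEmbed O))
  rwa [l2_opNorm_conjTranspose]

lemma continuous_interactionStep (H A : Matrix d d ℂ) (α β σ T : ℝ) (ρ : Matrix d d ℂ) :
    Continuous fun ω => interactionStep H A α β σ T ω ρ := by
  have hT : Continuous fun ω : ℝ => (T, ω) := by fun_prop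
  have hU := (continuous_evolution H A α σ T).comp hT
  have hB : Continuous fun ω => gibbsState β (bathHamiltonian ω) := by
    simp only [gibbsState_bathHamiltonian]
    have h : ∀ k, Continuous fun ω => (bathPopulation β ω k : ℂ) := fun k =>
      Complex.continuous_ofReal.comp (continuous_thermalRatio _ _)
    exact Continuous.matrix_diagonal (continuous_pi h)
  have hR : Continuous fun ω => ρ ⊗ₖ gibbsState β (bathHamiltonian ω) := by
    simp only [← systemEmbed_mul_bathEmbed]
    exact continuous_const.mul (continuous_bathEmbed.comp hB)
  have hM : Continuous fun ω => evolution H A α σ T T ω *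
      (ρ ⊗ₖ gibbsState β (bathHamiltonian ω)) * (evolution H A α σ T T ω)ᴴ :=
    (hU.mul hR).mul hU.star
  refine continuous_matrix fun i j => ?_
  simp only [interactionStep_eq, traceBath, of_apply]
  exact continuous_finsetSum _ fun k _ => hM.matrix_elem _ _

variable {g : ℝ → ℝ}

lemma integrable_weight_trace_interactionStep (hg : Integrable g) (hH : H.IsHermitian)
    (O : Matrix d d ℂ) (β : ℝ) (ρ : Matrix d d ℂ) :
    Integrable fun ω => (g ω : ℂ) * (O * interactionStep H A α β σ T ω ρ).trace :=
  integrable_weight_mul hg.ofReal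
    ((continuous_const.mul (continuous_interactionStep H A α β σ T ρ)).matrix_trace)
    fun ω => norm_trace_mul_interactionStep_le hH O β ω ρ

lemma integrable_weight_interactionStep_apply (hg : Integrable g) (hH : H.IsHermitian) (β : ℝ)
    (ρ : Matrix d d ℂ) (i j : d) :
    Integrable fun ω => (g ω : ℂ) * interactionStep H A α β σ T ω ρ i j := by
  refine (integrable_weight_trace_interactionStep (H := H) (A := A) (α := α) (σ := σ) (T := T)
    hg hH (Matrix.single j i 1) β ρ).congr (.of_forall fun ω => ?_)
  simp [Matrix.trace_single_mul]

/-- Testing the channel against an observable. -/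
lemma trace_mul_systemBathChannel (hg : Integrable g) (hH : H.IsHermitian)
    (𝒜 : Finset (Matrix d d ℂ)) (α β σ T : ℝ) (O ρ : Matrix d d ℂ) :
    (O * systemBathChannel H 𝒜 g α β σ T ρ).trace = (𝒜.card : ℂ)⁻¹ *
      ∑ A ∈ 𝒜, ∫ ω, (g ω : ℂ) * (O * interactionStep H A α β σ T ω ρ).trace := by
  rw [systemBathChannel, Matrix.mul_smul, trace_smul, smul_eq_mul, Matrix.mul_sum, trace_sum]
  congr 1
  refine Finset.sum_congr rfl fun A _ => ?_
  have hi := fun i j => integrable_weight_interactionStep_apply (H := H) (A := A) (α := α) (σ := σ)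
    (T := T) hg hH β ρ i j
  simp only [Matrix.trace, diag_apply, Matrix.mul_apply, of_apply, Finset.mul_sum]
  rw [integral_finsetSum]
  · refine Finset.sum_congr rfl fun i _ => ?_
    rw [integral_finsetSum]
    · refine Finset.sum_congr rfl fun j _ => ?_
      rw [← MeasureTheory.integral_const_mul]
      congr 1
      ext ω
      ring
    · exact fun j _ => ((hi j i).const_mul (O i j)).congr (.of_forall fun ω => by ring)
  · exact fun i _ => integrable_finsetSum _ fun j _ =>
      ((hi j i).const_mul (O i j)).congr (.of_forall fun ω => by ring)

lemma interactionStep_sub (β ω : ℝ) (ρ₁ ρ₂ : Matrix d d ℂ) :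
    interactionStep H A α β σ T ω (ρ₁ - ρ₂) =
      interactionStep H A α β σ T ω ρ₁ - interactionStep H A α β σ T ω ρ₂ := by
  have h : (ρ₁ - ρ₂) ⊗ₖ gibbsState β (bathHamiltonian ω) =
      ρ₁ ⊗ₖ gibbsState β (bathHamiltonian ω) - ρ₂ ⊗ₖ gibbsState β (bathHamiltonian ω) := by
    simp only [← systemEmbed_mul_bathEmbed, map_sub, Matrix.sub_mul]
  rw [interactionStep_eq, interactionStep_eq, interactionStep_eq, h, Matrix.mul_sub, Matrix.sub_mul]
  ext i j
  simp [traceBath, Finset.sum_sub_distrib]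

lemma systemBathChannel_sub (hg : Integrable g) (hH : H.IsHermitian) (𝒜 : Finset (Matrix d d ℂ))
    (α β σ T : ℝ) (ρ₁ ρ₂ : Matrix d d ℂ) : systemBathChannel H 𝒜 g α β σ T (ρ₁ - ρ₂) =
      systemBathChannel H 𝒜 g α β σ T ρ₁ - systemBathChannel H 𝒜 g α β σ T ρ₂ := by
  simp only [systemBathChannel, ← smul_sub, ← Finset.sum_sub_distrib]
  congr 1
  refine Finset.sum_congr rfl fun A _ => ?_
  ext i j
  simp only [of_apply, Matrix.sub_apply, interactionStep_sub, mul_sub]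
  exact integral_sub (integrable_weight_interactionStep_apply hg hH β ρ₁ i j)
    (integrable_weight_interactionStep_apply hg hH β ρ₂ i j)

lemma norm_inv_card_mul_sum_le {ι : Type*} {s : Finset ι} {F : ι → ℂ} {c : ℝ} (hc : 0 ≤ c)
    (hF : ∀ a ∈ s, ‖F a‖ ≤ c) : ‖(s.card : ℂ)⁻¹ * ∑ a ∈ s, F a‖ ≤ c := by
  rw [norm_mul, norm_inv, Complex.norm_natCast]
  rcases s.eq_empty_or_nonempty with h | h
  · simpa [h] using hc
  · rw [inv_mul_le_iff₀ (by exact_mod_cast h.card_pos)]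
    refine (norm_sum_le _ _).trans ((Finset.sum_le_sum hF).trans (le_of_eq ?_))
    rw [Finset.sum_const, nsmul_eq_mul]

/-- The channel contracts the trace norm. -/
lemma traceNorm_systemBathChannel_le (hg0 : ∀ ω, 0 ≤ g ω) (hg : Integrable g)
    (hg1 : ∫ ω, g ω = 1) (hH : H.IsHermitian) (𝒜 : Finset (Matrix d d ℂ)) (α β σ T : ℝ)
    (ρ : Matrix d d ℂ) : traceNorm (systemBathChannel H 𝒜 g α β σ T ρ) ≤ traceNorm ρ := by
  refine traceNorm_le_of_forall fun O hO => ?_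
  rw [trace_mul_systemBathChannel hg hH]
  refine norm_inv_card_mul_sum_le (traceNorm_nonneg ρ) fun A _ => ?_
  calc _ ≤ ∫ ω, g ω * traceNorm ρ := norm_integral_le_of_norm_le (hg.mul_const _)
        (.of_forall fun ω => by
          rw [norm_mul, Complex.norm_real, Real.norm_of_nonneg (hg0 ω)]
          refine mul_le_mul_of_nonneg_left ?_ (hg0 ω)
          exact (norm_trace_mul_interactionStep_le hH O β ω ρ).trans
            (mul_le_of_le_one_left (traceNorm_nonneg ρ) hO))
    _ = traceNorm ρ := by rw [MeasureTheory.integral_mul_const, hg1, one_mul]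

/-- A fixed point of a linear contraction `Φ` is at distance at most `2τ‖Φ ρ₀ - ρ₀‖` from `ρ₀`, if
`τ` steps of `Φ` halve their distance. -/
lemma traceNorm_sub_le_of_halving {Φ : Matrix d d ℂ → Matrix d d ℂ}
    (hsub : ∀ ρ₁ ρ₂, Φ (ρ₁ - ρ₂) = Φ ρ₁ - Φ ρ₂) (hc : ∀ ρ, traceNorm (Φ ρ) ≤ traceNorm ρ)
    {ρ ρ₀ : Matrix d d ℂ} (hfix : Φ ρ = ρ) {τ : ℕ}
    (hτ : traceNorm (Φ^[τ] ρ - Φ^[τ] ρ₀) ≤ traceNorm (ρ - ρ₀) / 2) :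
    traceNorm (ρ - ρ₀) ≤ 2 * (τ * traceNorm (Φ ρ₀ - ρ₀)) := by
  have hfixn : Φ^[τ] ρ = ρ := Function.iterate_fixed hfix τ
  have hdrift : ∀ n : ℕ, traceNorm (Φ^[n] ρ₀ - ρ₀) ≤ n * traceNorm (Φ ρ₀ - ρ₀) := fun n => by
    induction n with
    | zero => simp [traceNorm_zero]
    | succ n ih =>
      have e : Φ^[n + 1] ρ₀ - ρ₀ = Φ (Φ^[n] ρ₀ - ρ₀) + (Φ ρ₀ - ρ₀) := by
        rw [Function.iterate_succ_apply', hsub]; abel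
      rw [e]
      refine (traceNorm_add_le _ _).trans ?_
      have := (hc (Φ^[n] ρ₀ - ρ₀)).trans ih
      push_cast
      linarith
  have e : ρ - ρ₀ = (Φ^[τ] ρ - Φ^[τ] ρ₀) + (Φ^[τ] ρ₀ - ρ₀) := by rw [hfixn]; abel
  have h1 : traceNorm (ρ - ρ₀) ≤
      traceNorm (Φ^[τ] ρ - Φ^[τ] ρ₀) + traceNorm (Φ^[τ] ρ₀ - ρ₀) :=
    (congrArg traceNorm e).le.trans (traceNorm_add_le _ _)
  linarith [hdrift τ]

lemma isDensityMatrix_gibbsState [Nonempty d] (hH : H.IsHermitian) (β : ℝ) :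
    IsDensityMatrix (gibbsState β H) := by
  have hZ := partitionFn_pos hH β
  have htr := trace_exp_eq_partitionFn hH β
  refine ⟨?_, ?_⟩
  · have hK : NormedSpace.exp ((-β : ℂ) • H) = (NormedSpace.exp ((-(β / 2) : ℂ) • H))ᴴ *
        NormedSpace.exp ((-(β / 2) : ℂ) • H) := by
      rw [← Matrix.exp_conjTranspose, conjTranspose_smul, hH.eq,
        ← Matrix.exp_add_of_commute _ _ (((Commute.refl _).smul_left _).smul_right _), ← add_smul]
      congr 2
      simp
      ring
    rw [gibbsState, htr, ← Complex.ofReal_inv, hK]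
    exact (Matrix.posSemidef_conjTranspose_mul_self _).smul
      (Complex.zero_le_real.2 (inv_nonneg.2 hZ.le))
  · rw [gibbsState, trace_smul, smul_eq_mul, inv_mul_cancel₀]
    rw [htr]
    exact_mod_cast hZ.ne'

end Channel

/-! ### The drift of the thermal state -/

noncomputable section Drift

open scoped Matrix.Norms.L2Operator
open Matrix MeasureTheory

/-- If `F` is invariant under adjoining the coupling and reversing the frequency, its average over a
set closed under adjoints only depends on the symmetrised density. -/
lemma sum_integral_eq_symmetrised {E : Type*} [InvolutiveStar E] {𝒜 : Finset E}
    (h𝒜 : ∀ A ∈ 𝒜, star A ∈ 𝒜) {g : ℝ → ℝ}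
    {F : E → ℝ → ℂ} (hF : ∀ A ω, F (star A) (-ω) = F A ω)
    (hi : ∀ A, Integrable fun ω => (g ω : ℂ) * F A ω) :
    ∑ A ∈ 𝒜, ∫ ω, (g ω : ℂ) * F A ω =
      ∑ A ∈ 𝒜, (1 / 2) * ∫ ω, (symmetrisedDensity g ω : ℂ) * F A ω := by
  have hneg : ∀ A, Integrable fun ω => (g (-ω) : ℂ) * F A ω := fun A =>
    ((hi (star A)).comp_neg).congr (.of_forall fun ω => by simp only [hF])
  have h1 : ∑ A ∈ 𝒜, ∫ ω, (g (-ω) : ℂ) * F A ω = ∑ A ∈ 𝒜, ∫ ω, (g ω : ℂ) * F A ω := by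
    refine Finset.sum_nbij' star star h𝒜 h𝒜 (fun A _ => star_star A) (fun A _ => star_star A)
      fun A _ => ?_
    rw [← integral_neg_eq_self (fun ω => (g ω : ℂ) * F (star A) ω) volume]
    simp only [hF]
  have h2 : ∀ A, ∫ ω, (symmetrisedDensity g ω : ℂ) * F A ω =
      (∫ ω, (g ω : ℂ) * F A ω) + ∫ ω, (g (-ω) : ℂ) * F A ω := fun A => by
    rw [← integral_add (hi A) (hneg A)]
    congr 1
    ext ω
    simp only [symmetrisedDensity]
    push_cast
    ring
  rw [← Finset.mul_sum]
  simp only [h2]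
  rw [Finset.sum_add_distrib, h1]
  ring

variable {d : Type*} [Fintype d] [DecidableEq d] {H A : Matrix d d ℂ} {α β σ T : ℝ} {G : ℝ → ℝ}
  {M : ℝ}

lemma insertionConst_eq_mul (J L : ℝ) : insertionConst J L = J * insertionConst 1 L := by
  unfold insertionConst; ring

/-- The bound on the accumulated Fourier weight of the coupling, for a symmetrised density of
variation `M`. -/
def couplingConst (M α σ : ℝ) : ℝ :=
  (2 + 10 * M) * (4 * (|α| * gaussianPeak σ) * Real.log (1 + σ) +
    2 * (|α| * (4 * √σ) * (1 + σ)⁻¹))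

lemma integral_abs_mul_gaussianFilter_le (hσ : 0 < σ) (hT : 0 ≤ T) :
    ∫ s in (-T)..T, |α * gaussianFilter σ s| ≤ |α| * (4 * √σ) := by
  have h : ∀ s, |α * gaussianFilter σ s| = |α| * gaussianFilter σ s := fun s => by
    rw [abs_mul, abs_of_nonneg (gaussianFilter_nonneg hσ s)]
  simp only [h, intervalIntegral.integral_const_mul]
  exact mul_le_mul_of_nonneg_left (integral_gaussianFilter_le hσ hT) (abs_nonneg α)

lemma couplingConst_nonneg (hM : 0 ≤ M) (hσ : 0 < σ) : 0 ≤ couplingConst M α σ := by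
  have h1 := (gaussianPeak_pos hσ).le
  have h2 : 0 ≤ Real.log (1 + σ) := Real.log_nonneg (by linarith)
  unfold couplingConst
  positivity

/-- Averages of the commutator with the free Hamiltonian against a thermal weight. -/
lemma norm_integral_commutator_le (hH : H.IsHermitian) (hA : ‖A‖ ≤ 1)
    (hG : IsSymmetrisedDensity G M) (hσ : 0 < σ) (hT : 0 ≤ T) {p q : ℝ} (hpq : |p| ≤ q)
    {F : Matrix (d × Fin 2) (d × Fin 2) ℂ →L[ℂ] Matrix (d × Fin 2) (d × Fin 2) ℂ →L[ℂ] ℂ}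
    (hF : ‖F‖ ≤ 1) (hFp : ∀ t, F (couplingPlus H A t) 1 = 0)
    (hFm : ∀ t, F (couplingMinus H A t) 1 = 0) :
    ‖∫ ω, thermalWeight G p q ω * F
        (freeHamiltonian H ω * scattering H A α σ T T ω -
          scattering H A α σ T T ω * freeHamiltonian H ω) (scattering H A α σ T T ω)ᴴ‖ ≤
      4 * (|α| * gaussianPeak σ) *
        (2 * insertionConst (couplingConst M α σ) (4 * (|α| * (4 * √σ)))) := by
  have hM : 0 ≤ M := (integral_nonneg fun _ => abs_nonneg _).trans hG.integral_abs_deriv_le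
  have hJ0 := couplingConst_nonneg (α := α) hM hσ
  have hu : Continuous fun t => α * gaussianFilter σ t :=
    continuous_const.mul (continuous_gaussianFilter σ)
  have hv : Continuous fun t => α * gaussianFilterDeriv σ t :=
    continuous_const.mul (continuous_gaussianFilterDeriv σ)
  have hle : ∀ s, |α * gaussianFilter σ s| ≤ |α| * gaussianPeak σ := fun s => by
    rw [abs_mul, abs_of_nonneg (gaussianFilter_nonneg hσ s)]
    exact mul_le_mul_of_nonneg_left (gaussianFilter_le hσ s) (abs_nonneg α)
  have hU := integral_abs_mul_gaussianFilter_le (α := α) hσ hT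
  have hJ := fun c =>
    integral_coupling_mul_weightFourier_le hG hpq hu (neg_le_self hT) hσ.le hle hU c
  have hpair := isPropagatorPair_scattering (A := A) (α := α) (σ := σ) (T := T) hH
  have hstart : ∀ ω, (scattering H A α σ T (-T) ω)ᴴ = 1 := fun ω => by
    rw [scattering_start, conjTranspose_one]
  have hmain := norm_average_insertedCommutator_le (integrable_thermalWeight hG hpq) hu
    (isUnitCoupling hH hA) hpair (neg_le_self hT) (fun ω => scattering_start H A α σ T ω) hstart
    (fun t ω => scattering_mul_conjTranspose hH t ω) hJ0 hJ
    (mul_le_mul_of_nonneg_left hU zero_le_four) hF hFp hFm hv (α * gaussianFilter σ (-T))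
    (α * gaussianFilter σ T)
  simp only [freeHamiltonian_commutator_eq hH]
  refine hmain.trans (mul_le_mul_of_nonneg_right ?_ ?_)
  · have h1 : ∫ r in (-T)..T, |α * gaussianFilterDeriv σ r| ≤ |α| * (2 * gaussianPeak σ) := by
      simp only [abs_mul, intervalIntegral.integral_const_mul]
      exact mul_le_mul_of_nonneg_left (integral_abs_gaussianFilterDeriv_le hσ hT) (abs_nonneg α)
    linarith [hle (-T), hle T]
  · unfold insertionConst
    positivity

/-- The change of an expectation value in one interaction, averaged over the frequency. -/
lemma norm_integral_interactionStep_sub_le [Nonempty d] (hH : H.IsHermitian) (hA : ‖A‖ ≤ 1)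
    (hG : IsSymmetrisedDensity G M) (hβ : 0 ≤ β) (hσ : 0 < σ) (hT : 0 ≤ T) {O : Matrix d d ℂ}
    (hO : ‖O‖ ≤ 1) :
    ‖∫ ω, (G ω : ℂ) * ((O * interactionStep H A α β σ T ω (gibbsState β H)).trace -
      (O * gibbsState β H).trace)‖ ≤ β * (8 * (4 * (|α| * gaussianPeak σ) *
        (2 * insertionConst (couplingConst M α σ) (4 * (|α| * (4 * √σ)))))) := by
  have hW := isUnitCoupling hH hA
  have hpair := isPropagatorPair_scattering (A := A) (α := α) (σ := σ) (T := T) hH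
  have hv : Continuous fun t => α * gaussianFilterDeriv σ t :=
    continuous_const.mul (continuous_gaussianFilterDeriv σ)
  have hTω : Continuous fun ω : ℝ => (T, ω) := by fun_prop
  have hR := hpair.continuous_right.comp hTω
  have hX := continuous_insertedCommutator hW hpair hv (-T) T (α * gaussianFilter σ (-T))
    (α * gaussianFilter σ T)
  have hXB := norm_insertedCommutator_le hW hpair hv (neg_le_self hT) (α * gaussianFilter σ (-T))
    (α * gaussianFilter σ T)
  simp only [← freeHamiltonian_commutator_eq hH] at hX hXB
  have heq : ∀ ω, (O * interactionStep H A α β σ T ω (gibbsState β H)).trace -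
      (O * gibbsState β H).trace = cutExpectation H (heisenberg H O T) β ω 0
        (scattering H A α σ T T ω) (scattering H A α σ T T ω)ᴴ - cutExpectation H (heisenberg H O T)
          β ω β (scattering H A α σ T T ω) (scattering H A α σ T T ω)ᴴ := fun ω => by
    rw [trace_mul_interactionStep_gibbsState hH, cutExpectation_end hH]
  simp only [heq]
  refine norm_integral_cutExpectation_sub_le hH ((norm_heisenberg_le hH O T).trans hO) hβ hG hX hR
    (fun ω => rfl) hXB (fun ω => hpair.norm_right_le T ω) fun q hq F hF hFp hFm => ?_
  exact norm_integral_commutator_le hH hA hG hσ hT hq hF (hFp A) (hFm A)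

/-- The thermal state is nearly fixed by the channel. -/
theorem traceNorm_systemBathChannel_gibbsState_sub_le [Nonempty d] (hH : H.IsHermitian)
    {𝒜 : Finset (Matrix d d ℂ)} (hne : 𝒜.Nonempty) (h𝒜 : ∀ A ∈ 𝒜, Aᴴ ∈ 𝒜)
    (h𝒜1 : ∀ A ∈ 𝒜, ‖A‖ ≤ 1) {g : ℝ → ℝ} (hg : Integrable g) (hg1 : ∫ ω, g ω = 1)
    (hG : IsSymmetrisedDensity (symmetrisedDensity g) M) (hβ : 0 ≤ β) (hσ : 0 < σ) (hT : 0 ≤ T) :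
    traceNorm (systemBathChannel H 𝒜 g α β σ T (gibbsState β H) - gibbsState β H) ≤
      32 * β * (|α| * gaussianPeak σ) * couplingConst M α σ *
        insertionConst 1 (4 * (|α| * (4 * √σ))) := by
  have hM : 0 ≤ M := (integral_nonneg fun _ => abs_nonneg _).trans hG.integral_abs_deriv_le
  have hJ0 := couplingConst_nonneg (α := α) hM hσ
  have hp := (gaussianPeak_pos hσ).le
  refine traceNorm_le_of_forall fun O hO => ?_
  set F : Matrix d d ℂ → ℝ → ℂ := fun A ω =>
    (O * interactionStep H A α β σ T ω (gibbsState β H)).trace - (O * gibbsState β H).trace with hF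
  have hi1 := fun A => integrable_weight_trace_interactionStep (H := H) (A := A) (α := α) (σ := σ)
    (T := T) hg hH O β (gibbsState β H)
  have hi2 : Integrable fun ω => (g ω : ℂ) * (O * gibbsState β H).trace := hg.ofReal.mul_const _
  have hi : ∀ A, Integrable fun ω => (g ω : ℂ) * F A ω := fun A => by
    simp only [hF, mul_sub]
    exact (hi1 A).sub hi2
  have hint : ∀ A, ∫ ω, (g ω : ℂ) * F A ω =
      (∫ ω, (g ω : ℂ) * (O * interactionStep H A α β σ T ω (gibbsState β H)).trace) -
        (O * gibbsState β H).trace := fun A => by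
    simp only [hF, mul_sub]
    rw [integral_sub (hi1 A) hi2, MeasureTheory.integral_mul_const, integral_complex_ofReal, hg1,
      Complex.ofReal_one, one_mul]
  have hcard : (𝒜.card : ℂ) ≠ 0 := by exact_mod_cast hne.card_pos.ne'
  have hkey : (O * (systemBathChannel H 𝒜 g α β σ T (gibbsState β H) - gibbsState β H)).trace =
      (𝒜.card : ℂ)⁻¹ * ∑ A ∈ 𝒜, (1 / 2) * ∫ ω, (symmetrisedDensity g ω : ℂ) * F A ω := by
    rw [← sum_integral_eq_symmetrised h𝒜 (fun A ω => by
      simp only [hF, star_eq_conjTranspose, interactionStep_conjTranspose_neg hH]) hi]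
    simp only [hint]
    rw [Matrix.mul_sub, trace_sub, trace_mul_systemBathChannel hg hH, Finset.sum_sub_distrib,
      Finset.sum_const, nsmul_eq_mul, mul_sub, inv_mul_cancel_left₀ hcard]
  rw [hkey]
  refine norm_inv_card_mul_sum_le ?_ fun A hA => ?_
  · unfold insertionConst
    positivity
  · rw [norm_mul]
    have h := norm_integral_interactionStep_sub_le (α := α) hH (h𝒜1 A hA) hG hβ hσ hT hO
    rw [insertionConst_eq_mul] at h
    have h2 : ‖(1 / 2 : ℂ)‖ = 1 / 2 := by norm_num
    rw [h2]
    linarith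

end Drift

/-! ### Constants -/

noncomputable section Constants

open MeasureTheory

lemma couplingConst_le {M κ α σ σ₀ : ℝ} (hκ : 0 < κ) (hM : κ ≤ M) (hσ₀ : 1 < σ₀) (hσ : σ₀ ≤ σ) :
    couplingConst M α σ ≤ (2 / κ + 10) * (4 + 12 / Real.log σ₀) *
      (|α| / √σ * (M * Real.log σ)) := by
  have hσ1 : 1 < σ := hσ₀.trans_le hσ
  have hσp : 0 < σ := by linarith
  have hs : 0 < √σ := Real.sqrt_pos.2 hσp
  have hℓ : 0 < Real.log σ₀ := Real.log_pos hσ₀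
  have hlog : Real.log σ₀ ≤ Real.log σ := Real.log_le_log (by linarith) hσ
  have h1 : 1 ≤ Real.log σ / Real.log σ₀ := (one_le_div hℓ).2 hlog
  have h2 : Real.log (1 + σ) ≤ Real.log σ + 1 := by
    have : Real.log (1 + σ) ≤ Real.log (2 * σ) := Real.log_le_log (by linarith) (by linarith)
    rw [Real.log_mul two_ne_zero hσp.ne'] at this
    linarith [Real.log_two_lt_d9]
  have h2' : 0 ≤ Real.log (1 + σ) := Real.log_nonneg (by linarith)
  have h3 : √σ * (1 + σ)⁻¹ ≤ 1 / √σ := by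
    rw [← div_eq_mul_inv, div_le_div_iff₀ (by linarith) hs, Real.mul_self_sqrt hσp.le]
    linarith
  have hM1 : 1 ≤ M / κ := (one_le_div hκ).2 hM
  have h4 : 2 + 10 * M ≤ (2 / κ + 10) * M := by
    have : (2 / κ + 10) * M = 2 * (M / κ) + 10 * M := by ring
    linarith
  have ha : 0 ≤ |α| := abs_nonneg α
  have h5 : 4 * (|α| * gaussianPeak σ) * Real.log (1 + σ) +
      2 * (|α| * (4 * √σ) * (1 + σ)⁻¹) ≤ (4 + 12 / Real.log σ₀) * (|α| / √σ * Real.log σ) := by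
    have e1 : 4 * (|α| * gaussianPeak σ) * Real.log (1 + σ) ≤
        4 * (|α| * (1 / √σ)) * (Real.log σ + 1) := by
      have := gaussianPeak_le hσp
      gcongr
    have e2 : 2 * (|α| * (4 * √σ) * (1 + σ)⁻¹) ≤ 8 * (|α| * (1 / √σ)) := by
      have := mul_le_mul_of_nonneg_left h3 ha
      linarith
    have e3 : (4 + 12 / Real.log σ₀) * (|α| / √σ * Real.log σ) =
        4 * (|α| * (1 / √σ)) * Real.log σ +
          12 * (|α| * (1 / √σ)) * (Real.log σ / Real.log σ₀) := by ring
    have e4 : 12 * (|α| * (1 / √σ)) * 1 ≤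
        12 * (|α| * (1 / √σ)) * (Real.log σ / Real.log σ₀) :=
      mul_le_mul_of_nonneg_left h1 (by positivity)
    linarith
  have hMp : 0 < M := hκ.trans_le hM
  unfold couplingConst
  refine (mul_le_mul h4 h5 ?_ (by positivity)).trans (le_of_eq (by ring))
  have := (gaussianPeak_pos hσp).le
  positivity

lemma insertionConst_one_mono {L L' : ℝ} (hL : 0 ≤ L) (h : L ≤ L') :
    insertionConst 1 L ≤ insertionConst 1 L' := by
  unfold insertionConst
  have hL' := hL.trans h
  gcongr

lemma insertionConst_one_pos {L : ℝ} (hL : 0 ≤ L) : 0 < insertionConst 1 L := by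
  unfold insertionConst
  positivity

end Constants

theorem mainTheorem1
    (cα cβ cT cα' κ σ₀ : ℝ) (hcα : 0 < cα) (hcβ : 0 < cβ) (hcT : 0 < cT) (hcα' : 0 < cα')
    (hκ : 0 < κ) (hσ₀ : 1 < σ₀) :
    ∃ C m : ℝ, 0 < C ∧ 0 < m ∧
      ∀ (N : ℕ) (H : Matrix (Fin N) (Fin N) ℂ) (𝒜 : Finset (Matrix (Fin N) (Fin N) ℂ))
        (g : ℝ → ℝ) (α β σ T : ℝ),
        H.IsHermitian →
        𝒜.Nonempty → (∀ A ∈ 𝒜, -A ∈ 𝒜) → (∀ A ∈ 𝒜, A.conjTranspose ∈ 𝒜) →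
        (∀ A ∈ 𝒜, opNorm A ≤ 1) →
        (∀ ω, 0 ≤ g ω) → MeasureTheory.Integrable g → ∫ ω, g ω = 1 →
        0 ≤ β →
        Filter.Tendsto (gammaFilter g β) (Filter.cocompact ℝ) (nhds 0) →
        HasL1Deriv (gammaFilter g β) → HasL1Deriv (gammaTilde g β) →
        κ ≤ l1NormDeriv (gammaFilter g β) + l1NormDeriv (gammaTilde g β) →
        σ₀ ≤ σ → |α| ≤ cα / Real.sqrt σ → cβ * β ≤ σ → cT * σ ≤ T →
        traceNorm (systemBathChannel H 𝒜 g α β σ T (gibbsState β H) - gibbsState β H)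
            ≤ C * thermalErrorBound g α β σ T
        ∧ (∀ (τ : ℕ) (ρ : Matrix (Fin N) (Fin N) ℂ),
            IsMixingTime (systemBathChannel H 𝒜 g α β σ T) τ →
            IsDensityMatrix ρ → systemBathChannel H 𝒜 g α β σ T ρ = ρ →
            traceNorm (ρ - gibbsState β H) ≤ C * (τ * thermalErrorBound g α β σ T))
        ∧ |α| * (∫ t in (-T)..T, gaussianFilter σ t) ≤ C
        ∧ (cα' / Real.sqrt σ ≤ |α| → m ≤ |α| * (∫ t in (-T)..T, gaussianFilter σ t)) := by
  set K : ℝ := insertionConst 1 (16 * cα) with hK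
  have hKpos : 0 < K := insertionConst_one_pos (by positivity)
  have hℓ : 0 < Real.log σ₀ := Real.log_pos hσ₀
  set C₁ : ℝ := 32 * ((2 / κ + 10) * (4 + 12 / Real.log σ₀)) * K with hC₁
  have hC₁pos : 0 < C₁ := by positivity
  set m₀ : ℝ := 2 * cT * ((2 * Real.pi) ^ (1 / 4 : ℝ))⁻¹ * Real.exp (-cT ^ 2 / 4) with hm₀
  have hm₀pos : 0 < m₀ := by positivity
  -- The drift needs `C₁`, the distance of a fixed point `2 * C₁`, the cumulative coupling `4 * cα`.
  refine ⟨2 * C₁ + 4 * cα, cα' * m₀, by positivity, by positivity, ?_⟩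
  intro N H 𝒜 g α β σ T hH hne _ h𝒜 h𝒜1 hg0 hg hg1 hβ hlim h1 h2 hM hσ hα _ hT
  have hσ1 : 1 < σ := hσ₀.trans_le hσ
  have hσp : 0 < σ := by linarith
  have hs : 0 < √σ := Real.sqrt_pos.2 hσp
  have hTp : 0 < T := lt_of_lt_of_le (by positivity) hT
  have hαs : |α| * √σ ≤ cα := (le_div_iff₀ hs).1 hα
  have hlog : 0 < Real.log σ := Real.log_pos hσ1
  set M := l1NormDeriv (gammaFilter g β) + l1NormDeriv (gammaTilde g β) with hMdef
  have hMp : 0 < M := hκ.trans_le hM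
  have hE1 : β * α ^ 2 / σ * (M * Real.log σ) ≤ thermalErrorBound g α β σ T :=
    le_add_of_nonneg_right (by positivity)
  have hE0 : 0 ≤ thermalErrorBound g α β σ T := le_trans (by positivity) hE1
  have hdrift : traceNorm (systemBathChannel H 𝒜 g α β σ T (gibbsState β H) - gibbsState β H) ≤
      C₁ * thermalErrorBound g α β σ T := by
    rcases Nat.eq_zero_or_pos N with hN | hN
    · -- There are no states in dimension zero: both sides of the difference are the empty matrix.
      subst hN
      rw [Subsingleton.elim (systemBathChannel H 𝒜 g α β σ T (gibbsState β H) - gibbsState β H) 0,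
        traceNorm_zero]
      positivity
    · have : Nonempty (Fin N) := ⟨⟨0, hN⟩⟩
      have h := traceNorm_systemBathChannel_gibbsState_sub_le (α := α) hH hne h𝒜 h𝒜1 hg hg1
        (isSymmetrisedDensity hg0 hg hg1 hlim h1 h2) hβ hσp hTp.le
      refine h.trans (le_trans ?_ (mul_le_mul_of_nonneg_left hE1 hC₁pos.le))
      have e1 : |α| * gaussianPeak σ ≤ |α| / √σ :=
        (mul_le_mul_of_nonneg_left (gaussianPeak_le hσp) (abs_nonneg α)).trans
          (le_of_eq (by ring))
      have e2 := couplingConst_le (α := α) hκ hM hσ₀ hσ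
      have e3 : insertionConst 1 (4 * (|α| * (4 * √σ))) ≤ K :=
        insertionConst_one_mono (by positivity) (by linarith)
      have e4 : (|α| / √σ) * (|α| / √σ) = α ^ 2 / σ := by
        rw [div_mul_div_comm, Real.mul_self_sqrt hσp.le, ← sq, sq_abs]
      have e5 := couplingConst_nonneg (α := α) hMp.le hσp
      calc _ ≤ 32 * β * (|α| / √σ) * ((2 / κ + 10) * (4 + 12 / Real.log σ₀) *
            (|α| / √σ * (M * Real.log σ))) * K := by
            have := (insertionConst_one_pos (L := 4 * (|α| * (4 * √σ))) (by positivity)).le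
            gcongr
        _ = 32 * ((2 / κ + 10) * (4 + 12 / Real.log σ₀)) * K * β *
            ((|α| / √σ) * (|α| / √σ)) * (M * Real.log σ) := by ring
        _ = _ := by rw [e4, hC₁]; ring
  refine ⟨?_, ?_, ?_, ?_⟩
  · refine hdrift.trans (mul_le_mul_of_nonneg_right ?_ hE0)
    linarith
  · intro τ ρ hτ hρ hfix
    have hgoal : traceNorm (ρ - gibbsState β H) ≤
        2 * (τ * (C₁ * thermalErrorBound g α β σ T)) → traceNorm (ρ - gibbsState β H) ≤
          (2 * C₁ + 4 * cα) * (τ * thermalErrorBound g α β σ T) := fun h => by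
      have : 0 ≤ 4 * cα * (τ * thermalErrorBound g α β σ T) := by positivity
      linarith
    apply hgoal
    by_cases hρσ : ρ = gibbsState β H
    · rw [hρσ, sub_self, traceNorm_zero]
      positivity
    · have hN : Nonempty (Fin N) := by
        by_contra hN
        rw [not_nonempty_iff] at hN
        exact hρσ (Subsingleton.elim _ _)
      have hpos : 0 < traceNorm (ρ - gibbsState β H) :=
        (traceNorm_nonneg _).lt_of_ne fun h0 => hρσ (sub_eq_zero.1 (traceNorm_eq_zero h0.symm))
      have hhalf := hτ.1 ρ (gibbsState β H) hρ (isDensityMatrix_gibbsState hH β) hρσ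
      rw [div_le_iff₀ hpos] at hhalf
      refine (traceNorm_sub_le_of_halving (systemBathChannel_sub hg hH 𝒜 α β σ T)
        (traceNorm_systemBathChannel_le hg0 hg hg1 hH 𝒜 α β σ T) hfix (τ := τ)
        (by linarith)).trans ?_
      gcongr
  · have h := mul_le_mul_of_nonneg_left (integral_gaussianFilter_le hσp hTp.le) (abs_nonneg α)
    linarith
  · intro hα'
    have h := le_integral_gaussianFilter hσp hcT hT
    have h3 : cα' ≤ |α| * √σ := (div_le_iff₀ hs).1 hα'
    calc cα' * m₀ ≤ |α| * √σ * m₀ := mul_le_mul_of_nonneg_right h3 hm₀pos.le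
      _ = |α| * (m₀ * √σ) := by ring
      _ ≤ _ := mul_le_mul_of_nonneg_left h (abs_nonneg α)
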